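/- **Conventions.** A *tangent category* $(\mathbb X,\mathbb T)$ is a category $\mathbb X$ with an endofunctor $T$ and natural transformations $p\colon T\Rightarrow \mathrm{id}$, $z\colon \mathrm{id}\Rightarrow T$, $s\colon T_2\Rightarrow T$, $l\colon T\Rightarrow T^2$, $c\colon T^2\Rightarrow T^2$ satisfying the usual Cockett–Cruttwell axioms: all $n$-fold pullbacks $T_nM$ ($n\ge 1$) of $p_M$ along itself exist and are preserved by all iterates of $T$; $(p_M,z_M,s_M)$ is an additive bundle; $(z,l)$ and $(\mathrm{id},c)$ are additive bundle morphisms; the coherences of $l$ and $c$ hold; and the vertical lift is universal. A *$T$-pullback* is a pullback preserved by all iterates $T^k$, $k\ge 0$. A morphism $q\colon E\to M$ is *étale* if the naturality square of $p$ at $q$ is a $T$-pullback. *Restriction categories.* A restriction category is a category in which every $f\colon A\to B$ has an idempotent $\bar f\colon A\to A$ with $f\bar f=f$, $\bar f\bar g=\bar g\bar f$, $\overline{g\bar f}=\bar g\bar f$ and $\bar g f=f\,\overline{gf}$ (whenever these make sense); it is *split* if all $\bar f$ split, and $f$ is *total* if $\bar f=\mathrm{id}$. A *restriction functor* preserves $f\mapsto\bar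 f$. A *restriction pullback* of $f\colon B\to A$ and $g\colon C\to A$ is a commutative square with total projections $\pi_1\colon P\to B$, $\pi_2\colon P\to C$ such that for all $b\colon X\to B$, $e\colon X\to C$ with $fb\bar e=ge\bar b$ there is a unique $t\colon X\to P$ with $\pi_1t=b\bar e$ and $\pi_2t=e\bar b$; $n$-fold restriction pullbacks are defined analogously. *The 2-category $\mathscr M\text{-}\mathsf{TngCat}$.* An object is a tangent category $(\mathbb X,\mathbb T)$ with a class $\mathscr M$ of étale monomorphisms containing all isomorphisms, closed under composition and under $T$, and such that every $m\in\mathscr M$ has along every morphism $f$ into its codomain a $T$-pullback whose projection opposite to $m$ is again in $\mathscr M$. A 1-morphism $(\mathbb X,\mathbb T;\mathscr M)\to(\mathbb X',\mathbb T';\mathscr M')$ is a lax tangent morphism $(F,\alpha)$, that is, a functor $F$ with a natural transformation $\alpha\colon FT\Rightarrow T'F$ which is additive and compatible with $l$ and $c$, such that $F$ maps $\mathscr M$ into $\mathscr M'$ and preserves pullbacks along morphisms of $\mathscr M$, and such that $\alpha$ is $\mathscr M$-natural: its naturality squares at all $m\in\mathscr M$ are pullbacks. A 2-morphism $(F,\alpha)\Rightarrow(G,\beta)$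 is an $\mathscr M$-natural transformation $\varphi\colon F\Rightarrow G$ with $T'\varphi\circ\alpha=\beta\circ\varphi T$. *The 2-category $\mathsf{TngsRstr}$.* An object is a split restriction category with a tangent restriction structure: a restriction functor $T$ and total natural transformations $p,z,s,l,c$ satisfying the axioms of a tangent structure, where the required pullbacks are replaced by restriction pullbacks preserved by all iterates of $T$. A 1-morphism is a lax tangent morphism $(F,\alpha)$ with $F$ a restriction functor and all components of $\alpha$ total. A 2-morphism is a natural transformation with total components that is compatible with the distributive laws as above. *Partial maps.* For a tangent $\mathscr M$-category, $\mathrm{Par}(\mathbb X,\mathscr M)$ is the split restriction category with the objects of $\mathbb X$, whose morphisms $A\to B$ are isomorphism classes $[m,f]$ of spans $A\xleftarrow{m}S\xrightarrow{f}B$ with $m\in\mathscr M$, composed by pullback, and with $\overline{[m,f]}=[m,m]$. A functor $F$ which preserves $\mathscr M$ and pullbacks along $\mathscr M$ induces $\mathrm{Par}(F)\colon[m,f]\mapsto[Fm,Ff]$, and an $\mathscr M$-natural transformation $\varphi$ induces the transformation with components $[\mathrm{id},\varphi_A]$. **Theorem.** There is a (strict) 2-equivalence between the 2-category $\mathscr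 M\text{-}\mathsf{TngCat}$ of tangent $\mathscr M$-categories and the 2-category $\mathsf{TngsRstr}$ of tangent split restriction categories, i.e. 2-functors in both directions whose composites are 2-naturally isomorphic to the identities. It can be chosen so that each tangent $\mathscr M$-category $(\mathbb X,\mathbb T;\mathscr M)$ is sent to the tangent split restriction category with underlying split restriction category $\mathrm{Par}(\mathbb X,\mathscr M)$ and tangent structure $(\mathrm{Par}(T),\mathrm{Par}(p),\mathrm{Par}(z),\mathrm{Par}(s),\mathrm{Par}(l),\mathrm{Par}(c))$; in particular, the functors $T,T_2$ preserve $\mathscr M$ and pullbacks along $\mathscr M$, the structural transformations are $\mathscr M$-natural, and the resulting data form a tangent restriction structure. -/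

import Mathlib

open CategoryTheory

universe v u v' u' v'' u''

namespace TangentCats

/-! ### Tangent structures: data and equational axioms -/

section Data

variable {C : Type u} [Category.{v} C]

/-- The data `(q, z, s)` of an additive bundle `q : E ⟶ B`, with the 2-fold pullback `E₂` of `q`. -/
structure BundleData (C : Type u) [Category.{v} C] where
  B : C
  E : C
  E₂ : C
  q : E ⟶ B
  zero : B ⟶ E
  fst : E₂ ⟶ E
  snd : E₂ ⟶ E
  sum : E₂ ⟶ E

/-- The image of the data of an additive bundle under a functor. -/
def BundleData.map {C' : Type u'} [Category.{v'} C'] (F : C ⥤ C') (Q : BundleData C) :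
    BundleData C' where
  B := F.obj Q.B
  E := F.obj Q.E
  E₂ := F.obj Q.E₂
  q := F.map Q.q
  zero := F.map Q.zero
  fst := F.map Q.fst
  snd := F.map Q.snd
  sum := F.map Q.sum

/-- The equations of an additive bundle.  The universal property of `E₂` and the existence of
the `n`-fold pullbacks are imposed separately. -/
structure BundleData.IsAdditive (Q : BundleData C) : Prop where
  zero_q : Q.zero ≫ Q.q = 𝟙 Q.B
  sum_q : Q.sum ≫ Q.q = Q.fst ≫ Q.q
  /-- With `u = ⟨a, b⟩`, `v = ⟨a + b, c⟩`, `w = ⟨b, c⟩`, `w' = ⟨a, b + c⟩`, this says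
  `(a + b) + c = a + (b + c)`. -/
  assoc : ∀ {Z : C} (u v w w' : Z ⟶ Q.E₂),
    v ≫ Q.fst = u ≫ Q.sum → w ≫ Q.fst = u ≫ Q.snd → w ≫ Q.snd = v ≫ Q.snd →
    w' ≫ Q.fst = u ≫ Q.fst → w' ≫ Q.snd = w ≫ Q.sum → v ≫ Q.sum = w' ≫ Q.sum
  unit : ∃ h : Q.E ⟶ Q.E₂, h ≫ Q.fst = Q.q ≫ Q.zero ∧ h ≫ Q.snd = 𝟙 Q.E ∧ h ≫ Q.sum = 𝟙 Q.E
  comm : ∃ τ : Q.E₂ ⟶ Q.E₂, τ ≫ Q.fst = Q.snd ∧ τ ≫ Q.snd = Q.fst ∧ τ ≫ Q.sum = Q.sum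

/-- `(f, g)` is an additive bundle morphism `P ⟶ Q`; the map `h` is `g ×_f g`. -/
structure IsAdditiveMorphism (P Q : BundleData C) (f : P.B ⟶ Q.B) (g : P.E ⟶ Q.E) : Prop where
  comp_q : g ≫ Q.q = P.q ≫ f
  zero_comp : P.zero ≫ g = f ≫ Q.zero
  sum_comp : ∃ h : P.E₂ ⟶ Q.E₂,
    h ≫ Q.fst = P.fst ≫ g ∧ h ≫ Q.snd = P.snd ≫ g ∧ h ≫ Q.sum = P.sum ≫ g

/-- The data `(T, p, z, s, l, c)` of a tangent structure, with the functor `T₂` and its two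
projections. -/
structure TangentData (C : Type u) [Category.{v} C] where
  T : C ⥤ C
  p : T ⟶ 𝟭 C
  z : 𝟭 C ⟶ T
  T₂ : C ⥤ C
  π₁ : T₂ ⟶ T
  π₂ : T₂ ⟶ T
  s : T₂ ⟶ T
  l : T ⟶ T ⋙ T
  c : T ⋙ T ⟶ T ⋙ T

/-- The iterates of an endofunctor. -/
def iter (T : C ⥤ C) : ℕ → (C ⥤ C)
  | 0 => 𝟭 C
  | n + 1 => iter T n ⋙ T

/-- The additive bundle `p_A = (p_A, z_A, s_A)` on the tangent bundle of `A`. -/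
def TangentData.bundle (D : TangentData C) (A : C) : BundleData C where
  B := A
  E := D.T.obj A
  E₂ := D.T₂.obj A
  q := D.p.app A
  zero := D.z.app A
  fst := D.π₁.app A
  snd := D.π₂.app A
  sum := D.s.app A

/-- The equational axioms of a tangent structure. -/
structure TangentData.Equations (D : TangentData C) : Prop where
  additive : ∀ A, (D.bundle A).IsAdditive
  lift_additive : ∀ A,
    IsAdditiveMorphism (D.bundle A) ((D.bundle A).map D.T) (D.z.app A) (D.l.app A)
  flip_additive : ∀ A,
    IsAdditiveMorphism ((D.bundle A).map D.T) (D.bundle (D.T.obj A)) (𝟙 (D.T.obj A)) (D.c.app A)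
  lift_coassoc : ∀ A, D.l.app A ≫ D.T.map (D.l.app A) = D.l.app A ≫ D.l.app (D.T.obj A)
  lift_flip : ∀ A, D.l.app A ≫ D.c.app A = D.l.app A
  lift_flip_flip : ∀ A, D.l.app (D.T.obj A) ≫ D.T.map (D.c.app A) ≫ D.c.app (D.T.obj A) =
    D.c.app A ≫ D.T.map (D.l.app A)
  flip_flip : ∀ A, D.c.app A ≫ D.c.app A = 𝟙 _
  yang_baxter : ∀ A, D.T.map (D.c.app A) ≫ D.c.app (D.T.obj A) ≫ D.T.map (D.c.app A) =
    D.c.app (D.T.obj A) ≫ D.T.map (D.c.app A) ≫ D.c.app (D.T.obj A)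

/-- `v` is the map `z_T × l : T₂ A ⟶ T (T₂ A)`. -/
def TangentData.IsLiftPair (D : TangentData C) (A : C)
    (v : D.T₂.obj A ⟶ D.T.obj (D.T₂.obj A)) : Prop :=
  v ≫ D.T.map (D.π₁.app A) = D.π₁.app A ≫ D.z.app (D.T.obj A) ∧
  v ≫ D.T.map (D.π₂.app A) = D.π₂.app A ≫ D.l.app A

/-- The maps `π i` exhibit their common source as the `n`-fold pullback of `q` along itself
(for `n ≥ 1`). -/
def IsNFoldPullback {P E B : C} {n : ℕ} (q : E ⟶ B) (π : Fin n → (P ⟶ E)) : Prop :=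
  (∀ i j, π i ≫ q = π j ≫ q) ∧
  ∀ (Z : C) (b : Fin n → (Z ⟶ E)), (∀ i j, b i ≫ q = b j ≫ q) → ∃! t : Z ⟶ P, ∀ i, t ≫ π i = b i

/-- `D` is a tangent structure, so that `(C, D)` is a tangent category. -/
structure TangentData.IsTangent (D : TangentData C) : Prop where
  equations : D.Equations
  /-- `T₂ A` is the 2-fold `T`-pullback of `p_A`. -/
  pullback₂ : ∀ (A : C) (k : ℕ),
    IsPullback ((iter D.T k).map (D.π₁.app A)) ((iter D.T k).map (D.π₂.app A))
      ((iter D.T k).map (D.p.app A)) ((iter D.T k).map (D.p.app A))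
  /-- All `n`-fold `T`-pullbacks of `p_A` exist. -/
  pullbackN : ∀ (A : C) (n : ℕ), 1 ≤ n → ∃ (P : C) (π : Fin n → (P ⟶ D.T.obj A)),
    ∀ k : ℕ, IsNFoldPullback ((iter D.T k).map (D.p.app A)) (fun i => (iter D.T k).map (π i))
  /-- The tangent bundle is locally linear. -/
  linear : ∀ A : C, ∃ v, D.IsLiftPair A v ∧
    IsPullback (v ≫ D.T.map (D.s.app A)) (D.π₁.app A ≫ D.p.app A)
      (D.T.map (D.p.app A)) (D.z.app A)

variable {C' : Type u'} [Category.{v'} C'] {C'' : Type u''} [Category.{v''} C'']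

/-- `(F, α)` is a lax tangent morphism. -/
structure IsLaxTangent (D : TangentData C) (D' : TangentData C') (F : C ⥤ C')
    (α : D.T ⋙ F ⟶ F ⋙ D'.T) : Prop where
  additive : ∀ A, IsAdditiveMorphism ((D.bundle A).map F) (D'.bundle (F.obj A))
    (𝟙 (F.obj A)) (α.app A)
  lift : ∀ A, F.map (D.l.app A) ≫ α.app (D.T.obj A) ≫ D'.T.map (α.app A) =
    α.app A ≫ D'.l.app (F.obj A)
  flip : ∀ A, F.map (D.c.app A) ≫ α.app (D.T.obj A) ≫ D'.T.map (α.app A) =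
    α.app (D.T.obj A) ≫ D'.T.map (α.app A) ≫ D'.c.app (F.obj A)

/-- `φ` is a tangent natural transformation from `(F, α)` to `(G, β)`. -/
def IsTangentTrans (D : TangentData C) (D' : TangentData C') {F G : C ⥤ C'}
    (α : D.T ⋙ F ⟶ F ⋙ D'.T) (β : D.T ⋙ G ⟶ G ⋙ D'.T) (φ : F ⟶ G) : Prop :=
  ∀ A, α.app A ≫ D'.T.map (φ.app A) = φ.app (D.T.obj A) ≫ β.app A

/-- The identity distributive law. -/
def idLaw (D : TangentData C) : D.T ⋙ 𝟭 C ⟶ 𝟭 C ⋙ D.T where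
  app A := 𝟙 (D.T.obj A)

/-- The distributive law of the composite of `(F, α)` and `(G, β)`. -/
def compLaw {D : TangentData C} {D' : TangentData C'} {D'' : TangentData C''}
    {F : C ⥤ C'} {G : C' ⥤ C''} (α : D.T ⋙ F ⟶ F ⋙ D'.T) (β : D'.T ⋙ G ⟶ G ⋙ D''.T) :
    D.T ⋙ (F ⋙ G) ⟶ (F ⋙ G) ⋙ D''.T where
  app A := G.map (α.app A) ≫ β.app (F.obj A)
  naturality A B f := by
    have h1 := α.naturality f
    have h2 := β.naturality (F.map f)
    dsimp at h1 h2 ⊢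
    rw [← Category.assoc, ← G.map_comp, h1, G.map_comp, Category.assoc, h2, Category.assoc]

theorem isLaxTangent_id (D : TangentData C) : IsLaxTangent D D (𝟭 C) (idLaw D) where
  additive A :=
    ⟨by simp [idLaw, TangentData.bundle, BundleData.map],
     by simp [idLaw, TangentData.bundle, BundleData.map],
     𝟙 _, by simp [idLaw, TangentData.bundle, BundleData.map]⟩
  lift A := by simp [idLaw]
  flip A := by simp [idLaw]

theorem isLaxTangent_comp {D : TangentData C} {D' : TangentData C'} {D'' : TangentData C''}
    {F : C ⥤ C'} {G : C' ⥤ C''} {α : D.T ⋙ F ⟶ F ⋙ D'.T} {β : D'.T ⋙ G ⟶ G ⋙ D''.T}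
    (hα : IsLaxTangent D D' F α) (hβ : IsLaxTangent D' D'' G β) :
    IsLaxTangent D D'' (F ⋙ G) (compLaw α β) where
  additive A := by
    obtain ⟨a1, a2, h, a3, a4, a5⟩ := hα.additive A
    obtain ⟨b1, b2, k, b3, b4, b5⟩ := hβ.additive (F.obj A)
    dsimp [TangentData.bundle, BundleData.map] at a1 a2 h a3 a4 a5 b1 b2 k b3 b4 b5
    refine ⟨?_, ?_, G.map h ≫ k, ?_, ?_, ?_⟩ <;>
      dsimp [compLaw, TangentData.bundle, BundleData.map]
    · rw [Category.assoc, b1, Category.comp_id, Category.comp_id, ← G.map_comp, a1,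
        Category.comp_id]
    · rw [← Category.assoc, ← G.map_comp, a2, G.map_comp, Category.assoc, b2]; simp
    · rw [Category.assoc, b3, ← Category.assoc, ← G.map_comp, a3, G.map_comp, Category.assoc]
    · rw [Category.assoc, b4, ← Category.assoc, ← G.map_comp, a4, G.map_comp, Category.assoc]
    · rw [Category.assoc, b5, ← Category.assoc, ← G.map_comp, a5, G.map_comp, Category.assoc]
  lift A := by
    have h1 := congrArg G.map (hα.lift A)
    have h2 := hβ.lift (F.obj A)
    have h3 := β.naturality (α.app A)
    simp only [Functor.comp_obj, Functor.comp_map, Functor.map_comp, Category.assoc, compLaw]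
      at h1 h2 h3 ⊢
    rw [← reassoc_of% h3, reassoc_of% h1, h2]
  flip A := by
    have h1 := congrArg G.map (hα.flip A)
    have h2 := hβ.flip (F.obj A)
    have h3 := β.naturality (α.app A)
    simp only [Functor.comp_obj, Functor.comp_map, Functor.map_comp, Category.assoc, compLaw]
      at h1 h2 h3 ⊢
    rw [← reassoc_of% h3, reassoc_of% h1, h2, reassoc_of% h3]

end Data

/-! ### Systems of monics, `M`-functors and `M`-natural transformations -/

section Monics

variable {C : Type u} [Category.{v} C] {C' : Type u'} [Category.{v'} C']
  {C'' : Type u''} [Category.{v''} C'']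

/-- A display system of monics. -/
class IsMonicSystem (M : MorphismProperty C) : Prop where
  mono : ∀ {A B : C} (m : A ⟶ B), M m → Mono m
  iso : ∀ {A B : C} (f : A ⟶ B), IsIso f → M f
  comp : ∀ {A B D : C} (m : A ⟶ B) (n : B ⟶ D), M m → M n → M (m ≫ n)
  pullback : ∀ {A B N : C} (f : N ⟶ B) (m : A ⟶ B), M m →
    ∃ (P : C) (fst : P ⟶ N) (snd : P ⟶ A), IsPullback fst snd f m ∧ M fst

/-- An `M`-functor. -/
structure IsMFunctor (M : MorphismProperty C) (M' : MorphismProperty C') (F : C ⥤ C') : Prop where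
  map_mem : ∀ {A B : C} (m : A ⟶ B), M m → M' (F.map m)
  map_pullback : ∀ {P N A B : C} {fst : P ⟶ N} {snd : P ⟶ A} {f : N ⟶ B} {m : A ⟶ B}, M m →
    IsPullback fst snd f m → IsPullback (F.map fst) (F.map snd) (F.map f) (F.map m)

/-- An `M`-natural transformation. -/
def IsMNatural (M : MorphismProperty C) {F G : C ⥤ C'} (φ : F ⟶ G) : Prop :=
  ∀ ⦃A B : C⦄ (m : A ⟶ B), M m → IsPullback (F.map m) (φ.app A) (φ.app B) (G.map m)

variable {M : MorphismProperty C} {M' : MorphismProperty C'} {M'' : MorphismProperty C''}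

theorem IsMFunctor.id (M : MorphismProperty C) : IsMFunctor M M (𝟭 C) :=
  ⟨fun _ h => h, fun _ h => h⟩

theorem IsMFunctor.comp {F : C ⥤ C'} {G : C' ⥤ C''} (hF : IsMFunctor M M' F)
    (hG : IsMFunctor M' M'' G) : IsMFunctor M M'' (F ⋙ G) :=
  ⟨fun _ h => hG.map_mem _ (hF.map_mem _ h),
    fun hm h => hG.map_pullback (hF.map_mem _ hm) (hF.map_pullback hm h)⟩

theorem IsMNatural.of_isIso {F G : C ⥤ C'} (φ : F ⟶ G) [IsIso φ] : IsMNatural M φ :=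
  fun _ _ m _ => IsPullback.of_vert_isIso ⟨(φ.naturality m)⟩

theorem IsMNatural.comp {F G H : C ⥤ C'} {φ : F ⟶ G} {ψ : G ⟶ H} (hφ : IsMNatural M φ)
    (hψ : IsMNatural M ψ) : IsMNatural M (φ ≫ ψ) :=
  fun _ _ m hm => (hφ m hm).paste_vert (hψ m hm)

theorem IsMNatural.compLaw {D : TangentData C} {D' : TangentData C'} {D'' : TangentData C''}
    {F : C ⥤ C'} {G : C' ⥤ C''} {α : D.T ⋙ F ⟶ F ⋙ D'.T} {β : D'.T ⋙ G ⟶ G ⋙ D''.T}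
    (hF : IsMFunctor M M' F) (hG : IsMFunctor M' M'' G) (hT : ∀ {A B : C'} (m : A ⟶ B), M' m → M' (D'.T.map m))
    (hα : IsMNatural M α) (hβ : IsMNatural M' β) :
    IsMNatural M (compLaw α β) :=
  fun _ _ m hm => (hG.map_pullback (hT _ (hF.map_mem _ hm)) (hα m hm)).paste_vert
    (hβ _ (hF.map_mem _ hm))

end Monics

/-! ### Tangent categories with a tangent display system of étale monics -/

section Display

variable {C : Type u} [Category.{v} C]

/-- The square with projections `fst, snd` over `f, g` is a `T`-pullback. -/
def IsTPullback (T : C ⥤ C) {P N A B : C} (fst : P ⟶ N) (snd : P ⟶ A) (f : N ⟶ B) (g : A ⟶ B) :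
    Prop :=
  ∀ k : ℕ, IsPullback ((iter T k).map fst) ((iter T k).map snd) ((iter T k).map f)
    ((iter T k).map g)

/-- `q` is an étale map of the tangent category `(C, D)`. -/
def IsEtale (D : TangentData C) {E A : C} (q : E ⟶ A) : Prop :=
  IsTPullback D.T (D.T.map q) (D.p.app E) (D.p.app A) q

/-- `M` is a tangent display system of (étale) monics of the tangent category `(C, D)`. -/
structure IsTangentMonicSystem (D : TangentData C) (M : MorphismProperty C) : Prop where
  mono : ∀ {A B : C} (m : A ⟶ B), M m → Mono m
  etale : ∀ {A B : C} (m : A ⟶ B), M m → IsEtale D m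
  iso : ∀ {A B : C} (f : A ⟶ B), IsIso f → M f
  comp : ∀ {A B E : C} (m : A ⟶ B) (n : B ⟶ E), M m → M n → M (m ≫ n)
  map_mem : ∀ {A B : C} (m : A ⟶ B), M m → M (D.T.map m)
  pullback : ∀ {A B N : C} (f : N ⟶ B) (m : A ⟶ B), M m →
    ∃ (P : C) (fst : P ⟶ N) (snd : P ⟶ A), IsTPullback D.T fst snd f m ∧ M fst

theorem IsTangentMonicSystem.isMonicSystem {D : TangentData C} {M : MorphismProperty C}
    (h : IsTangentMonicSystem D M) : IsMonicSystem M where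
  mono := h.mono
  iso := h.iso
  comp := h.comp
  pullback f m hm := by
    obtain ⟨P, a, b, hp, ha⟩ := h.pullback f m hm
    exact ⟨P, a, b, hp 0, ha⟩

end Display

/-! ### Restriction categories -/

/-- A restriction structure on a category. -/
class RestrictionCategory (C : Type u) [Category.{v} C] where
  res : ∀ {A B : C}, (A ⟶ B) → (A ⟶ A)
  res_comp_self : ∀ {A B : C} (f : A ⟶ B), res f ≫ f = f
  res_comm : ∀ {A B B' : C} (f : A ⟶ B) (g : A ⟶ B'), res f ≫ res g = res g ≫ res f
  res_res_comp : ∀ {A B B' : C} (f : A ⟶ B) (g : A ⟶ B'), res (res f ≫ g) = res f ≫ res g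
  comp_res : ∀ {A B E : C} (f : A ⟶ B) (g : B ⟶ E), f ≫ res g = res (f ≫ g) ≫ f

section Restriction

open RestrictionCategory

variable {C : Type u} [Category.{v} C] [RestrictionCategory C]
  {C' : Type u'} [Category.{v'} C'] [RestrictionCategory C']

/-- Total maps. -/
def IsTotal {A B : C} (f : A ⟶ B) : Prop := res f = 𝟙 A

theorem isTotal_id (A : C) : IsTotal (𝟙 A) := by
  have := res_comp_self (𝟙 A); rwa [Category.comp_id] at this

theorem isTotal_comp {A B E : C} {f : A ⟶ B} {g : B ⟶ E} (hf : IsTotal f) (hg : IsTotal g) :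
    IsTotal (f ≫ g) := by
  unfold IsTotal at *
  have h1 := comp_res f g
  rw [hg, Category.comp_id] at h1
  have h2 := res_res_comp (f ≫ g) f
  rw [← h1, hf, Category.comp_id] at h2
  exact h2.symm

variable (C) in
/-- All restriction idempotents split. -/
def IsSplit : Prop :=
  ∀ {A B : C} (f : A ⟶ B), ∃ (S : C) (m : S ⟶ A) (r : A ⟶ S), m ≫ r = 𝟙 S ∧ r ≫ m = res f

/-- A restriction pullback of `f` and `g`. -/
structure IsRestrictionPullback {P B E A : C} (fst : P ⟶ B) (snd : P ⟶ E) (f : B ⟶ A) (g : E ⟶ A) :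
    Prop where
  fst_total : IsTotal fst
  snd_total : IsTotal snd
  w : fst ≫ f = snd ≫ g
  lift : ∀ {X : C} (b : X ⟶ B) (e : X ⟶ E), res e ≫ b ≫ f = res b ≫ e ≫ g →
    ∃! t : X ⟶ P, t ≫ fst = res e ≫ b ∧ t ≫ snd = res b ≫ e

/-- The composite of the restriction idempotents of a finite family of maps out of `X`. -/
def meet {X E : C} {n : ℕ} (b : Fin n → (X ⟶ E)) : X ⟶ X :=
  (List.ofFn (fun i => res (b i))).foldr (fun e e' => e ≫ e') (𝟙 X)

/-- The maps `π i` exhibit their common source as the `n`-fold restriction pullback of `q` along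
itself (for `n ≥ 1`). -/
structure IsNFoldRestrictionPullback {P E B : C} {n : ℕ} (q : E ⟶ B) (π : Fin n → (P ⟶ E)) :
    Prop where
  total : ∀ i, IsTotal (π i)
  w : ∀ i j, π i ≫ q = π j ≫ q
  lift : ∀ {X : C} (b : Fin n → (X ⟶ E)),
    (∀ i j, res (b j) ≫ b i ≫ q = res (b i) ≫ b j ≫ q) →
    ∃! t : X ⟶ P, ∀ i, t ≫ π i = meet b ≫ b i

/-- A restriction functor. -/
def IsRestrictionFunctor (F : C ⥤ C') : Prop :=
  ∀ ⦃A B : C⦄ (f : A ⟶ B), F.map (res f) = res (F.map f)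

theorem IsRestrictionFunctor.isTotal {F : C ⥤ C'} (hF : IsRestrictionFunctor F) {A B : C}
    {f : A ⟶ B} (hf : IsTotal f) : IsTotal (F.map f) := by
  unfold IsTotal at *
  rw [← hF f, hf, F.map_id]

/-- A natural transformation all of whose components are total. -/
def IsTotalTrans {K : Type u'} [Category.{v'} K] {F G : K ⥤ C} (φ : F ⟶ G) : Prop :=
  ∀ A, IsTotal (φ.app A)

/-- `D` is a tangent restriction structure: as for a tangent structure, with a restriction functor
`T`, total natural transformations, and restriction pullbacks that are preserved by all iterates
of `T`.  (Totality of `π₁, π₂` is part of the definition of a restriction pullback.) -/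
structure TangentData.IsTangentRestriction (D : TangentData C) : Prop where
  T_res : IsRestrictionFunctor D.T
  p_total : IsTotalTrans D.p
  z_total : IsTotalTrans D.z
  s_total : IsTotalTrans D.s
  l_total : IsTotalTrans D.l
  c_total : IsTotalTrans D.c
  equations : D.Equations
  pullback₂ : ∀ (A : C) (k : ℕ),
    IsRestrictionPullback ((iter D.T k).map (D.π₁.app A)) ((iter D.T k).map (D.π₂.app A))
      ((iter D.T k).map (D.p.app A)) ((iter D.T k).map (D.p.app A))
  pullbackN : ∀ (A : C) (n : ℕ), 1 ≤ n → ∃ (P : C) (π : Fin n → (P ⟶ D.T.obj A)),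
    ∀ k : ℕ, IsNFoldRestrictionPullback ((iter D.T k).map (D.p.app A))
      (fun i => (iter D.T k).map (π i))
  linear : ∀ A : C, ∃ v, D.IsLiftPair A v ∧ ∀ k : ℕ,
    IsRestrictionPullback ((iter D.T k).map (v ≫ D.T.map (D.s.app A)))
      ((iter D.T k).map (D.π₁.app A ≫ D.p.app A))
      ((iter D.T k).map (D.T.map (D.p.app A))) ((iter D.T k).map (D.z.app A))

end Restriction

/-! ### The split restriction category `Par(C, M)` -/

/-- The objects of `Par(C, M)` are the objects of `C`. -/
structure Par {C : Type u} [Category.{v} C] (M : MorphismProperty C) : Type u where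
  obj : C

/-- A span from `A` to `B` whose left leg belongs to `M`. -/
structure PSpan {C : Type u} [Category.{v} C] (M : MorphismProperty C) (A B : C) :
    Type (max u v) where
  dom : C
  m : dom ⟶ A
  f : dom ⟶ B
  mem : M m

section Par

variable {C : Type u} [Category.{v} C] {M : MorphismProperty C}
  {C' : Type u'} [Category.{v'} C'] {M' : MorphismProperty C'}
  {C'' : Type u''} [Category.{v''} C''] {M'' : MorphismProperty C''}

/-- Isomorphism of spans. -/
def PSpan.Rel {A B : C} (x y : PSpan M A B) : Prop :=
  ∃ e : x.dom ≅ y.dom, e.hom ≫ y.m = x.m ∧ e.hom ≫ y.f = x.f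

instance PSpan.setoid (M : MorphismProperty C) (A B : C) : Setoid (PSpan M A B) where
  r := PSpan.Rel
  iseqv :=
    { refl := fun x => ⟨Iso.refl _, by simp, by simp⟩
      symm := by
        rintro x y ⟨e, h1, h2⟩
        exact ⟨e.symm, by simp [← h1], by simp [← h2]⟩
      trans := by
        rintro x y w ⟨e, h1, h2⟩ ⟨d, h3, h4⟩
        exact ⟨e ≪≫ d, by simp [h1, h3], by simp [h2, h4]⟩ }

/-- Partial maps: isomorphism classes of spans. -/
def ParHom (M : MorphismProperty C) (A B : C) : Type (max u v) := Quotient (PSpan.setoid M A B)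

/-- The partial map `A ←m- S -f→ B`. -/
def ParHom.mk {A B S : C} (m : S ⟶ A) (hm : M m) (f : S ⟶ B) : ParHom M A B :=
  Quotient.mk (PSpan.setoid M A B) ⟨S, m, f, hm⟩

theorem ParHom.mk_eq {A B S S' : C} {m : S ⟶ A} {hm : M m} {f : S ⟶ B} {m' : S' ⟶ A} {hm' : M m'}
    {f' : S' ⟶ B} (e : S ≅ S') (h1 : e.hom ≫ m' = m) (h2 : e.hom ≫ f' = f) :
    ParHom.mk m hm f = ParHom.mk m' hm' f' :=
  Quotient.sound ⟨e, h1, h2⟩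

theorem ParHom.mk_congr {A B S : C} {m m' : S ⟶ A} {hm : M m} {hm' : M m'} {f f' : S ⟶ B}
    (h : m = m') (h' : f = f') : ParHom.mk m hm f = ParHom.mk m' hm' f' := by
  subst h h'; rfl

theorem ParHom.ind {A B : C} {P : ParHom M A B → Prop}
    (h : ∀ (S : C) (m : S ⟶ A) (hm : M m) (f : S ⟶ B), P (ParHom.mk m hm f)) (x : ParHom M A B) :
    P x :=
  Quotient.inductionOn x fun s => h s.dom s.m s.mem s.f

/-- The restriction of `A ←m- S -f→ B` is `A ←m- S -m→ A`. -/
def ParHom.res {A B : C} (x : ParHom M A B) : ParHom M A A :=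
  Quotient.map (fun s => (⟨s.dom, s.m, s.m, s.mem⟩ : PSpan M A A))
    (by rintro _ _ ⟨e, h1, _⟩; exact ⟨e, h1, h1⟩) x

theorem ParHom.res_mk {A B S : C} {m : S ⟶ A} {hm : M m} {f : S ⟶ B} :
    ParHom.res (ParHom.mk m hm f) = ParHom.mk m hm m := rfl

/-- The action of an `M`-functor on partial maps. -/
def ParHom.map {F : C ⥤ C'} (hF : IsMFunctor M M' F) {A B : C} (x : ParHom M A B) :
    ParHom M' (F.obj A) (F.obj B) :=
  Quotient.map
    (fun s => (⟨F.obj s.dom, F.map s.m, F.map s.f, hF.map_mem _ s.mem⟩ :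
      PSpan M' (F.obj A) (F.obj B)))
    (by
      rintro _ _ ⟨e, h1, h2⟩
      exact ⟨F.mapIso e, by simp [← h1], by simp [← h2]⟩) x

theorem ParHom.map_mk {F : C ⥤ C'} (hF : IsMFunctor M M' F) {A B S : C} {m : S ⟶ A} {hm : M m}
    {f : S ⟶ B} :
    ParHom.map hF (ParHom.mk m hm f) = ParHom.mk (F.map m) (hF.map_mem _ hm) (F.map f) := rfl

theorem IsMonicSystem.of_isPullback [hM : IsMonicSystem M] {P N A B : C} {fst : P ⟶ N} {snd : P ⟶ A}
    {f : N ⟶ B} {m : A ⟶ B} (hm : M m) (h : IsPullback fst snd f m) : M fst := by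
  obtain ⟨P', a, b, h', ha⟩ := hM.pullback f m hm
  have := h.isoIsPullback_hom_fst _ _ h'
  rw [← this]
  exact hM.comp _ _ (hM.iso _ inferInstance) ha

theorem compRel [IsMonicSystem M] {A B E : C} {x x' : PSpan M A B} {y y' : PSpan M B E}
    (hx : x.Rel x') (hy : y.Rel y') {P P' : C} {a : P ⟶ x.dom} {b : P ⟶ y.dom}
    {a' : P' ⟶ x'.dom} {b' : P' ⟶ y'.dom} (h : IsPullback a b x.f y.m)
    (h' : IsPullback a' b' x'.f y'.m) (hm : M (a ≫ x.m)) (hm' : M (a' ≫ x'.m)) :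
    ParHom.mk (a ≫ x.m) hm (b ≫ y.f) = ParHom.mk (a' ≫ x'.m) hm' (b' ≫ y'.f) := by
  obtain ⟨e, e1, e2⟩ := hx
  obtain ⟨d, d1, d2⟩ := hy
  have h2 : IsPullback (a ≫ e.hom) (b ≫ d.hom) x'.f y'.m :=
    IsPullback.of_iso h (Iso.refl _) e d (Iso.refl _) (by simp) (by simp) (by simp [e2])
      (by simp [d1])
  refine ParHom.mk_eq (h2.isoIsPullback _ _ h') ?_ ?_
  · rw [h2.isoIsPullback_hom_fst_assoc, Category.assoc, e1]
  · rw [h2.isoIsPullback_hom_snd_assoc, Category.assoc, d2]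

variable [hM : IsMonicSystem M] [IsMonicSystem M'] [IsMonicSystem M'']

/-- Composition of spans by means of a chosen pullback. -/
noncomputable def PSpan.comp {A B E : C} (x : PSpan M A B) (y : PSpan M B E) : PSpan M A E where
  dom := (hM.pullback x.f y.m y.mem).choose
  m := (hM.pullback x.f y.m y.mem).choose_spec.choose ≫ x.m
  f := (hM.pullback x.f y.m y.mem).choose_spec.choose_spec.choose ≫ y.f
  mem := hM.comp _ _ (hM.pullback x.f y.m y.mem).choose_spec.choose_spec.choose_spec.2 x.mem

/-- Composition of partial maps. -/
noncomputable def ParHom.comp {A B E : C} (x : ParHom M A B) (y : ParHom M B E) : ParHom M A E :=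
  Quotient.map₂ PSpan.comp (fun x x' hx y y' hy => Quotient.exact
    (compRel hx hy (hM.pullback x.f y.m y.mem).choose_spec.choose_spec.choose_spec.1
      (hM.pullback x'.f y'.m y'.mem).choose_spec.choose_spec.choose_spec.1 (PSpan.comp x y).mem
      (PSpan.comp x' y').mem)) x y

theorem ParHom.comp_mk {A B E S R P : C} {m : S ⟶ A} {hm : M m} {f : S ⟶ B} {n : R ⟶ B} {hn : M n}
    {g : R ⟶ E} {a : P ⟶ S} {b : P ⟶ R} (h : IsPullback a b f n) :
    ParHom.comp (ParHom.mk m hm f) (ParHom.mk n hn g) =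
      ParHom.mk (a ≫ m) (hM.comp _ _ (IsMonicSystem.of_isPullback hn h) hm) (b ≫ g) :=
  compRel (x := ⟨S, m, f, hm⟩) (x' := ⟨S, m, f, hm⟩) (y := ⟨R, n, g, hn⟩) (y' := ⟨R, n, g, hn⟩)
    ⟨Iso.refl _, by simp, by simp⟩ ⟨Iso.refl _, by simp, by simp⟩
    (hM.pullback f n hn).choose_spec.choose_spec.choose_spec.1 h _ _

/-- The everywhere defined partial map given by a map of `C`. -/
def ParHom.tot {A B : C} (f : A ⟶ B) : ParHom M A B :=
  ParHom.mk (𝟙 A) (hM.iso _ inferInstance) f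

theorem ParHom.tot_comp {A B E R P : C} {f : A ⟶ B} {n : R ⟶ B} {hn : M n} {g : R ⟶ E}
    {a : P ⟶ A} {b : P ⟶ R} (h : IsPullback a b f n) :
    ParHom.comp (ParHom.tot f) (ParHom.mk n hn g) =
      ParHom.mk a (IsMonicSystem.of_isPullback hn h) (b ≫ g) :=
  (ParHom.comp_mk h).trans (ParHom.mk_congr (by simp) rfl)

theorem ParHom.comp_tot {A B E S : C} {m : S ⟶ A} {hm : M m} {f : S ⟶ B} {g : B ⟶ E} :
    ParHom.comp (ParHom.mk m hm f) (ParHom.tot g) = ParHom.mk m hm (f ≫ g) :=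
  (ParHom.comp_mk (a := 𝟙 S) (b := f) (IsPullback.of_horiz_isIso ⟨by simp⟩)).trans
    (ParHom.mk_congr (by simp) rfl)

theorem ParHom.id_comp {A B : C} (x : ParHom M A B) : ParHom.comp (ParHom.tot (𝟙 A)) x = x := by
  induction x using ParHom.ind with
  | h S m hm f =>
    exact (ParHom.tot_comp (a := m) (b := 𝟙 S) (IsPullback.of_vert_isIso ⟨by simp⟩)).trans
      (ParHom.mk_congr rfl (by simp))

theorem ParHom.comp_id {A B : C} (x : ParHom M A B) : ParHom.comp x (ParHom.tot (𝟙 B)) = x := by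
  induction x using ParHom.ind with
  | h S m hm f => exact ParHom.comp_tot.trans (ParHom.mk_congr rfl (by simp))

theorem ParHom.assoc {A B E K : C} (x : ParHom M A B) (y : ParHom M B E) (w : ParHom M E K) :
    (x.comp y).comp w = x.comp (y.comp w) := by
  induction x using ParHom.ind with
  | h S₁ m₁ h₁ f₁ =>
  induction y using ParHom.ind with
  | h S₂ m₂ h₂ f₂ =>
  induction w using ParHom.ind with
  | h S₃ m₃ h₃ f₃ =>
    obtain ⟨P, a, b, hp, ha⟩ := hM.pullback f₁ m₂ h₂
    obtain ⟨Q, a', b', hq, ha'⟩ := hM.pullback f₂ m₃ h₃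
    obtain ⟨R, a'', b'', hr, ha''⟩ := hM.pullback b a' ha'
    rw [ParHom.comp_mk hp, ParHom.comp_mk hq,
      ParHom.comp_mk (hr.paste_vert hq),
      ParHom.comp_mk (hr.paste_horiz hp)]
    exact ParHom.mk_congr (by simp) (by simp)

noncomputable instance Par.category : Category.{max u v} (Par M) where
  Hom A B := ParHom M A.obj B.obj
  id A := ParHom.tot (𝟙 A.obj)
  comp x y := ParHom.comp x y
  id_comp := ParHom.id_comp
  comp_id := ParHom.comp_id
  assoc := ParHom.assoc


theorem isPullback_self {A S : C} {m : S ⟶ A} (hm : M m) : IsPullback (𝟙 S) (𝟙 S) m m := by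
  have := hM.mono m hm
  exact IsKernelPair.id_of_mono m

theorem isPullback_left {P S A : C} (a : P ⟶ S) {m : S ⟶ A} (hm : M m) :
    IsPullback (𝟙 P) a (a ≫ m) m := by
  simpa using (IsPullback.of_horiz_isIso (fst := 𝟙 P) (snd := a) (f := a) (g := 𝟙 S)
    ⟨by simp⟩).paste_vert (isPullback_self hm)

noncomputable instance Par.restriction : RestrictionCategory (Par M) where
  res x := ParHom.res x
  res_comp_self x := by
    change ParHom.comp (ParHom.res x) x = x
    induction x using ParHom.ind with
    | h S m hm f =>
      rw [ParHom.res_mk, ParHom.comp_mk (isPullback_self hm)]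
      exact ParHom.mk_congr (by simp) (by simp)
  res_comm x y := by
    change ParHom.comp (ParHom.res x) (ParHom.res y) = ParHom.comp (ParHom.res y) (ParHom.res x)
    induction x using ParHom.ind with
    | h S m hm f =>
    induction y using ParHom.ind with
    | h R n hn g =>
      obtain ⟨P, a, b, hp, ha⟩ := hM.pullback m n hn
      rw [ParHom.res_mk, ParHom.res_mk, ParHom.comp_mk hp, ParHom.comp_mk hp.flip]
      exact ParHom.mk_congr hp.w hp.w.symm
  res_res_comp x y := by
    change ParHom.res (ParHom.comp (ParHom.res x) y) = ParHom.comp (ParHom.res x) (ParHom.res y)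
    induction x using ParHom.ind with
    | h S m hm f =>
    induction y using ParHom.ind with
    | h R n hn g =>
      obtain ⟨P, a, b, hp, ha⟩ := hM.pullback m n hn
      rw [ParHom.res_mk, ParHom.res_mk, ParHom.comp_mk hp, ParHom.comp_mk hp, ParHom.res_mk]
      exact ParHom.mk_congr rfl hp.w
  comp_res x y := by
    change ParHom.comp x (ParHom.res y) = ParHom.comp (ParHom.res (ParHom.comp x y)) x
    induction x using ParHom.ind with
    | h S m hm f =>
    induction y using ParHom.ind with
    | h R n hn g =>
      obtain ⟨P, a, b, hp, ha⟩ := hM.pullback f n hn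
      rw [ParHom.res_mk, ParHom.comp_mk hp, ParHom.comp_mk hp, ParHom.res_mk,
        ParHom.comp_mk (isPullback_left a hm)]
      exact ParHom.mk_congr (by simp) hp.w.symm

variable (M) in
theorem Par.isSplit : IsSplit (Par M) := by
  intro A B x
  change ∃ (S : Par M) (m : ParHom M S.obj A.obj) (r : ParHom M A.obj S.obj),
    ParHom.comp m r = ParHom.tot (𝟙 S.obj) ∧ ParHom.comp r m = ParHom.res x
  induction x using ParHom.ind with
  | h S m hm f =>
    refine ⟨⟨S⟩, ParHom.tot m, ParHom.mk m hm (𝟙 S), ?_, ?_⟩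
    · rw [ParHom.tot_comp (isPullback_self hm)]
      exact ParHom.mk_congr rfl (by simp)
    · rw [ParHom.comp_tot, ParHom.res_mk]
      exact ParHom.mk_congr rfl (by simp)

/-- The functor `Par(F)` induced by an `M`-functor `F`. -/
noncomputable def Par.map (F : C ⥤ C') (hF : IsMFunctor M M' F) : Par M ⥤ Par M' where
  obj A := ⟨F.obj A.obj⟩
  map x := ParHom.map hF x
  map_id A := ParHom.mk_congr (by simp) (by simp)
  map_comp x y := by
    change ParHom.map hF (ParHom.comp x y) = ParHom.comp (ParHom.map hF x) (ParHom.map hF y)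
    induction x using ParHom.ind with
    | h S m hm f =>
    induction y using ParHom.ind with
    | h R n hn g =>
      obtain ⟨P, a, b, hp, ha⟩ := hM.pullback f n hn
      rw [ParHom.map_mk, ParHom.map_mk, ParHom.comp_mk hp, ParHom.map_mk,
        ParHom.comp_mk (hF.map_pullback hn hp)]
      exact ParHom.mk_congr (by simp) (by simp)

/-- The natural transformation `Par(φ)` induced by an `M`-natural transformation `φ`. -/
noncomputable def Par.mapTrans {F G : C ⥤ C'} (hF : IsMFunctor M M' F) (hG : IsMFunctor M M' G)
    (φ : F ⟶ G) (hφ : IsMNatural M φ) : Par.map F hF ⟶ Par.map G hG where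
  app A := ParHom.tot (φ.app A.obj)
  naturality A B x := by
    change ParHom.comp (ParHom.map hF x) (ParHom.tot (φ.app B.obj)) =
      ParHom.comp (ParHom.tot (φ.app A.obj)) (ParHom.map hG x)
    induction x using ParHom.ind with
    | h S m hm f =>
      rw [ParHom.map_mk, ParHom.map_mk, ParHom.comp_tot, ParHom.tot_comp (hφ m hm)]
      exact ParHom.mk_congr rfl (by simp)

variable (M) in
/-- `Par(id) = id`. -/
noncomputable def Par.mapId : Par.map (𝟭 C) (IsMFunctor.id M) ≅ 𝟭 (Par M) :=
  NatIso.ofComponents (fun A => Iso.refl A) (by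
    intro A B x
    have h : (Par.map (𝟭 C) (IsMFunctor.id M)).map x = x := by
      change ParHom.map (IsMFunctor.id M) x = x
      induction x using ParHom.ind with
      | h S m hm f => rfl
    rw [h]
    exact (Category.comp_id _).trans (Category.id_comp _).symm)

/-- `Par(F ⋙ G) = Par(F) ⋙ Par(G)`. -/
noncomputable def Par.mapComp {F : C ⥤ C'} {G : C' ⥤ C''} (hF : IsMFunctor M M' F)
    (hG : IsMFunctor M' M'' G) :
    Par.map (F ⋙ G) (hF.comp hG) ≅ Par.map F hF ⋙ Par.map G hG :=
  NatIso.ofComponents (fun A => Iso.refl _) (by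
    intro A B x
    have h : (Par.map (F ⋙ G) (hF.comp hG)).map x = (Par.map F hF ⋙ Par.map G hG).map x := by
      change ParHom.map (hF.comp hG) x = ParHom.map hG (ParHom.map hF x)
      induction x using ParHom.ind with
      | h S m hm f => rfl
    rw [h]
    exact (Category.comp_id _).trans (Category.id_comp _).symm)

end Par

section ParTangent

variable {C : Type u} [Category.{v} C]

/-- The functors of a tangent structure are `M`-functors and its natural transformations are
`M`-natural. -/
structure TangentData.IsMStructure (D : TangentData C) (M : MorphismProperty C) : Prop where
  T : IsMFunctor M M D.T
  T₂ : IsMFunctor M M D.T₂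
  p : IsMNatural M D.p
  z : IsMNatural M D.z
  π₁ : IsMNatural M D.π₁
  π₂ : IsMNatural M D.π₂
  s : IsMNatural M D.s
  l : IsMNatural M D.l
  c : IsMNatural M D.c

/-- The tangent structure induced on `Par(C, M)`: apply `Par` to every component. -/
noncomputable def TangentData.par (D : TangentData C) (M : MorphismProperty C) [IsMonicSystem M]
    (h : D.IsMStructure M) : TangentData (Par M) where
  T := Par.map D.T h.T
  p := Par.mapTrans h.T (IsMFunctor.id M) D.p h.p ≫ (Par.mapId M).hom
  z := (Par.mapId M).inv ≫ Par.mapTrans (IsMFunctor.id M) h.T D.z h.z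
  T₂ := Par.map D.T₂ h.T₂
  π₁ := Par.mapTrans h.T₂ h.T D.π₁ h.π₁
  π₂ := Par.mapTrans h.T₂ h.T D.π₂ h.π₂
  s := Par.mapTrans h.T₂ h.T D.s h.s
  l := Par.mapTrans h.T (h.T.comp h.T) D.l h.l ≫ (Par.mapComp h.T h.T).hom
  c := (Par.mapComp h.T h.T).inv ≫ Par.mapTrans (h.T.comp h.T) (h.T.comp h.T) D.c h.c ≫
    (Par.mapComp h.T h.T).hom

end ParTangent

/-! ### The 2-category of tangent `M`-categories -/

/-- A tangent `M`-category `(C, D; M)`. -/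
structure MTangentCat where
  C : Type u
  [cat : Category.{v} C]
  D : TangentData C
  isTangent : D.IsTangent
  M : MorphismProperty C
  isMonicSystem : IsTangentMonicSystem D M

namespace MTangentCat

attribute [instance] cat

instance (X : MTangentCat.{v, u}) : IsMonicSystem X.M := X.isMonicSystem.isMonicSystem

/-- A lax tangent morphism `(F, α)` with `F` an `M`-functor and `α` an `M`-natural
transformation. -/
@[ext]
structure Hom (X Y : MTangentCat.{v, u}) where
  F : X.C ⥤ Y.C
  α : X.D.T ⋙ F ⟶ F ⋙ Y.D.T
  isM : IsMFunctor X.M Y.M F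
  α_M : IsMNatural X.M α
  isLax : IsLaxTangent X.D Y.D F α

/-- The identity 1-morphism. -/
def Hom.id (X : MTangentCat.{v, u}) : Hom X X where
  F := 𝟭 X.C
  α := idLaw X.D
  isM := IsMFunctor.id X.M
  α_M := fun A B m _ =>
    haveI : IsIso ((idLaw X.D).app A) := inferInstanceAs (IsIso (𝟙 (X.D.T.obj A)))
    haveI : IsIso ((idLaw X.D).app B) := inferInstanceAs (IsIso (𝟙 (X.D.T.obj B)))
    IsPullback.of_vert_isIso ⟨(idLaw X.D).naturality m⟩
  isLax := isLaxTangent_id X.D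

/-- Composition of 1-morphisms. -/
def Hom.comp {X Y Z : MTangentCat.{v, u}} (f : Hom X Y) (g : Hom Y Z) : Hom X Z where
  F := f.F ⋙ g.F
  α := compLaw f.α g.α
  isM := f.isM.comp g.isM
  α_M := IsMNatural.compLaw f.isM g.isM Y.isMonicSystem.map_mem f.α_M g.α_M
  isLax := isLaxTangent_comp f.isLax g.isLax

instance : CategoryStruct MTangentCat.{v, u} where
  Hom := Hom
  id := Hom.id
  comp := Hom.comp

/-- An `M`-natural transformation that is a tangent natural transformation. -/
@[ext]
structure Hom₂ {X Y : MTangentCat.{v, u}} (f g : X ⟶ Y) where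
  φ : f.F ⟶ g.F
  isM : IsMNatural X.M φ
  isTangent : IsTangentTrans X.D Y.D f.α g.α φ

/-- The identity 2-morphism. -/
def Hom₂.id {X Y : MTangentCat.{v, u}} (f : X ⟶ Y) : Hom₂ f f where
  φ := 𝟙 f.F
  isM := IsMNatural.of_isIso _
  isTangent A := by simp

/-- Vertical composition of 2-morphisms. -/
def Hom₂.comp {X Y : MTangentCat.{v, u}} {f g h : X ⟶ Y} (a : Hom₂ f g) (b : Hom₂ g h) :
    Hom₂ f h where
  φ := a.φ ≫ b.φ
  isM := a.isM.comp b.isM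
  isTangent A := by
    have h1 := a.isTangent A
    have h2 := b.isTangent A
    simp only [NatTrans.comp_app, Functor.map_comp, Category.assoc]
    rw [reassoc_of% h1, h2]

instance (X Y : MTangentCat.{v, u}) : Category (X ⟶ Y) where
  Hom f g := Hom₂ f g
  id f := Hom₂.id f
  comp a b := Hom₂.comp a b
  id_comp a := Hom₂.ext (Category.id_comp a.φ)
  comp_id a := Hom₂.ext (Category.comp_id a.φ)
  assoc a b c := Hom₂.ext (Category.assoc a.φ b.φ c.φ)

theorem hom₂_ext {X Y : MTangentCat.{v, u}} {f g : X ⟶ Y} {a b : f ⟶ g}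
    (h : ∀ A, (Hom₂.φ a).app A = (Hom₂.φ b).app A) : a = b :=
  Hom₂.ext (NatTrans.ext (funext h))

theorem id_app {X Y : MTangentCat.{v, u}} (f : X ⟶ Y) (A : X.C) :
    (Hom₂.φ (𝟙 f)).app A = 𝟙 (f.F.obj A) := rfl

theorem comp_app {X Y : MTangentCat.{v, u}} {f g h : X ⟶ Y} (a : f ⟶ g) (b : g ⟶ h)
    (A : X.C) : (Hom₂.φ (a ≫ b)).app A = (Hom₂.φ a).app A ≫ (Hom₂.φ b).app A := rfl

theorem eqToHom_app {X Y : MTangentCat.{v, u}} {f g : X ⟶ Y} (h : f = g) (A : X.C) :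
    (Hom₂.φ (eqToHom h)).app A = eqToHom (congrArg (fun k : X ⟶ Y => k.F.obj A) h) := by
  subst h; rfl

/-- Whiskering on the left. -/
def whiskerLeft {X Y Z : MTangentCat.{v, u}} (f : X ⟶ Y) {g h : Y ⟶ Z} (a : g ⟶ h) :
    f ≫ g ⟶ f ≫ h where
  φ := Functor.whiskerLeft f.F (Hom₂.φ a)
  isM := fun _ _ m hm => Hom₂.isM a _ (f.isM.map_mem m hm)
  isTangent A := by
    have h1 := Hom₂.isTangent a (f.F.obj A)
    have h2 := (Hom₂.φ a).naturality (f.α.app A)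
    change (g.F.map (f.α.app A) ≫ g.α.app (f.F.obj A)) ≫ Z.D.T.map ((Hom₂.φ a).app (f.F.obj A)) =
      (Hom₂.φ a).app (f.F.obj (X.D.T.obj A)) ≫ h.F.map (f.α.app A) ≫ h.α.app (f.F.obj A)
    rw [Category.assoc, h1, reassoc_of% h2]

/-- Whiskering on the right. -/
def whiskerRight {X Y Z : MTangentCat.{v, u}} {f g : X ⟶ Y} (a : f ⟶ g) (h : Y ⟶ Z) :
    f ≫ h ⟶ g ≫ h where
  φ := Functor.whiskerRight (Hom₂.φ a) h.F
  isM := fun _ _ m hm => h.isM.map_pullback (g.isM.map_mem m hm) (Hom₂.isM a m hm)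
  isTangent A := by
    have h1 := congrArg h.F.map (Hom₂.isTangent a A)
    have h2 := h.α.naturality ((Hom₂.φ a).app A)
    simp only [Functor.map_comp, Functor.comp_map] at h1 h2
    change (h.F.map (f.α.app A) ≫ h.α.app (f.F.obj A)) ≫ Z.D.T.map (h.F.map ((Hom₂.φ a).app A)) =
      h.F.map ((Hom₂.φ a).app (X.D.T.obj A)) ≫ h.F.map (g.α.app A) ≫ h.α.app (g.F.obj A)
    rw [Category.assoc, ← h2, reassoc_of% h1]

theorem whiskerLeft_app {X Y Z : MTangentCat.{v, u}} (f : X ⟶ Y) {g h : Y ⟶ Z} (a : g ⟶ h)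
    (A : X.C) : (Hom₂.φ (whiskerLeft f a)).app A = (Hom₂.φ a).app (f.F.obj A) := rfl

theorem whiskerRight_app {X Y Z : MTangentCat.{v, u}} {f g : X ⟶ Y} (a : f ⟶ g) (h : Y ⟶ Z)
    (A : X.C) : (Hom₂.φ (whiskerRight a h)).app A = h.F.map ((Hom₂.φ a).app A) := rfl

theorem id_comp' {X Y : MTangentCat.{v, u}} (f : X ⟶ Y) : 𝟙 X ≫ f = f := by
  refine Hom.ext rfl (heq_of_eq (NatTrans.ext (funext fun A => ?_)))
  change f.F.map (𝟙 (X.D.T.obj A)) ≫ f.α.app A = f.α.app A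
  rw [f.F.map_id, Category.id_comp]

theorem comp_id' {X Y : MTangentCat.{v, u}} (f : X ⟶ Y) : f ≫ 𝟙 Y = f := by
  refine Hom.ext rfl (heq_of_eq (NatTrans.ext (funext fun A => ?_)))
  exact Category.comp_id (f.α.app A)

theorem assoc' {X Y Z W : MTangentCat.{v, u}} (f : X ⟶ Y) (g : Y ⟶ Z) (h : Z ⟶ W) :
    (f ≫ g) ≫ h = f ≫ g ≫ h := by
  refine Hom.ext rfl (heq_of_eq (NatTrans.ext (funext fun A => ?_)))
  change h.F.map (g.F.map (f.α.app A) ≫ g.α.app (f.F.obj A)) ≫ h.α.app (g.F.obj (f.F.obj A)) =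
    h.F.map (g.F.map (f.α.app A)) ≫ h.F.map (g.α.app (f.F.obj A)) ≫ h.α.app (g.F.obj (f.F.obj A))
  rw [h.F.map_comp, Category.assoc]

theorem leftUnitor_app {X Y : MTangentCat.{v, u}} (f : X ⟶ Y) (A : X.C) :
    (Hom₂.φ (eqToIso (id_comp' f)).hom).app A = 𝟙 (f.F.obj A) :=
  eqToHom_app (id_comp' f) A

theorem leftUnitor_inv_app {X Y : MTangentCat.{v, u}} (f : X ⟶ Y) (A : X.C) :
    (Hom₂.φ (eqToIso (id_comp' f)).inv).app A = 𝟙 (f.F.obj A) :=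
  eqToHom_app (id_comp' f).symm A

theorem rightUnitor_app {X Y : MTangentCat.{v, u}} (f : X ⟶ Y) (A : X.C) :
    (Hom₂.φ (eqToIso (comp_id' f)).hom).app A = 𝟙 (f.F.obj A) :=
  eqToHom_app (comp_id' f) A

theorem rightUnitor_inv_app {X Y : MTangentCat.{v, u}} (f : X ⟶ Y) (A : X.C) :
    (Hom₂.φ (eqToIso (comp_id' f)).inv).app A = 𝟙 (f.F.obj A) :=
  eqToHom_app (comp_id' f).symm A

theorem associator_app {X Y Z W : MTangentCat.{v, u}} (f : X ⟶ Y) (g : Y ⟶ Z) (h : Z ⟶ W) (A : X.C) :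
    (Hom₂.φ (eqToIso (assoc' f g h)).hom).app A = 𝟙 (h.F.obj (g.F.obj (f.F.obj A))) :=
  eqToHom_app (assoc' f g h) A

theorem associator_inv_app {X Y Z W : MTangentCat.{v, u}} (f : X ⟶ Y) (g : Y ⟶ Z) (h : Z ⟶ W)
    (A : X.C) :
    (Hom₂.φ (eqToIso (assoc' f g h)).inv).app A = 𝟙 (h.F.obj (g.F.obj (f.F.obj A))) :=
  eqToHom_app (assoc' f g h).symm A

/-- The 2-category of tangent `M`-categories. -/
instance bicategory : Bicategory MTangentCat.{v, u} where
  whiskerLeft := whiskerLeft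
  whiskerRight := whiskerRight
  associator f g h := eqToIso (assoc' f g h)
  leftUnitor f := eqToIso (id_comp' f)
  rightUnitor f := eqToIso (comp_id' f)
  whiskerLeft_id f g := rfl
  whiskerLeft_comp f _ _ _ a b := rfl
  id_whiskerLeft a := by
    refine hom₂_ext fun A => ?_
    rw [comp_app, comp_app, leftUnitor_app, leftUnitor_inv_app]
    exact ((Category.id_comp _).trans (Category.comp_id _)).symm
  comp_whiskerLeft f g _ _ a := by
    refine hom₂_ext fun A => ?_
    rw [comp_app, comp_app, associator_app, associator_inv_app]
    exact ((Category.id_comp _).trans (Category.comp_id _)).symm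
  id_whiskerRight f g := hom₂_ext fun A => g.F.map_id _
  comp_whiskerRight a b g := hom₂_ext fun A => g.F.map_comp _ _
  whiskerRight_id a := by
    refine hom₂_ext fun A => ?_
    rw [comp_app, comp_app, rightUnitor_app, rightUnitor_inv_app]
    exact ((Category.id_comp _).trans (Category.comp_id _)).symm
  whiskerRight_comp a f g := by
    refine hom₂_ext fun A => ?_
    rw [comp_app, comp_app, associator_app, associator_inv_app]
    exact ((Category.id_comp _).trans (Category.comp_id _)).symm
  whisker_assoc f _ _ a g := by
    refine hom₂_ext fun A => ?_
    rw [comp_app, comp_app, associator_app, associator_inv_app]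
    exact ((Category.id_comp _).trans (Category.comp_id _)).symm
  whisker_exchange a b := hom₂_ext fun A => ((Hom₂.φ b).naturality ((Hom₂.φ a).app A)).symm
  pentagon f g h i := by
    refine hom₂_ext fun A => ?_
    simp only [comp_app, whiskerLeft_app, whiskerRight_app, associator_app]
    refine (congrArg (· ≫ _) (i.F.map_id (h.F.obj (g.F.obj (f.F.obj A))))).trans ?_
    exact Category.id_comp _
  triangle f g := by
    refine hom₂_ext fun A => ?_
    simp only [comp_app, whiskerLeft_app, whiskerRight_app, associator_app, leftUnitor_app,
      rightUnitor_app]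
    exact (Category.id_comp _).trans (g.F.map_id (f.F.obj A)).symm

instance strict : Bicategory.Strict MTangentCat.{v, u} where
  id_comp := id_comp'
  comp_id := comp_id'
  assoc := assoc'
  leftUnitor_eqToIso _ := rfl
  rightUnitor_eqToIso _ := rfl
  associator_eqToIso _ _ _ := rfl

end MTangentCat

/-! ### The 2-category of tangent split restriction categories -/

/-- A tangent split restriction category. -/
structure SplitTangentRestrictionCat where
  C : Type u
  [cat : Category.{v} C]
  [restriction : RestrictionCategory C]
  isSplit : IsSplit C
  D : TangentData C
  isTangent : D.IsTangentRestriction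

namespace SplitTangentRestrictionCat

attribute [instance] cat restriction

/-- A lax tangent morphism `(F, α)` with `F` a restriction functor and `α` a total natural
transformation. -/
@[ext]
structure Hom (X Y : SplitTangentRestrictionCat.{v, u}) where
  F : X.C ⥤ Y.C
  α : X.D.T ⋙ F ⟶ F ⋙ Y.D.T
  isRestriction : IsRestrictionFunctor F
  α_total : IsTotalTrans α
  isLax : IsLaxTangent X.D Y.D F α

/-- The identity 1-morphism. -/
def Hom.id (X : SplitTangentRestrictionCat.{v, u}) : Hom X X where
  F := 𝟭 X.C
  α := idLaw X.D
  isRestriction := fun _ _ _ => rfl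
  α_total := fun A => isTotal_id (X.D.T.obj A)
  isLax := isLaxTangent_id X.D

/-- Composition of 1-morphisms. -/
def Hom.comp {X Y Z : SplitTangentRestrictionCat.{v, u}} (f : Hom X Y) (g : Hom Y Z) :
    Hom X Z where
  F := f.F ⋙ g.F
  α := compLaw f.α g.α
  isRestriction := fun _ _ a => (congrArg g.F.map (f.isRestriction a)).trans (g.isRestriction _)
  α_total := fun A => isTotal_comp (g.isRestriction.isTotal (f.α_total A)) (g.α_total (f.F.obj A))
  isLax := isLaxTangent_comp f.isLax g.isLax

instance : CategoryStruct SplitTangentRestrictionCat.{v, u} where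
  Hom := Hom
  id := Hom.id
  comp := Hom.comp

/-- A total natural transformation that is a tangent natural transformation. -/
@[ext]
structure Hom₂ {X Y : SplitTangentRestrictionCat.{v, u}} (f g : X ⟶ Y) where
  φ : f.F ⟶ g.F
  isTotal : IsTotalTrans φ
  isTangent : IsTangentTrans X.D Y.D f.α g.α φ

/-- The identity 2-morphism. -/
def Hom₂.id {X Y : SplitTangentRestrictionCat.{v, u}} (f : X ⟶ Y) : Hom₂ f f where
  φ := 𝟙 f.F
  isTotal := fun A => isTotal_id (f.F.obj A)
  isTangent A := by simp

/-- Vertical composition of 2-morphisms. -/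
def Hom₂.comp {X Y : SplitTangentRestrictionCat.{v, u}} {f g h : X ⟶ Y} (a : Hom₂ f g) (b : Hom₂ g h) :
    Hom₂ f h where
  φ := a.φ ≫ b.φ
  isTotal := fun A => isTotal_comp (a.isTotal A) (b.isTotal A)
  isTangent A := by
    have h1 := a.isTangent A
    have h2 := b.isTangent A
    simp only [NatTrans.comp_app, Functor.map_comp, Category.assoc]
    rw [reassoc_of% h1, h2]

instance (X Y : SplitTangentRestrictionCat.{v, u}) : Category (X ⟶ Y) where
  Hom f g := Hom₂ f g
  id f := Hom₂.id f
  comp a b := Hom₂.comp a b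
  id_comp a := Hom₂.ext (Category.id_comp a.φ)
  comp_id a := Hom₂.ext (Category.comp_id a.φ)
  assoc a b c := Hom₂.ext (Category.assoc a.φ b.φ c.φ)

theorem hom₂_ext {X Y : SplitTangentRestrictionCat.{v, u}} {f g : X ⟶ Y} {a b : f ⟶ g}
    (h : ∀ A, (Hom₂.φ a).app A = (Hom₂.φ b).app A) : a = b :=
  Hom₂.ext (NatTrans.ext (funext h))

theorem id_app {X Y : SplitTangentRestrictionCat.{v, u}} (f : X ⟶ Y) (A : X.C) :
    (Hom₂.φ (𝟙 f)).app A = 𝟙 (f.F.obj A) := rfl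

theorem comp_app {X Y : SplitTangentRestrictionCat.{v, u}} {f g h : X ⟶ Y} (a : f ⟶ g) (b : g ⟶ h)
    (A : X.C) : (Hom₂.φ (a ≫ b)).app A = (Hom₂.φ a).app A ≫ (Hom₂.φ b).app A := rfl

theorem eqToHom_app {X Y : SplitTangentRestrictionCat.{v, u}} {f g : X ⟶ Y} (h : f = g) (A : X.C) :
    (Hom₂.φ (eqToHom h)).app A = eqToHom (congrArg (fun k : X ⟶ Y => k.F.obj A) h) := by
  subst h; rfl

/-- Whiskering on the left. -/
def whiskerLeft {X Y Z : SplitTangentRestrictionCat.{v, u}} (f : X ⟶ Y) {g h : Y ⟶ Z} (a : g ⟶ h) :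
    f ≫ g ⟶ f ≫ h where
  φ := Functor.whiskerLeft f.F (Hom₂.φ a)
  isTotal := fun A => Hom₂.isTotal a (f.F.obj A)
  isTangent A := by
    have h1 := Hom₂.isTangent a (f.F.obj A)
    have h2 := (Hom₂.φ a).naturality (f.α.app A)
    change (g.F.map (f.α.app A) ≫ g.α.app (f.F.obj A)) ≫ Z.D.T.map ((Hom₂.φ a).app (f.F.obj A)) =
      (Hom₂.φ a).app (f.F.obj (X.D.T.obj A)) ≫ h.F.map (f.α.app A) ≫ h.α.app (f.F.obj A)
    rw [Category.assoc, h1, reassoc_of% h2]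

/-- Whiskering on the right. -/
def whiskerRight {X Y Z : SplitTangentRestrictionCat.{v, u}} {f g : X ⟶ Y} (a : f ⟶ g) (h : Y ⟶ Z) :
    f ≫ h ⟶ g ≫ h where
  φ := Functor.whiskerRight (Hom₂.φ a) h.F
  isTotal := fun A => h.isRestriction.isTotal (Hom₂.isTotal a A)
  isTangent A := by
    have h1 := congrArg h.F.map (Hom₂.isTangent a A)
    have h2 := h.α.naturality ((Hom₂.φ a).app A)
    simp only [Functor.map_comp, Functor.comp_map] at h1 h2
    change (h.F.map (f.α.app A) ≫ h.α.app (f.F.obj A)) ≫ Z.D.T.map (h.F.map ((Hom₂.φ a).app A)) =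
      h.F.map ((Hom₂.φ a).app (X.D.T.obj A)) ≫ h.F.map (g.α.app A) ≫ h.α.app (g.F.obj A)
    rw [Category.assoc, ← h2, reassoc_of% h1]

theorem whiskerLeft_app {X Y Z : SplitTangentRestrictionCat.{v, u}} (f : X ⟶ Y) {g h : Y ⟶ Z} (a : g ⟶ h)
    (A : X.C) : (Hom₂.φ (whiskerLeft f a)).app A = (Hom₂.φ a).app (f.F.obj A) := rfl

theorem whiskerRight_app {X Y Z : SplitTangentRestrictionCat.{v, u}} {f g : X ⟶ Y} (a : f ⟶ g) (h : Y ⟶ Z)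
    (A : X.C) : (Hom₂.φ (whiskerRight a h)).app A = h.F.map ((Hom₂.φ a).app A) := rfl

theorem id_comp' {X Y : SplitTangentRestrictionCat.{v, u}} (f : X ⟶ Y) : 𝟙 X ≫ f = f := by
  refine Hom.ext rfl (heq_of_eq (NatTrans.ext (funext fun A => ?_)))
  change f.F.map (𝟙 (X.D.T.obj A)) ≫ f.α.app A = f.α.app A
  rw [f.F.map_id, Category.id_comp]

theorem comp_id' {X Y : SplitTangentRestrictionCat.{v, u}} (f : X ⟶ Y) : f ≫ 𝟙 Y = f := by
  refine Hom.ext rfl (heq_of_eq (NatTrans.ext (funext fun A => ?_)))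
  exact Category.comp_id (f.α.app A)

theorem assoc' {X Y Z W : SplitTangentRestrictionCat.{v, u}} (f : X ⟶ Y) (g : Y ⟶ Z) (h : Z ⟶ W) :
    (f ≫ g) ≫ h = f ≫ g ≫ h := by
  refine Hom.ext rfl (heq_of_eq (NatTrans.ext (funext fun A => ?_)))
  change h.F.map (g.F.map (f.α.app A) ≫ g.α.app (f.F.obj A)) ≫ h.α.app (g.F.obj (f.F.obj A)) =
    h.F.map (g.F.map (f.α.app A)) ≫ h.F.map (g.α.app (f.F.obj A)) ≫ h.α.app (g.F.obj (f.F.obj A))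
  rw [h.F.map_comp, Category.assoc]

theorem leftUnitor_app {X Y : SplitTangentRestrictionCat.{v, u}} (f : X ⟶ Y) (A : X.C) :
    (Hom₂.φ (eqToIso (id_comp' f)).hom).app A = 𝟙 (f.F.obj A) :=
  eqToHom_app (id_comp' f) A

theorem leftUnitor_inv_app {X Y : SplitTangentRestrictionCat.{v, u}} (f : X ⟶ Y) (A : X.C) :
    (Hom₂.φ (eqToIso (id_comp' f)).inv).app A = 𝟙 (f.F.obj A) :=
  eqToHom_app (id_comp' f).symm A

theorem rightUnitor_app {X Y : SplitTangentRestrictionCat.{v, u}} (f : X ⟶ Y) (A : X.C) :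
    (Hom₂.φ (eqToIso (comp_id' f)).hom).app A = 𝟙 (f.F.obj A) :=
  eqToHom_app (comp_id' f) A

theorem rightUnitor_inv_app {X Y : SplitTangentRestrictionCat.{v, u}} (f : X ⟶ Y) (A : X.C) :
    (Hom₂.φ (eqToIso (comp_id' f)).inv).app A = 𝟙 (f.F.obj A) :=
  eqToHom_app (comp_id' f).symm A

theorem associator_app {X Y Z W : SplitTangentRestrictionCat.{v, u}} (f : X ⟶ Y) (g : Y ⟶ Z) (h : Z ⟶ W) (A : X.C) :
    (Hom₂.φ (eqToIso (assoc' f g h)).hom).app A = 𝟙 (h.F.obj (g.F.obj (f.F.obj A))) :=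
  eqToHom_app (assoc' f g h) A

theorem associator_inv_app {X Y Z W : SplitTangentRestrictionCat.{v, u}} (f : X ⟶ Y) (g : Y ⟶ Z) (h : Z ⟶ W)
    (A : X.C) :
    (Hom₂.φ (eqToIso (assoc' f g h)).inv).app A = 𝟙 (h.F.obj (g.F.obj (f.F.obj A))) :=
  eqToHom_app (assoc' f g h).symm A

/-- The 2-category of tangent split restriction categories. -/
instance bicategory : Bicategory SplitTangentRestrictionCat.{v, u} where
  whiskerLeft := whiskerLeft
  whiskerRight := whiskerRight
  associator f g h := eqToIso (assoc' f g h)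
  leftUnitor f := eqToIso (id_comp' f)
  rightUnitor f := eqToIso (comp_id' f)
  whiskerLeft_id f g := rfl
  whiskerLeft_comp f _ _ _ a b := rfl
  id_whiskerLeft a := by
    refine hom₂_ext fun A => ?_
    rw [comp_app, comp_app, leftUnitor_app, leftUnitor_inv_app]
    exact ((Category.id_comp _).trans (Category.comp_id _)).symm
  comp_whiskerLeft f g _ _ a := by
    refine hom₂_ext fun A => ?_
    rw [comp_app, comp_app, associator_app, associator_inv_app]
    exact ((Category.id_comp _).trans (Category.comp_id _)).symm
  id_whiskerRight f g := hom₂_ext fun A => g.F.map_id _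
  comp_whiskerRight a b g := hom₂_ext fun A => g.F.map_comp _ _
  whiskerRight_id a := by
    refine hom₂_ext fun A => ?_
    rw [comp_app, comp_app, rightUnitor_app, rightUnitor_inv_app]
    exact ((Category.id_comp _).trans (Category.comp_id _)).symm
  whiskerRight_comp a f g := by
    refine hom₂_ext fun A => ?_
    rw [comp_app, comp_app, associator_app, associator_inv_app]
    exact ((Category.id_comp _).trans (Category.comp_id _)).symm
  whisker_assoc f _ _ a g := by
    refine hom₂_ext fun A => ?_
    rw [comp_app, comp_app, associator_app, associator_inv_app]
    exact ((Category.id_comp _).trans (Category.comp_id _)).symm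
  whisker_exchange a b := hom₂_ext fun A => ((Hom₂.φ b).naturality ((Hom₂.φ a).app A)).symm
  pentagon f g h i := by
    refine hom₂_ext fun A => ?_
    simp only [comp_app, whiskerLeft_app, whiskerRight_app, associator_app]
    refine (congrArg (· ≫ _) (i.F.map_id (h.F.obj (g.F.obj (f.F.obj A))))).trans ?_
    exact Category.id_comp _
  triangle f g := by
    refine hom₂_ext fun A => ?_
    simp only [comp_app, whiskerLeft_app, whiskerRight_app, associator_app, leftUnitor_app,
      rightUnitor_app]
    exact (Category.id_comp _).trans (g.F.map_id (f.F.obj A)).symm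

instance strict : Bicategory.Strict SplitTangentRestrictionCat.{v, u} where
  id_comp := id_comp'
  comp_id := comp_id'
  assoc := assoc'
  leftUnitor_eqToIso _ := rfl
  rightUnitor_eqToIso _ := rfl
  associator_eqToIso _ _ _ := rfl

end SplitTangentRestrictionCat

/-! ### 2-equivalences -/

section TwoEquivalence

open Bicategory

variable {K : Type u} [Bicategory.{v, v'} K] {L : Type u'} [Bicategory.{v'', u''} L]

/-- A 2-natural isomorphism between (strict) 2-functors. -/
structure TwoNatIso (F G : StrictPseudofunctor K L) where
  hom : ∀ X, F.obj X ⟶ G.obj X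
  inv : ∀ X, G.obj X ⟶ F.obj X
  hom_inv_id : ∀ X, hom X ≫ inv X = 𝟙 (F.obj X)
  inv_hom_id : ∀ X, inv X ≫ hom X = 𝟙 (G.obj X)
  naturality : ∀ {X Y : K} (f : X ⟶ Y), F.map f ≫ hom Y = hom X ≫ G.map f
  naturality₂ : ∀ {X Y : K} {f g : X ⟶ Y} (θ : f ⟶ g),
    F.map₂ θ ▷ hom Y ≫ eqToHom (naturality g) = eqToHom (naturality f) ≫ hom X ◁ G.map₂ θ

variable (K L) in
/-- A 2-equivalence of (strict) 2-categories. -/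
structure TwoEquivalence [Bicategory.Strict K] [Bicategory.Strict L] where
  functor : StrictPseudofunctor K L
  inverse : StrictPseudofunctor L K
  unit : TwoNatIso (StrictPseudofunctor.id K) (functor.comp inverse)
  counit : TwoNatIso (inverse.comp functor) (StrictPseudofunctor.id L)

end TwoEquivalence

end TangentCats

namespace TangentCats

/-! ### Restriction idempotents -/

section RestrictionLemmas

open RestrictionCategory

variable {C : Type u} [Category.{v} C] [RestrictionCategory C]

/-! The inverse of `Par` is `Tot`, which sends a split restriction category to its total maps, with
the restriction monics (total maps `m` having `r` with `m ≫ r = 𝟙` and `r ≫ m = res r`) as display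
system. Forgetting tangent structure, this is the classical correspondence between categories with a
system of monics and split restriction categories. A total span has an invertible left leg, so it is
an ordinary map; conversely, splitting `res f` as `q ≫ n` writes `f` as the span with legs `n` and
`n ≫ f`. What has to be added is that tangent structure passes both ways.

From `C` to `Par M`: étaleness says that `p` is cartesian over `M`. Pullback cancellation then makes
`z`, `s`, `l` and the projections of `T₂` cartesian over `M`, and `c` is invertible
(`TangentData.IsTangent.isMStructure`), so `Par` applies to all the data. Equations descend because
`tot` is functorial. A cone of partial maps, cut down to its common domain, is an ordinary cone over
one span leg, so pullbacks become restriction pullbacks (`Par.isRestrictionPullback`,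
`Par.isNFoldRestrictionPullback`). Universality of the lift is assumed without iterates of `T` on
one side and with them on the other; `TangentData.IsTangent.linear_iter` closes the gap by using `c`
to identify `T` of the square at `A` with the square at `T A`.

From a restriction category to its total maps: pullbacks along restriction monics are equational
(`IsRetractSquare`), hence preserved by every restriction functor. Naturality of a total
transformation at the retraction `r` is the equation that makes its square at `m` a pullback. This
yields étaleness and all `M`-naturality conditions together.

The unit is `f ↦ tot f` and the counit sends a span `(m, f)` to `r ≫ f`. Both are bijective on
objects and on maps, with identity distributive laws, so they are strictly invertible and strictly
natural. -/

theorem res_res {A B : C} (f : A ⟶ B) : res (res f) = res f := by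
  have h := res_res_comp f (𝟙 A)
  rwa [Category.comp_id, isTotal_id A, Category.comp_id] at h

theorem res_comp_res {A B E : C} (f : A ⟶ B) (g : B ⟶ E) : res (f ≫ g) ≫ res f = res (f ≫ g) := by
  rw [res_comm, ← res_res_comp, ← Category.assoc, res_comp_self]

theorem res_comp_res_self {A B E : C} (f : A ⟶ B) (g : B ⟶ E) :
    res (f ≫ res g) = res (f ≫ g) := by
  rw [comp_res, res_res_comp, res_comp_res]

theorem res_comp_total {A B E : C} (f : A ⟶ B) {g : B ⟶ E} (hg : IsTotal g) :
    res (f ≫ g) = res f := by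
  rw [← res_comp_res_self, hg, Category.comp_id]

theorem isTotal_of_comp {A B E : C} {f : A ⟶ B} {g : B ⟶ E} (h : IsTotal (f ≫ g)) : IsTotal f := by
  have h' := res_comp_res f g
  rwa [h, Category.id_comp] at h'

theorem isTotal_of_comp_eq_id {A B : C} {f : A ⟶ B} {g : B ⟶ A} (h : f ≫ g = 𝟙 A) : IsTotal f :=
  isTotal_of_comp (g := g) (h ▸ isTotal_id A)

/-- `meet` is a right fold over `List.ofFn`, so its properties are proved by induction on a list of
restriction idempotents, with `res_res_comp` as the inductive step. -/
theorem res_foldr {X : C} (L : List (X ⟶ X)) (hL : ∀ e ∈ L, res e = e) :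
    res (L.foldr (fun e e' => e ≫ e') (𝟙 X)) = L.foldr (fun e e' => e ≫ e') (𝟙 X) := by
  induction L with
  | nil => exact isTotal_id X
  | cons e L ih =>
    have h1 := ih fun e' he' => hL e' (List.mem_cons_of_mem _ he')
    have h2 := hL e List.mem_cons_self
    have h3 := res_res_comp e (L.foldr (fun e e' => e ≫ e') (𝟙 X))
    rw [h1, h2] at h3
    exact h3

/-- At the head of the list `e` is absorbed by idempotence; otherwise it commutes past the head and
is absorbed further on. -/
theorem foldr_comp_of_mem {X : C} (L : List (X ⟶ X)) (hL : ∀ e ∈ L, res e = e) {e : X ⟶ X}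
    (he : e ∈ L) :
    e ≫ L.foldr (fun e e' => e ≫ e') (𝟙 X) = L.foldr (fun e e' => e ≫ e') (𝟙 X) := by
  induction L with
  | nil => cases he
  | cons d L ih =>
    have hd := hL d List.mem_cons_self
    rw [List.foldr_cons]
    rcases List.mem_cons.1 he with rfl | he'
    · have := res_comp_self e
      rw [hd] at this
      rw [← Category.assoc, this]
    · have he1 := hL e he
      have hc := res_comm d e
      rw [hd, he1] at hc
      rw [← Category.assoc, ← hc, Category.assoc,
        ih (fun e' he' => hL e' (List.mem_cons_of_mem _ he')) he']

theorem res_meet {X E : C} {n : ℕ} (b : Fin n → (X ⟶ E)) : res (meet b) = meet b := by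
  refine res_foldr _ fun e he => ?_
  obtain ⟨i, rfl⟩ := List.mem_ofFn.1 he
  exact res_res _

theorem meet_comp_res {X E : C} {n : ℕ} (b : Fin n → (X ⟶ E)) (i : Fin n) :
    meet b ≫ res (b i) = meet b := by
  rw [← res_meet b, res_comm, res_meet b]
  refine foldr_comp_of_mem _ (fun e he => ?_) (List.mem_ofFn.2 ⟨i, rfl⟩)
  obtain ⟨j, rfl⟩ := List.mem_ofFn.1 he
  exact res_res _

/-- All the truncated maps `meet b ≫ b i` thus have one and the same domain of definition, so in
`Par M` they can be represented with a common left leg. -/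
theorem res_meet_comp {X E : C} {n : ℕ} (b : Fin n → (X ⟶ E)) (i : Fin n) :
    res (meet b ≫ b i) = meet b := by
  rw [← res_meet b, res_res_comp, res_meet b, meet_comp_res]

theorem meet_of_total {X E : C} {n : ℕ} (b : Fin n → (X ⟶ E)) (hb : ∀ i, IsTotal (b i)) :
    meet b = 𝟙 X := by
  have h : ∀ L : List (X ⟶ X), (∀ e ∈ L, e = 𝟙 X) → L.foldr (fun e e' => e ≫ e') (𝟙 X) = 𝟙 X := by
    intro L
    induction L with
    | nil => intro _; rfl
    | cons e L ih =>
      intro h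
      rw [List.foldr_cons, ih fun e' he' => h e' (List.mem_cons_of_mem _ he'),
        h e List.mem_cons_self, Category.comp_id]
  refine h _ fun e he => ?_
  obtain ⟨i, rfl⟩ := List.mem_ofFn.1 he
  exact hb i

/-- A map into a restriction pullback is determined by its components. -/
theorem IsRestrictionPullback.hom_ext {P B E A X : C} {fst : P ⟶ B} {snd : P ⟶ E} {f : B ⟶ A}
    {g : E ⟶ A} (h : IsRestrictionPullback fst snd f g) {t t' : X ⟶ P}
    (h₁ : t ≫ fst = t' ≫ fst) (h₂ : t ≫ snd = t' ≫ snd) : t = t' := by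
  have r₁ : res (t ≫ fst) = res t := res_comp_total t h.fst_total
  have r₂ : res (t ≫ snd) = res t := res_comp_total t h.snd_total
  -- The projections are total, so both components of `t` have restriction `res t`. Truncating
  -- either by the other changes nothing, and `t` and `t'` are both lifts of the same cone.
  obtain ⟨w, -, hw⟩ := h.lift (t ≫ fst) (t ≫ snd)
    (by rw [r₁, r₂, Category.assoc, Category.assoc, h.w])
  have e₁ : t = w := hw t (by
    rw [r₁, r₂, ← Category.assoc, ← Category.assoc, res_comp_self]; exact ⟨rfl, rfl⟩)
  have e₂ : t' = w := hw t' (by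
    rw [r₁, r₂, ← r₁, h₁, h₂, res_comp_total t' h.fst_total, ← Category.assoc, ← Category.assoc,
      res_comp_self]
    exact ⟨rfl, rfl⟩)
  rw [e₁, e₂]

end RestrictionLemmas

/-! ### Partial maps -/

section ParLemmas

variable {C : Type u} [Category.{v} C] {M : MorphismProperty C}

/-- The restriction remembers the left leg up to isomorphism, and the right leg can be transported
along that isomorphism to any chosen representative. -/
theorem ParHom.exists_mk_of_res {A B S : C} {m : S ⟶ A} {hm : M m} {x : ParHom M A B}
    {f : S ⟶ A} (h : ParHom.res x = ParHom.mk m hm f) : ∃ g : S ⟶ B, x = ParHom.mk m hm g := by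
  induction x using ParHom.ind with
  | h R n hn k =>
    obtain ⟨e, h1, -⟩ := Quotient.exact h
    exact ⟨e.inv ≫ k, ParHom.mk_eq e h1 (e.hom_inv_id_assoc k)⟩

variable [hM : IsMonicSystem M]
  {C' : Type u'} [Category.{v'} C'] {M' : MorphismProperty C'} [IsMonicSystem M']

/-- An isomorphism of spans that commutes with the same monic on both sides is the identity. This
turns equations of partial maps with a fixed leg into equations in `C`. -/
theorem ParHom.mk_inj {A B S : C} {m : S ⟶ A} {hm hm' : M m} {f g : S ⟶ B}
    (h : ParHom.mk m hm f = ParHom.mk m hm' g) : f = g := by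
  obtain ⟨e, h1, h2⟩ := Quotient.exact h
  change e.hom ≫ m = m at h1
  change e.hom ≫ g = f at h2
  have := hM.mono m hm
  have h3 : e.hom = 𝟙 S := (cancel_mono m).1 (h1.trans (Category.id_comp m).symm)
  exact h2.symm.trans ((congrArg (· ≫ g) h3).trans (Category.id_comp g))

theorem ParHom.tot_injective {A B : C} {f g : A ⟶ B}
    (h : (ParHom.tot f : ParHom M A B) = ParHom.tot g) : f = g :=
  ParHom.mk_inj h

theorem ParHom.tot_comp_tot {A B E : C} (f : A ⟶ B) (g : B ⟶ E) :
    ParHom.comp (ParHom.tot f : ParHom M A B) (ParHom.tot g) = ParHom.tot (f ≫ g) :=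
  ParHom.comp_tot

theorem ParHom.map_tot {F : C ⥤ C'} (hF : IsMFunctor M M' F) {A B : C} (f : A ⟶ B) :
    ParHom.map hF (ParHom.tot f) = ParHom.tot (F.map f) :=
  ParHom.mk_congr (F.map_id A) rfl

/-- Composing with an everywhere defined map leaves the left leg alone, so a span for the composite
already provides a leg for `x`. -/
theorem ParHom.exists_mk_of_comp_tot {A B E S : C} {m : S ⟶ A} {hm : M m} {x : ParHom M A B}
    {g : B ⟶ E} {f : S ⟶ E} (h : ParHom.comp x (ParHom.tot g) = ParHom.mk m hm f) :
    ∃ k : S ⟶ B, x = ParHom.mk m hm k ∧ k ≫ g = f := by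
  induction x using ParHom.ind with
  | h R n hn k =>
    rw [ParHom.comp_tot] at h
    obtain ⟨e, h1, h2⟩ := Quotient.exact h
    change e.hom ≫ f = k ≫ g at h2
    exact ⟨e.inv ≫ k, ParHom.mk_eq e h1 (e.hom_inv_id_assoc k),
      (Category.assoc _ _ _).trans ((Iso.inv_comp_eq e).2 h2.symm)⟩

theorem ParHom.exists_res (M : MorphismProperty C) [IsMonicSystem M] {A B : C} (x : ParHom M A B) :
    ∃ (S : C) (m : S ⟶ A) (hm : M m), ParHom.res x = ParHom.mk m hm m := by
  induction x using ParHom.ind with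
  | h S m hm f => exact ⟨S, m, hm, rfl⟩

/-- Each map restricted to the domain of the other is defined on the intersection of the two
subobjects, that is, on the pullback of their legs. -/
theorem ParHom.exists_res_comp {A B E : C} (x : ParHom M A B) (y : ParHom M A E) :
    ∃ (S : C) (m : S ⟶ A) (hm : M m) (f : S ⟶ B) (g : S ⟶ E),
      ParHom.comp (ParHom.res y) x = ParHom.mk m hm f ∧
      ParHom.comp (ParHom.res x) y = ParHom.mk m hm g := by
  induction x using ParHom.ind with
  | h S m hm f =>
  induction y using ParHom.ind with
  | h R n hn g =>
    obtain ⟨P, a, b, hp, ha⟩ := hM.pullback m n hn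
    refine ⟨P, a ≫ m, hM.comp _ _ ha hm, a ≫ f, b ≫ g, ?_, ?_⟩
    · rw [ParHom.res_mk, ParHom.comp_mk hp.flip]
      exact ParHom.mk_congr hp.w.symm rfl
    · rw [ParHom.res_mk, ParHom.comp_mk hp]

variable (M) in
/-- The inclusion of a category into its category of partial maps. -/
noncomputable def Par.incl : C ⥤ Par M where
  obj A := ⟨A⟩
  map f := ParHom.tot f
  map_id _ := rfl
  map_comp f g := (ParHom.tot_comp_tot f g).symm

theorem Par.isRestrictionFunctor_map {F : C ⥤ C'} (hF : IsMFunctor M M' F) :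
    IsRestrictionFunctor (Par.map F hF) := by
  intro A B x
  change ParHom.map hF (ParHom.res x) = ParHom.res (ParHom.map hF x)
  induction x using ParHom.ind with
  | h S m hm f => rfl

theorem Par.incl_comp_map {F : C ⥤ C'} (hF : IsMFunctor M M' F) :
    Par.incl M ⋙ Par.map F hF = F ⋙ Par.incl M' :=
  Functor.hext (fun _ => rfl) fun _ _ f => heq_of_eq (ParHom.map_tot hF f)

/-- An equality of functors, not merely an isomorphism: rewriting with it moves statements about
`iter T k` in `C` to the iterates of `Par.map T hT`. -/
theorem Par.incl_comp_iter {T : C ⥤ C} (hT : IsMFunctor M M T) (k : ℕ) :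
    Par.incl M ⋙ iter (Par.map T hT) k = iter T k ⋙ Par.incl M := by
  induction k with
  | zero => rfl
  | succ k ih =>
    calc Par.incl M ⋙ iter (Par.map T hT) (k + 1)
        = (Par.incl M ⋙ iter (Par.map T hT) k) ⋙ Par.map T hT := rfl
      _ = iter T k ⋙ (Par.incl M ⋙ Par.map T hT) := by rw [ih]; rfl
      _ = iter T (k + 1) ⋙ Par.incl M := by rw [Par.incl_comp_map]; rfl

/-- Pullbacks are restriction pullbacks of partial maps. -/
theorem Par.isRestrictionPullback {P B E A : C} {fst : P ⟶ B} {snd : P ⟶ E} {f : B ⟶ A}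
    {g : E ⟶ A} (h : IsPullback fst snd f g) :
    IsRestrictionPullback ((Par.incl M).map fst) ((Par.incl M).map snd) ((Par.incl M).map f)
      ((Par.incl M).map g) where
  fst_total := rfl
  snd_total := rfl
  w := by rw [← Functor.map_comp, ← Functor.map_comp, h.w]
  lift {X} b e hw := by
    change ParHom M X.obj B at b
    change ParHom M X.obj E at e
    change ParHom.comp (ParHom.res e) (ParHom.comp b (ParHom.tot f)) =
      ParHom.comp (ParHom.res b) (ParHom.comp e (ParHom.tot g)) at hw
    change ∃! t : ParHom M X.obj P,
      ParHom.comp t (ParHom.tot fst) = ParHom.comp (ParHom.res e) b ∧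
      ParHom.comp t (ParHom.tot snd) = ParHom.comp (ParHom.res b) e
    -- Over the common leg `m`, the cone condition becomes an equation of maps out of `S`, to which
    -- the pullback in `C` applies.
    obtain ⟨S, m, hm, b', e', hb, he⟩ := ParHom.exists_res_comp b e
    rw [← ParHom.assoc, ← ParHom.assoc, hb, he, ParHom.comp_tot, ParHom.comp_tot] at hw
    rw [hb, he]
    refine ⟨ParHom.mk m hm (h.lift b' e' (ParHom.mk_inj hw)), ⟨?_, ?_⟩, ?_⟩
    · rw [ParHom.comp_tot, h.lift_fst]
    · rw [ParHom.comp_tot, h.lift_snd]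
    · rintro t ⟨h1, h2⟩
      -- A competing lift must have leg `m` as well, since its composite with the total map `fst`
      -- does.
      obtain ⟨t', rfl, h3⟩ := ParHom.exists_mk_of_comp_tot h1
      rw [ParHom.comp_tot] at h2
      refine ParHom.mk_congr rfl (h.hom_ext ?_ ?_)
      · rw [h3, h.lift_fst]
      · rw [ParHom.mk_inj h2, h.lift_snd]

/-- `n`-fold pullbacks are `n`-fold restriction pullbacks of partial maps. -/
theorem Par.isNFoldRestrictionPullback {P E B : C} {n : ℕ} (hn : 1 ≤ n) {q : E ⟶ B}
    {π : Fin n → (P ⟶ E)} (h : IsNFoldPullback q π) :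
    IsNFoldRestrictionPullback ((Par.incl M).map q) (fun i => (Par.incl M).map (π i)) where
  total _ := rfl
  w i j := by rw [← Functor.map_comp, ← Functor.map_comp, h.1 i j]
  lift {X} b hb := by
    have hb' : ∀ i j, meet b ≫ b i ≫ (Par.incl M).map q = meet b ≫ b j ≫ (Par.incl M).map q := by
      intro i j
      rw [← meet_comp_res b j, Category.assoc, hb i j, ← Category.assoc, meet_comp_res b j,
        ← Category.assoc, meet_comp_res b i, Category.assoc]
    obtain ⟨S, m, hm, hS⟩ := ParHom.exists_res M (A := X.obj) (B := X.obj) (meet b)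
    -- Each truncated component has restriction `meet b`, so the single leg `m` of `meet b` serves
    -- for all `i`.
    have hr : ∀ i, ∃ g : S ⟶ E, meet b ≫ b i = ParHom.mk m hm g := fun i =>
      ParHom.exists_mk_of_res (f := m)
        ((res_meet_comp b i).trans ((res_meet b).symm.trans hS))
    choose g hg using hr
    have hgq : ∀ i j, g i ≫ q = g j ≫ q := by
      intro i j
      have h1 := hb' i j
      rw [← Category.assoc, ← Category.assoc, hg, hg] at h1
      change ParHom.comp (ParHom.mk m hm (g i)) (ParHom.tot q) =
        ParHom.comp (ParHom.mk m hm (g j)) (ParHom.tot q) at h1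
      rw [ParHom.comp_tot, ParHom.comp_tot] at h1
      exact ParHom.mk_inj h1
    obtain ⟨t, ht, ht'⟩ := h.2 S g hgq
    refine ⟨ParHom.mk m hm t, fun i => ?_, fun t' h' => ?_⟩
    · rw [hg i]
      exact ParHom.comp_tot.trans (ParHom.mk_congr rfl (ht i))
    -- One projection is enough to fix the leg of `t'`; `1 ≤ n` guarantees that there is one.
    · obtain ⟨k, rfl, -⟩ := ParHom.exists_mk_of_comp_tot ((h' ⟨0, hn⟩).trans (hg _))
      refine ParHom.mk_congr rfl (ht' k fun i => ?_)
      exact ParHom.mk_inj (ParHom.comp_tot.symm.trans ((h' i).trans (hg i)))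

end ParLemmas

/-! ### Tangent categories -/

section TangentLemmas

variable {C : Type u} [Category.{v} C]

/-- `iter` adds the new copy of `T` on the outside, whereas the induction in `linear_iter` applies
it first. -/
theorem iter_comp (T : C ⥤ C) (k : ℕ) : iter T k ⋙ T = T ⋙ iter T k := by
  induction k with
  | zero => rfl
  | succ k ih =>
    calc iter T (k + 1) ⋙ T = (iter T k ⋙ T) ⋙ T := rfl
      _ = (T ⋙ iter T k) ⋙ T := by rw [ih]
      _ = T ⋙ iter T (k + 1) := rfl

/-- This is pullback cancellation on naturality squares: the square of `φ` stacked on that of `ψ` is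
the square of `χ`. -/
theorem IsMNatural.of_comp {C' : Type u'} [Category.{v'} C'] {M : MorphismProperty C}
    {F G H : C ⥤ C'} (φ : F ⟶ G) {ψ : G ⟶ H} {χ : F ⟶ H} (w : ∀ A, φ.app A ≫ ψ.app A = χ.app A)
    (hψ : IsMNatural M ψ) (hχ : IsMNatural M χ) : IsMNatural M φ := by
  intro A B m hm
  have h := hχ m hm
  rw [← w, ← w] at h
  exact h.of_bot (φ.naturality m) (hψ m hm)

/-- Two pullbacks of one cospan are isomorphic, and functors carry the isomorphism along. One
`T`-pullback on a cospan therefore makes every pullback on it a `T`-pullback. -/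
theorem IsTPullback.of_isPullback {T : C ⥤ C} {P P' N A B : C} {fst : P ⟶ N} {snd : P ⟶ A}
    {fst' : P' ⟶ N} {snd' : P' ⟶ A} {f : N ⟶ B} {g : A ⟶ B} (h : IsTPullback T fst snd f g)
    (h' : IsPullback fst' snd' f g) : IsTPullback T fst' snd' f g := by
  have h0 : IsPullback fst snd f g := h 0
  intro k
  refine (h k).of_iso ((iter T k).mapIso (h0.isoIsPullback _ _ h')) (Iso.refl _) (Iso.refl _)
    (Iso.refl _) ?_ ?_ ?_ ?_
  · rw [Functor.mapIso_hom, ← Functor.map_comp, h0.isoIsPullback_hom_fst]; exact Category.comp_id _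
  · rw [Functor.mapIso_hom, ← Functor.map_comp, h0.isoIsPullback_hom_snd]; exact Category.comp_id _
  · exact (Category.comp_id _).trans (Category.id_comp _).symm
  · exact (Category.comp_id _).trans (Category.id_comp _).symm

variable {D : TangentData C}

theorem IsTangentMonicSystem.isTPullback {M : MorphismProperty C} (h : IsTangentMonicSystem D M)
    {P N A B : C} {fst : P ⟶ N} {snd : P ⟶ A} {f : N ⟶ B} {m : A ⟶ B} (hm : M m)
    (hp : IsPullback fst snd f m) : IsTPullback D.T fst snd f m := by
  obtain ⟨P', a, b, h', -⟩ := h.pullback f m hm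
  exact h'.of_isPullback hp

/-- The functors of a tangent structure with a tangent system of étale monics preserve the monics
and the pullbacks along them, and the structural transformations are `M`-natural. -/
theorem TangentData.IsTangent.isMStructure (hD : D.IsTangent) {M : MorphismProperty C}
    (h : IsTangentMonicSystem D M) : D.IsMStructure M := by
  have := h.isMonicSystem
  have hT : IsMFunctor M M D.T := ⟨h.map_mem, fun hm hp => h.isTPullback hm hp 1⟩
  have hp : IsMNatural M D.p := fun A B m hm => h.etale m hm 0
  have hπ₁ : IsMNatural M D.π₁ := by
    intro A B m hm
    -- The square defining `T₂ A` pasted with the étale square of `m` is, by naturality of `p` and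
    -- `π₂`, the naturality square of `π₁` pasted with the square defining `T₂ B`. Cancelling the
    -- latter leaves the claim.
    have h1 : IsPullback (D.π₂.app A ≫ D.T.map m) (D.π₁.app A) (D.p.app B) (D.p.app A ≫ m) :=
      (hD.pullback₂ A 0).flip.paste_horiz (hp m hm)
    have h2 : D.p.app A ≫ m = D.T.map m ≫ D.p.app B := (D.p.naturality m).symm
    rw [← D.π₂.naturality m, h2] at h1
    exact h1.of_right (D.π₁.naturality m) (hD.pullback₂ B 0).flip
  have hT₂ : IsMFunctor M M D.T₂ :=
    { map_mem := fun m hm => IsMonicSystem.of_isPullback (h.map_mem m hm) (hπ₁ m hm)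
      map_pullback := by
        intro P N A B fst snd f m hm hp
        -- The cartesian square of `π₁` at `fst` stacked on the `T`-image of the given pullback
        -- agrees with the `T₂`-image stacked on the cartesian square of `π₁` at `m`, which cancels.
        have h1 := (hπ₁ fst (IsMonicSystem.of_isPullback hm hp)).paste_vert
          (hT.map_pullback hm hp)
        rw [← D.π₁.naturality snd, ← D.π₁.naturality f] at h1
        refine h1.of_bot ?_ (hπ₁ m hm)
        rw [← D.T₂.map_comp, ← D.T₂.map_comp, hp.w] }
  -- The remaining transformations except `c` come from cancelling `p` or `T p` in `z ≫ p = 𝟙`, `π₂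
  -- ≫ p = π₁ ≫ p`, `s ≫ p = π₁ ≫ p` and `l ≫ T p = p ≫ z`.
  have hz : IsMNatural M D.z := IsMNatural.of_comp D.z (χ := 𝟙 (𝟭 C))
    (fun A => (hD.equations.additive A).zero_q) hp (IsMNatural.of_isIso _)
  have hTp : IsMNatural M (Functor.whiskerRight D.p D.T) := fun A B m hm =>
    hT.map_pullback hm (hp m hm)
  refine ⟨hT, hT₂, hp, hz, hπ₁, ?_, ?_, ?_, ?_⟩
  · exact IsMNatural.of_comp D.π₂ (χ := D.π₁ ≫ D.p)
      (fun A => (hD.pullback₂ A 0).w.symm) hp (hπ₁.comp hp)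
  · exact IsMNatural.of_comp D.s (χ := D.π₁ ≫ D.p)
      (fun A => (hD.equations.additive A).sum_q) hp (hπ₁.comp hp)
  · exact IsMNatural.of_comp D.l (ψ := Functor.whiskerRight D.p D.T) (χ := D.p ≫ D.z)
      (fun A => (hD.equations.lift_additive A).comp_q) hTp (hp.comp hz)
  · have : ∀ A, IsIso (D.c.app A) := fun A =>
      ⟨D.c.app A, hD.equations.flip_flip A, hD.equations.flip_flip A⟩
    have : IsIso D.c := NatIso.isIso_of_isIso_app D.c
    exact IsMNatural.of_isIso _

/-- The flip carries `T` of the lift pair at `A` to the lift pair at `T A`, with `θ` playing the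
role of `c × c`. It is checked on the two projections of `T (T₂ (T A))`: the first uses that `c`
respects zeros, the second the coherence of `l` with `c`. -/
theorem TangentData.IsLiftPair.flip (hD : D.IsTangent) {A : C}
    {v : D.T₂.obj A ⟶ D.T.obj (D.T₂.obj A)}
    {v' : D.T₂.obj (D.T.obj A) ⟶ D.T.obj (D.T₂.obj (D.T.obj A))} (hv : D.IsLiftPair A v)
    (hv' : D.IsLiftPair (D.T.obj A) v') {θ : D.T.obj (D.T₂.obj A) ⟶ D.T₂.obj (D.T.obj A)}
    (h₁ : θ ≫ D.π₁.app (D.T.obj A) = D.T.map (D.π₁.app A) ≫ D.c.app A)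
    (h₂ : θ ≫ D.π₂.app (D.T.obj A) = D.T.map (D.π₂.app A) ≫ D.c.app A) :
    D.T.map v ≫ D.c.app (D.T₂.obj A) ≫ D.T.map θ = θ ≫ v' := by
  -- The axiom `lift_flip_flip` solved for the other side, all flips being involutions.
  have hl : D.T.map (D.l.app A) ≫ D.c.app (D.T.obj A) ≫ D.T.map (D.c.app A) =
      D.c.app A ≫ D.l.app (D.T.obj A) := by
    have e := congrArg (D.c.app A ≫ ·) (hD.equations.lift_flip_flip A)
    simp only [← Category.assoc, hD.equations.flip_flip A] at e
    rw [Category.id_comp] at e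
    have e1 := hD.equations.flip_flip (D.T.obj A)
    have e2 : D.T.map (D.c.app A) ≫ D.T.map (D.c.app A) = 𝟙 _ := by
      rw [← D.T.map_comp, hD.equations.flip_flip A]; exact D.T.map_id _
    rw [← e]
    simp only [Category.assoc]
    have e3 : D.c.app (D.T.obj A) ≫ D.c.app (D.T.obj A) ≫ D.T.map (D.c.app A) =
        D.T.map (D.c.app A) := by
      rw [← Category.assoc, e1]; exact Category.id_comp _
    rw [e3, e2]
    exact congrArg (D.c.app A ≫ ·) (Category.comp_id _)
  have hc₁ := D.c.naturality (D.π₁.app A)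
  have hc₂ := D.c.naturality (D.π₂.app A)
  have hz₁ := D.z.naturality (D.c.app A)
  have hz₂ := (hD.equations.flip_additive (D.T.obj A)).zero_comp
  dsimp [TangentData.bundle, BundleData.map] at hc₁ hc₂ hz₁ hz₂
  rw [Category.id_comp] at hz₂
  refine (hD.pullback₂ (D.T.obj A) 1).hom_ext ?_ ?_
  · change (_ ≫ _ ≫ _) ≫ D.T.map (D.π₁.app (D.T.obj A)) =
      (_ ≫ _) ≫ D.T.map (D.π₁.app (D.T.obj A))
    rw [Category.assoc, Category.assoc, Category.assoc, ← D.T.map_comp, h₁, hv'.1,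
      D.T.map_comp, ← reassoc_of% hc₁, ← Category.assoc, ← D.T.map_comp, hv.1]
    rw [reassoc_of% h₁, D.T.map_comp, Category.assoc, reassoc_of% hz₂, hz₁]
  · change (_ ≫ _ ≫ _) ≫ D.T.map (D.π₂.app (D.T.obj A)) =
      (_ ≫ _) ≫ D.T.map (D.π₂.app (D.T.obj A))
    rw [Category.assoc, Category.assoc, Category.assoc, ← D.T.map_comp, h₂, hv'.2,
      D.T.map_comp, ← reassoc_of% hc₂, ← Category.assoc, ← D.T.map_comp, hv.2, reassoc_of% h₂]
    rw [D.T.map_comp, Category.assoc, hl]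

/-- The universality of the vertical lift is preserved by all iterates of the tangent functor. -/
theorem TangentData.IsTangent.linear_iter (hD : D.IsTangent) (k : ℕ) : ∀ (A : C)
    (v : D.T₂.obj A ⟶ D.T.obj (D.T₂.obj A)), D.IsLiftPair A v →
    IsPullback ((iter D.T k).map (v ≫ D.T.map (D.s.app A)))
      ((iter D.T k).map (D.π₁.app A ≫ D.p.app A))
      ((iter D.T k).map (D.T.map (D.p.app A))) ((iter D.T k).map (D.z.app A)) := by
  induction k with
  | zero =>
    intro A v hv
    obtain ⟨w, hw, h⟩ := hD.linear A
    -- A lift pair is unique because `T` preserves the pullback defining `T₂ A` (the case `k = 1` of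
    -- `pullback₂`).
    have : v = w := (hD.pullback₂ A 1).hom_ext (hv.1.trans hw.1.symm) (hv.2.trans hw.2.symm)
    subst this
    exact h
  | succ k ih =>
    intro A v hv
    obtain ⟨v', hv', -⟩ := hD.linear (D.T.obj A)
    obtain ⟨hcq, hcz, θ, h₁, h₂, h₃⟩ := hD.equations.flip_additive A
    dsimp [TangentData.bundle, BundleData.map] at hcq hcz θ h₁ h₂ h₃
    rw [Category.comp_id] at hcq
    rw [Category.id_comp] at hcz
    have hcc := hD.equations.flip_flip A
    have hcc' := hD.equations.flip_flip (D.T.obj A)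
    let c₁ : D.T.obj (D.T.obj A) ≅ D.T.obj (D.T.obj A) := ⟨D.c.app A, D.c.app A, hcc, hcc⟩
    let c₂ : D.T.obj (D.T.obj (D.T.obj A)) ≅ D.T.obj (D.T.obj (D.T.obj A)) :=
      ⟨D.c.app (D.T.obj A), D.c.app (D.T.obj A), hcc', hcc'⟩
    -- Composing the preserved pullback `T (T₂ A)` with the flips gives another pullback of `p` at
    -- `T A` along itself, so the comparison `θ` with `T₂ (T A)` is invertible.
    have hθp : IsPullback (θ ≫ D.π₁.app (D.T.obj A)) (θ ≫ D.π₂.app (D.T.obj A))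
        (D.p.app (D.T.obj A)) (D.p.app (D.T.obj A)) := by
      refine (hD.pullback₂ A 1).of_iso (Iso.refl _) c₁ c₁ (Iso.refl _) ?_ ?_ ?_ ?_
      · exact (Category.id_comp _).trans h₁ |>.symm
      · exact (Category.id_comp _).trans h₂ |>.symm
      · exact (Category.comp_id _).trans hcq.symm
      · exact (Category.comp_id _).trans hcq.symm
    have hθ : IsIso θ := by
      have e := (hθp.isoIsPullback _ _ (hD.pullback₂ (D.T.obj A) 0)).isIso_hom
      have : (hθp.isoIsPullback _ _ (hD.pullback₂ (D.T.obj A) 0)).hom = θ :=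
        (hD.pullback₂ (D.T.obj A) 0).hom_ext (hθp.isoIsPullback_hom_fst _ _ _)
          (hθp.isoIsPullback_hom_snd _ _ _)
      rwa [this] at e
    have hfl := hv.flip hD hv' h₁ h₂
    have hcs := D.c.naturality (D.s.app A)
    have hcp := D.c.naturality (D.p.app A)
    dsimp at hcs hcp
    have key : IsPullback
        ((D.T ⋙ iter D.T k).map (v ≫ D.T.map (D.s.app A)))
        ((D.T ⋙ iter D.T k).map (D.π₁.app A ≫ D.p.app A))
        ((D.T ⋙ iter D.T k).map (D.T.map (D.p.app A)))
        ((D.T ⋙ iter D.T k).map (D.z.app A)) := by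
      -- The square at `T A`, a pullback after `iter D.T k` by induction, is isomorphic to `T` of
      -- the square at `A`: `θ` at the vertex, `c` followed by `T c` on the triple tangent bundle,
      -- the identity on `T A`, and `c` at the base.
      refine (ih (D.T.obj A) v' hv').of_iso' ((iter D.T k).mapIso (asIso θ))
        ((iter D.T k).mapIso (c₂ ≪≫ D.T.mapIso c₁)) (Iso.refl _) ((iter D.T k).mapIso c₁)
        ?_ ?_ ?_ ?_
      · dsimp [c₁, c₂]
        simp only [← Functor.map_comp]
        congr 1
        rw [← reassoc_of% hfl, ← D.T.map_comp, h₃, D.T.map_comp, ← reassoc_of% hcs,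
          D.T.map_comp, Category.assoc]
      · dsimp
        rw [Category.comp_id, ← Functor.map_comp, reassoc_of% h₁, hcq, ← D.T.map_comp]
      · dsimp [c₁, c₂]
        simp only [← Functor.map_comp]
        congr 1
        rw [Category.assoc, ← D.T.map_comp, hcq, hcp]
      · dsimp [c₁]
        rw [Category.id_comp, ← Functor.map_comp, hcz]
    rw [← iter_comp] at key
    exact key

end TangentLemmas

/-! ### The tangent restriction structure on partial maps -/

section ParTangentLemmas

variable {C : Type u} [Category.{v} C] {C' : Type u'} [Category.{v'} C']

variable {M : MorphismProperty C} [hM : IsMonicSystem M] {M' : MorphismProperty C'}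
  [IsMonicSystem M']

theorem BundleData.IsAdditive.par {Q : BundleData C} (h : Q.IsAdditive) :
    (Q.map (Par.incl M)).IsAdditive where
  zero_q := by
    dsimp [BundleData.map]
    rw [← Functor.map_comp, h.zero_q]
    rfl
  sum_q := by
    dsimp [BundleData.map]
    rw [← Functor.map_comp, h.sum_q, Functor.map_comp]
  assoc {Z} u v w w' h₁ h₂ h₃ h₄ h₅ := by
    change ParHom M Z.obj Q.E₂ at u v w w'
    change ParHom.comp v (ParHom.tot Q.fst) = ParHom.comp u (ParHom.tot Q.sum) at h₁
    change ParHom.comp w (ParHom.tot Q.fst) = ParHom.comp u (ParHom.tot Q.snd) at h₂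
    change ParHom.comp w (ParHom.tot Q.snd) = ParHom.comp v (ParHom.tot Q.snd) at h₃
    change ParHom.comp w' (ParHom.tot Q.fst) = ParHom.comp u (ParHom.tot Q.fst) at h₄
    change ParHom.comp w' (ParHom.tot Q.snd) = ParHom.comp w (ParHom.tot Q.sum) at h₅
    change ParHom.comp v (ParHom.tot Q.sum) = ParHom.comp w' (ParHom.tot Q.sum)
    induction u using ParHom.ind with
    | h S m hm u =>
      -- These three equations force `v`, `w` and `w'` to have the leg `m` of `u`; what remains is
      -- associativity in `C` for maps out of `S`.
      rw [ParHom.comp_tot] at h₁ h₂ h₄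
      obtain ⟨v, rfl, hv⟩ := ParHom.exists_mk_of_comp_tot h₁
      obtain ⟨w, rfl, hw⟩ := ParHom.exists_mk_of_comp_tot h₂
      obtain ⟨w', rfl, hw'⟩ := ParHom.exists_mk_of_comp_tot h₄
      rw [ParHom.comp_tot, ParHom.comp_tot] at h₃ h₅ ⊢
      exact ParHom.mk_congr rfl
        (h.assoc u v w w' hv hw (ParHom.mk_inj h₃) hw' (ParHom.mk_inj h₅))
  unit := by
    obtain ⟨k, h1, h2, h3⟩ := h.unit
    refine ⟨(Par.incl M).map k, ?_, ?_, ?_⟩ <;> dsimp [BundleData.map] <;>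
      simp only [← Functor.map_comp, h1, h2, h3] <;> rfl
  comm := by
    obtain ⟨k, h1, h2, h3⟩ := h.comm
    refine ⟨(Par.incl M).map k, ?_, ?_, ?_⟩ <;> dsimp [BundleData.map] <;>
      simp only [← Functor.map_comp, h1, h2, h3]

/-- With the next two lemmas this gives a calculus of total spans: an equation between structural
maps of `Par M` reduces to the same equation in `C`. The hypotheses are equations because the
components of `D.par` are of the form `tot f` only up to identity factors. -/
theorem Par.comp_eq_tot {A B E : Par M} {x : A ⟶ B} {y : B ⟶ E} {f : A.obj ⟶ B.obj}
    {g : B.obj ⟶ E.obj} (hx : x = ParHom.tot f) (hy : y = ParHom.tot g) :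
    x ≫ y = ParHom.tot (f ≫ g) := by
  subst hx hy
  exact ParHom.tot_comp_tot f g

theorem Par.map_eq_tot {F : C ⥤ C'} (hF : IsMFunctor M M' F) {A B : Par M} {x : A ⟶ B}
    {f : A.obj ⟶ B.obj} (hx : x = ParHom.tot f) :
    (Par.map F hF).map x = ParHom.tot (F.map f) := by
  subst hx
  exact ParHom.map_tot hF f

theorem Par.eq_of_eq_tot {A B : Par M} {x y : A ⟶ B} {f g : A.obj ⟶ B.obj}
    (hx : x = ParHom.tot f) (hy : y = ParHom.tot g) (h : f = g) : x = y := by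
  rw [hx, hy, h]

variable (D : TangentData C) (h : D.IsMStructure M)

/-- The comparisons `Par.mapId` and `Par.mapComp` in the definition of `D.par` have identity
components; here and in the next three lemmas these factors are stripped off. -/
theorem TangentData.par_p_app (A : Par M) :
    (D.par M h).p.app A = ParHom.tot (D.p.app A.obj) :=
  ParHom.comp_id (ParHom.tot (D.p.app A.obj))

theorem TangentData.par_z_app (A : Par M) :
    (D.par M h).z.app A = ParHom.tot (D.z.app A.obj) :=
  ParHom.id_comp (ParHom.tot (D.z.app A.obj))

theorem TangentData.par_l_app (A : Par M) :
    (D.par M h).l.app A = ParHom.tot (D.l.app A.obj) :=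
  ParHom.comp_id (ParHom.tot (D.l.app A.obj))

theorem TangentData.par_c_app (A : Par M) :
    (D.par M h).c.app A = ParHom.tot (D.c.app A.obj) :=
  (ParHom.id_comp (ParHom.comp (ParHom.tot (D.c.app A.obj)) (ParHom.tot (𝟙 _)))).trans
    (ParHom.comp_id _)

theorem TangentData.par_bundle (A : C) :
    (D.par M h).bundle ⟨A⟩ = (D.bundle A).map (Par.incl M) := by
  unfold TangentData.bundle
  rw [TangentData.par_p_app, TangentData.par_z_app]
  rfl

theorem TangentData.Equations.par (hD : D.Equations) : (D.par M h).Equations where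
  additive A := by
    rw [show A = ⟨A.obj⟩ from rfl, D.par_bundle h A.obj]
    exact (hD.additive A.obj).par
  lift_additive A := by
    obtain ⟨h1, h2, k, h3, h4, h5⟩ := hD.lift_additive A.obj
    have hp := D.par_p_app h
    have hz := D.par_z_app h
    have hl := D.par_l_app h
    exact ⟨Par.eq_of_eq_tot (Par.comp_eq_tot (hl A) (Par.map_eq_tot h.T (hp A)))
        (Par.comp_eq_tot (hp A) (hz A)) h1,
      Par.eq_of_eq_tot (Par.comp_eq_tot (hz A) (hl A))
        (Par.comp_eq_tot (hz A) (Par.map_eq_tot h.T (hz A))) h2,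
      ParHom.tot k,
      Par.eq_of_eq_tot (Par.comp_eq_tot rfl (Par.map_eq_tot h.T rfl))
        (Par.comp_eq_tot rfl (hl A)) h3,
      Par.eq_of_eq_tot (Par.comp_eq_tot rfl (Par.map_eq_tot h.T rfl))
        (Par.comp_eq_tot rfl (hl A)) h4,
      Par.eq_of_eq_tot (Par.comp_eq_tot rfl (Par.map_eq_tot h.T rfl))
        (Par.comp_eq_tot rfl (hl A)) h5⟩
  flip_additive A := by
    obtain ⟨h1, h2, k, h3, h4, h5⟩ := hD.flip_additive A.obj
    have hp := D.par_p_app h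
    have hz := D.par_z_app h
    have hc := D.par_c_app h
    exact ⟨Par.eq_of_eq_tot (Par.comp_eq_tot (hc A) (hp _))
        (Par.comp_eq_tot (Par.map_eq_tot h.T (hp A)) rfl) h1,
      Par.eq_of_eq_tot (Par.comp_eq_tot (Par.map_eq_tot h.T (hz A)) (hc A))
        (Par.comp_eq_tot rfl (hz _)) h2,
      ParHom.tot k,
      Par.eq_of_eq_tot (Par.comp_eq_tot rfl rfl)
        (Par.comp_eq_tot (Par.map_eq_tot h.T rfl) (hc A)) h3,
      Par.eq_of_eq_tot (Par.comp_eq_tot rfl rfl)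
        (Par.comp_eq_tot (Par.map_eq_tot h.T rfl) (hc A)) h4,
      Par.eq_of_eq_tot (Par.comp_eq_tot rfl rfl)
        (Par.comp_eq_tot (Par.map_eq_tot h.T rfl) (hc A)) h5⟩
  lift_coassoc A :=
    have hl := D.par_l_app h
    Par.eq_of_eq_tot (Par.comp_eq_tot (hl A) (Par.map_eq_tot h.T (hl A)))
      (Par.comp_eq_tot (hl A) (hl _)) (hD.lift_coassoc A.obj)
  lift_flip A :=
    Par.eq_of_eq_tot (Par.comp_eq_tot (D.par_l_app h A) (D.par_c_app h A)) (D.par_l_app h A)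
      (hD.lift_flip A.obj)
  lift_flip_flip A :=
    have hl := D.par_l_app h
    have hc := D.par_c_app h
    Par.eq_of_eq_tot
      (Par.comp_eq_tot (hl _) (Par.comp_eq_tot (Par.map_eq_tot h.T (hc A)) (hc _)))
      (Par.comp_eq_tot (hc A) (Par.map_eq_tot h.T (hl A))) (hD.lift_flip_flip A.obj)
  flip_flip A :=
    Par.eq_of_eq_tot (Par.comp_eq_tot (D.par_c_app h A) (D.par_c_app h A)) rfl
      (hD.flip_flip A.obj)
  yang_baxter A :=
    have hc := D.par_c_app h
    have hTc := Par.map_eq_tot h.T (hc A)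
    Par.eq_of_eq_tot (Par.comp_eq_tot hTc (Par.comp_eq_tot (hc _) hTc))
      (Par.comp_eq_tot (hc _) (Par.comp_eq_tot hTc (hc _))) (hD.yang_baxter A.obj)

theorem Par.iter_isRestrictionPullback {T : C ⥤ C} (hT : IsMFunctor M M T) (k : ℕ)
    {P B E A : Par M} {x : P ⟶ B} {y : P ⟶ E} {x' : B ⟶ A} {y' : E ⟶ A}
    {fst : P.obj ⟶ B.obj} {snd : P.obj ⟶ E.obj} {f : B.obj ⟶ A.obj} {g : E.obj ⟶ A.obj}
    (hx : x = ParHom.tot fst) (hy : y = ParHom.tot snd) (hx' : x' = ParHom.tot f)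
    (hy' : y' = ParHom.tot g)
    (h : IsPullback ((iter T k).map fst) ((iter T k).map snd) ((iter T k).map f)
      ((iter T k).map g)) :
    IsRestrictionPullback ((iter (Par.map T hT) k).map x) ((iter (Par.map T hT) k).map y)
      ((iter (Par.map T hT) k).map x') ((iter (Par.map T hT) k).map y') := by
  subst hx hy hx' hy'
  have key : IsRestrictionPullback ((iter T k ⋙ Par.incl M).map fst)
      ((iter T k ⋙ Par.incl M).map snd) ((iter T k ⋙ Par.incl M).map f)
      ((iter T k ⋙ Par.incl M).map g) := Par.isRestrictionPullback h
  rw [← Par.incl_comp_iter hT] at key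
  exact key

theorem Par.iter_isNFoldRestrictionPullback {T : C ⥤ C} (hT : IsMFunctor M M T) (k : ℕ)
    {P B E : C} {n : ℕ} (hn : 1 ≤ n) {q : E ⟶ B} {π : Fin n → (P ⟶ E)}
    (h : IsNFoldPullback ((iter T k).map q) fun i => (iter T k).map (π i)) :
    IsNFoldRestrictionPullback ((iter (Par.map T hT) k).map ((Par.incl M).map q))
      (fun i => (iter (Par.map T hT) k).map ((Par.incl M).map (π i))) := by
  have key : IsNFoldRestrictionPullback ((iter T k ⋙ Par.incl M).map q)
      (fun i => (iter T k ⋙ Par.incl M).map (π i)) := Par.isNFoldRestrictionPullback hn h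
  rw [← Par.incl_comp_iter hT] at key
  exact key

theorem TangentData.IsTangent.par (hD : D.IsTangent) : (D.par M h).IsTangentRestriction where
  T_res := Par.isRestrictionFunctor_map h.T
  p_total A := by rw [D.par_p_app]; rfl
  z_total A := by rw [D.par_z_app]; rfl
  s_total A := rfl
  l_total A := by rw [D.par_l_app]; rfl
  c_total A := by rw [D.par_c_app]; rfl
  equations := hD.equations.par D h
  pullback₂ A k :=
    Par.iter_isRestrictionPullback h.T k rfl rfl (D.par_p_app h A) (D.par_p_app h A)
      (hD.pullback₂ A.obj k)
  pullbackN A n hn := by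
    obtain ⟨P, π, hπ⟩ := hD.pullbackN A.obj n hn
    refine ⟨⟨P⟩, fun i => (Par.incl M).map (π i), fun k => ?_⟩
    rw [D.par_p_app]
    exact Par.iter_isNFoldRestrictionPullback h.T k hn (hπ k)
  linear A := by
    have hp := D.par_p_app h
    have hz := D.par_z_app h
    have hl := D.par_l_app h
    -- Only the lift pair is taken from here: the pullback property is needed after every iterate of
    -- `T`, which `linear_iter` supplies.
    obtain ⟨v, hv, -⟩ := hD.linear A.obj
    exact ⟨ParHom.tot v,
      ⟨Par.eq_of_eq_tot (Par.comp_eq_tot rfl (Par.map_eq_tot h.T rfl))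
        (Par.comp_eq_tot rfl (hz _)) hv.1,
      Par.eq_of_eq_tot (Par.comp_eq_tot rfl (Par.map_eq_tot h.T rfl))
        (Par.comp_eq_tot rfl (hl A)) hv.2⟩,
      fun k => Par.iter_isRestrictionPullback h.T k
        (Par.comp_eq_tot rfl (Par.map_eq_tot h.T rfl)) (Par.comp_eq_tot rfl (hp A))
        (Par.map_eq_tot h.T (hp A)) (hz A) (hD.linear_iter k A.obj v hv)⟩

variable {D} {D' : TangentData C'} (h' : D'.IsMStructure M')

/-- The distributive law of `Par(F)` induced by an `M`-natural distributive law of `F`. -/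
noncomputable def Par.law {F : C ⥤ C'} (hF : IsMFunctor M M' F) (α : D.T ⋙ F ⟶ F ⋙ D'.T)
    (hα : IsMNatural M α) :
    (D.par M h).T ⋙ Par.map F hF ⟶ Par.map F hF ⋙ (D'.par M' h').T :=
  (Par.mapComp h.T hF).inv ≫ Par.mapTrans (h.T.comp hF) (hF.comp h'.T) α hα ≫
    (Par.mapComp hF h'.T).hom

theorem Par.law_app {F : C ⥤ C'} (hF : IsMFunctor M M' F) (α : D.T ⋙ F ⟶ F ⋙ D'.T)
    (hα : IsMNatural M α) (A : Par M) :
    (Par.law h h' hF α hα).app A = ParHom.tot (α.app A.obj) :=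
  (ParHom.id_comp (ParHom.comp (ParHom.tot (α.app A.obj)) (ParHom.tot (𝟙 _)))).trans
    (ParHom.comp_id _)

theorem IsLaxTangent.par {F : C ⥤ C'} (hF : IsMFunctor M M' F) {α : D.T ⋙ F ⟶ F ⋙ D'.T}
    (hα : IsMNatural M α) (hL : IsLaxTangent D D' F α) :
    IsLaxTangent (D.par M h) (D'.par M' h') (Par.map F hF) (Par.law h h' hF α hα) where
  additive A := by
    obtain ⟨h1, h2, k, h3, h4, h5⟩ := hL.additive A.obj
    have hp := D.par_p_app h A
    have hz := D.par_z_app h A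
    have hp' := D'.par_p_app h'
    have hz' := D'.par_z_app h'
    have hl := Par.law_app h h' hF α hα A
    exact ⟨Par.eq_of_eq_tot (Par.comp_eq_tot hl (hp' _))
        (Par.comp_eq_tot (Par.map_eq_tot hF hp) rfl) h1,
      Par.eq_of_eq_tot (Par.comp_eq_tot (Par.map_eq_tot hF hz) hl)
        (Par.comp_eq_tot rfl (hz' _)) h2,
      ParHom.tot k,
      Par.eq_of_eq_tot (Par.comp_eq_tot rfl rfl)
        (Par.comp_eq_tot (Par.map_eq_tot hF rfl) hl) h3,
      Par.eq_of_eq_tot (Par.comp_eq_tot rfl rfl)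
        (Par.comp_eq_tot (Par.map_eq_tot hF rfl) hl) h4,
      Par.eq_of_eq_tot (Par.comp_eq_tot rfl rfl)
        (Par.comp_eq_tot (Par.map_eq_tot hF rfl) hl) h5⟩
  lift A :=
    have hl := Par.law_app h h' hF α hα
    Par.eq_of_eq_tot (Par.comp_eq_tot (Par.map_eq_tot hF (D.par_l_app h A))
        (Par.comp_eq_tot (hl _) (Par.map_eq_tot h'.T (hl A))))
      (Par.comp_eq_tot (hl A) (D'.par_l_app h' _)) (hL.lift A.obj)
  flip A :=
    have hl := Par.law_app h h' hF α hα
    Par.eq_of_eq_tot (Par.comp_eq_tot (Par.map_eq_tot hF (D.par_c_app h A))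
        (Par.comp_eq_tot (hl _) (Par.map_eq_tot h'.T (hl A))))
      (Par.comp_eq_tot (hl _)
        (Par.comp_eq_tot (Par.map_eq_tot h'.T (hl A)) (D'.par_c_app h' _))) (hL.flip A.obj)

theorem IsTangentTrans.par {F G : C ⥤ C'} {hF : IsMFunctor M M' F} {hG : IsMFunctor M M' G}
    {α : D.T ⋙ F ⟶ F ⋙ D'.T} {β : D.T ⋙ G ⟶ G ⋙ D'.T} (hα : IsMNatural M α)
    (hβ : IsMNatural M β) {φ : F ⟶ G} (hφ : IsMNatural M φ) (hL : IsTangentTrans D D' α β φ) :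
    IsTangentTrans (D.par M h) (D'.par M' h') (Par.law h h' hF α hα) (Par.law h h' hG β hβ)
      (Par.mapTrans hF hG φ hφ) := fun A =>
  Par.eq_of_eq_tot (Par.comp_eq_tot (Par.law_app h h' hF α hα A) (Par.map_eq_tot h'.T rfl))
    (Par.comp_eq_tot rfl (Par.law_app h h' hG β hβ A)) (hL A.obj)

end ParTangentLemmas

/-! ### Extensionality for 1-morphisms -/

/-- The type of a distributive law depends on its functor, so once the functors are known to be
equal the laws are compared by heterogeneous equality of components. -/
theorem law_heq {C : Type u} [Category.{v} C] {C' : Type u'} [Category.{v'} C'] {T : C ⥤ C}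
    {T' : C' ⥤ C'} {F G : C ⥤ C'} {α : T ⋙ F ⟶ F ⋙ T'} {β : T ⋙ G ⟶ G ⋙ T'} (h : F = G)
    (hα : ∀ A, α.app A ≍ β.app A) : α ≍ β := by
  subst h
  exact heq_of_eq (NatTrans.ext (funext fun A => eq_of_heq (hα A)))

theorem MTangentCat.hom_hext {X Y : MTangentCat.{v, u}} {f g : X ⟶ Y}
    (hobj : ∀ A, f.F.obj A = g.F.obj A)
    (hmap : ∀ {A B : X.C} (a : A ⟶ B), f.F.map a ≍ g.F.map a)
    (hα : ∀ A, f.α.app A ≍ g.α.app A) : f = g :=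
  have h : f.F = g.F := Functor.hext hobj fun _ _ a => hmap a
  Hom.ext h (law_heq h hα)

theorem SplitTangentRestrictionCat.hom_hext {X Y : SplitTangentRestrictionCat.{v, u}} {f g : X ⟶ Y}
    (hobj : ∀ A, f.F.obj A = g.F.obj A)
    (hmap : ∀ {A B : X.C} (a : A ⟶ B), f.F.map a ≍ g.F.map a)
    (hα : ∀ A, f.α.app A ≍ g.α.app A) : f = g :=
  have h : f.F = g.F := Functor.hext hobj fun _ _ a => hmap a
  Hom.ext h (law_heq h hα)

/-! ### The 2-functor `Par` -/

namespace MTangentCat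

theorem isMStructure (X : MTangentCat.{v, u}) : X.D.IsMStructure X.M :=
  X.isTangent.isMStructure X.isMonicSystem

/-- The tangent split restriction category of partial maps of a tangent `M`-category. -/
noncomputable def par (X : MTangentCat.{v, u}) : SplitTangentRestrictionCat.{max u v, u} where
  C := Par X.M
  isSplit := Par.isSplit X.M
  D := X.D.par X.M X.isMStructure
  isTangent := X.isTangent.par X.D X.isMStructure

/-- The action of `Par` on 1-morphisms. -/
noncomputable def parMap {X Y : MTangentCat.{v, u}} (f : X ⟶ Y) : X.par ⟶ Y.par where
  F := Par.map f.F f.isM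
  α := Par.law X.isMStructure Y.isMStructure f.isM f.α f.α_M
  isRestriction := Par.isRestrictionFunctor_map f.isM
  α_total A := by
    rw [Par.law_app X.isMStructure Y.isMStructure f.isM f.α f.α_M A]
    rfl
  isLax := f.isLax.par X.isMStructure Y.isMStructure f.isM f.α_M

theorem parMap_α_app {X Y : MTangentCat.{v, u}} (f : X ⟶ Y) (A : Par X.M) :
    (parMap f).α.app A = ParHom.tot (f.α.app A.obj) :=
  Par.law_app X.isMStructure Y.isMStructure f.isM f.α f.α_M A

/-- The action of `Par` on 2-morphisms. -/
noncomputable def parMap₂ {X Y : MTangentCat.{v, u}} {f g : X ⟶ Y} (θ : f ⟶ g) :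
    parMap f ⟶ parMap g where
  φ := Par.mapTrans f.isM g.isM (Hom₂.φ θ) (Hom₂.isM θ)
  isTotal _ := rfl
  isTangent := IsTangentTrans.par X.isMStructure Y.isMStructure f.α_M g.α_M (Hom₂.isM θ) (Hom₂.isTangent θ)

theorem parMap_id (X : MTangentCat.{v, u}) : parMap (𝟙 X) = 𝟙 X.par :=
  SplitTangentRestrictionCat.hom_hext (fun _ => rfl)
    (fun x => heq_of_eq (by
      change ParHom.map (IsMFunctor.id X.M) x = x
      induction x using ParHom.ind with
      | h S m hm f => rfl))
    (fun A => heq_of_eq (parMap_α_app (𝟙 X) A))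

theorem parMap_comp {X Y Z : MTangentCat.{v, u}} (f : X ⟶ Y) (g : Y ⟶ Z) :
    parMap (f ≫ g) = parMap f ≫ parMap g :=
  SplitTangentRestrictionCat.hom_hext (fun _ => rfl)
    (fun x => heq_of_eq (by
      change ParHom.map (f.isM.comp g.isM) x = ParHom.map g.isM (ParHom.map f.isM x)
      induction x using ParHom.ind with
      | h S m hm f => rfl))
    (fun A => heq_of_eq ((parMap_α_app (f ≫ g) A).trans
      (Par.comp_eq_tot (Par.map_eq_tot g.isM (parMap_α_app f A)) (parMap_α_app g _)).symm))

/-- The 2-functor `Par`. -/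
noncomputable def parFunctor :
    StrictPseudofunctor MTangentCat.{max u v, u} SplitTangentRestrictionCat.{max u v, u} :=
  StrictPseudofunctor.mk''
    { obj := fun X => par X
      map := fun f => parMap f
      map₂ := fun θ => parMap₂ θ
      map₂_id := fun _ => SplitTangentRestrictionCat.hom₂_ext fun _ => rfl
      map₂_comp := fun θ η => SplitTangentRestrictionCat.hom₂_ext fun A =>
        (ParHom.tot_comp_tot ((Hom₂.φ θ).app A.obj) ((Hom₂.φ η).app A.obj)).symm
      map_id := parMap_id
      map_comp := parMap_comp
      map₂_whisker_left := fun f _ _ θ => SplitTangentRestrictionCat.hom₂_ext fun A => by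
        -- `parMap_comp` is definitional on objects, so the components of the `eqToHom`s are
        -- identities.
        rw [SplitTangentRestrictionCat.comp_app, SplitTangentRestrictionCat.comp_app,
          SplitTangentRestrictionCat.eqToHom_app, SplitTangentRestrictionCat.eqToHom_app]
        exact ((Category.id_comp _).trans (Category.comp_id _)).symm
      map₂_whisker_right := fun θ g => SplitTangentRestrictionCat.hom₂_ext fun A => by
        rw [SplitTangentRestrictionCat.comp_app, SplitTangentRestrictionCat.comp_app,
          SplitTangentRestrictionCat.eqToHom_app, SplitTangentRestrictionCat.eqToHom_app]
        refine Eq.trans ?_ ((Category.id_comp _).trans (Category.comp_id _)).symm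
        exact (ParHom.map_tot g.isM _).symm }

end MTangentCat

/-! ### The category of total maps of a restriction category -/

section Tot

open RestrictionCategory

/-- The objects of the category of total maps of `C` are the objects of `C`. -/
structure Tot (C : Type u) : Type u where
  obj : C

variable {C : Type u} [Category.{v} C] [RestrictionCategory C]
  {C' : Type u'} [Category.{v'} C'] [RestrictionCategory C']

instance Tot.category : Category.{v} (Tot C) where
  Hom A B := { f : A.obj ⟶ B.obj // IsTotal f }
  id A := ⟨𝟙 A.obj, isTotal_id A.obj⟩
  comp f g := ⟨f.1 ≫ g.1, isTotal_comp f.2 g.2⟩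
  id_comp f := Subtype.ext (Category.id_comp f.1)
  comp_id f := Subtype.ext (Category.comp_id f.1)
  assoc f g h := Subtype.ext (Category.assoc f.1 g.1 h.1)

theorem Tot.hom_ext {A B : Tot C} {f g : A ⟶ B} (h : f.1 = g.1) : f = g := Subtype.ext h

theorem Tot.comp_val {A B E : Tot C} (f : A ⟶ B) (g : B ⟶ E) : (f ≫ g).1 = f.1 ≫ g.1 := rfl

variable (C) in
/-- The inclusion of the total maps. -/
def Tot.incl : Tot C ⥤ C where
  obj A := A.obj
  map f := f.1

/-- The action of a restriction functor on total maps. -/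
def Tot.map (F : C ⥤ C') (hF : IsRestrictionFunctor F) : Tot C ⥤ Tot C' where
  obj A := ⟨F.obj A.obj⟩
  map f := ⟨F.map f.1, hF.isTotal f.2⟩
  map_id A := Tot.hom_ext (F.map_id A.obj)
  map_comp f g := Tot.hom_ext (F.map_comp f.1 g.1)

/-- The action of a total natural transformation on total maps. -/
def Tot.mapTrans {F G : C ⥤ C'} (hF : IsRestrictionFunctor F) (hG : IsRestrictionFunctor G)
    (φ : F ⟶ G) (hφ : IsTotalTrans φ) : Tot.map F hF ⟶ Tot.map G hG where
  app A := ⟨φ.app A.obj, hφ A.obj⟩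
  naturality _ _ f := Tot.hom_ext (φ.naturality f.1)

theorem Tot.iter_comp_incl {T : C ⥤ C} (hT : IsRestrictionFunctor T) (k : ℕ) :
    iter (Tot.map T hT) k ⋙ Tot.incl C = Tot.incl C ⋙ iter T k := by
  induction k with
  | zero => rfl
  | succ k ih =>
    calc iter (Tot.map T hT) (k + 1) ⋙ Tot.incl C
        = (iter (Tot.map T hT) k ⋙ Tot.incl C) ⋙ T := rfl
      _ = Tot.incl C ⋙ iter T (k + 1) := by rw [ih]; rfl

/-- A criterion with existence and joint monicity as separate hypotheses; both restriction pullbacks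
and retract squares meet it in this form. -/
theorem isPullback_of_exists {K : Type u'} [Category.{v'} K] {P B E A : K} {fst : P ⟶ B}
    {snd : P ⟶ E} {f : B ⟶ A} {g : E ⟶ A} (w : fst ≫ f = snd ≫ g)
    (h : ∀ {Z : K} (b : Z ⟶ B) (e : Z ⟶ E), b ≫ f = e ≫ g → ∃ t, t ≫ fst = b ∧ t ≫ snd = e)
    (h' : ∀ {Z : K} (t t' : Z ⟶ P), t ≫ fst = t' ≫ fst → t ≫ snd = t' ≫ snd → t = t') :
    IsPullback fst snd f g :=
  ⟨⟨w⟩, ⟨Limits.PullbackCone.IsLimit.mk w (fun s => (h s.fst s.snd s.condition).choose)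
    (fun s => (h s.fst s.snd s.condition).choose_spec.1)
    (fun s => (h s.fst s.snd s.condition).choose_spec.2)
    (fun s _ h₁ h₂ => h' _ _ (h₁.trans (h s.fst s.snd s.condition).choose_spec.1.symm)
      (h₂.trans (h s.fst s.snd s.condition).choose_spec.2.symm))⟩⟩

theorem isTotal_of_comp_eq {A B E : C} {f : A ⟶ B} {g : B ⟶ E} {k : A ⟶ E} (h : f ≫ g = k)
    (hk : IsTotal k) : IsTotal f :=
  isTotal_of_comp (h ▸ hk)

theorem IsRestrictionPullback.exists_lift {P B E A X : C} {fst : P ⟶ B} {snd : P ⟶ E}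
    {f : B ⟶ A} {g : E ⟶ A} (h : IsRestrictionPullback fst snd f g) {b : X ⟶ B} {e : X ⟶ E}
    (hb : IsTotal b) (he : IsTotal e) (w : b ≫ f = e ≫ g) : ∃ t, t ≫ fst = b ∧ t ≫ snd = e := by
  unfold IsTotal at hb he
  obtain ⟨t, ⟨h₁, h₂⟩, -⟩ := h.lift b e (by rw [hb, he, w])
  rw [he, Category.id_comp] at h₁
  rw [hb, Category.id_comp] at h₂
  exact ⟨t, h₁, h₂⟩

/-- For total maps the truncation by `meet b` is the identity, so the restricted universal property
becomes the usual one. -/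
theorem IsNFoldRestrictionPullback.existsUnique_lift {P E B X : C} {n : ℕ} {q : E ⟶ B}
    {π : Fin n → (P ⟶ E)} (h : IsNFoldRestrictionPullback q π) {b : Fin n → (X ⟶ E)}
    (hb : ∀ i, IsTotal (b i)) (w : ∀ i j, b i ≫ q = b j ≫ q) : ∃! t, ∀ i, t ≫ π i = b i := by
  have hr : ∀ i, res (b i) = 𝟙 X := hb
  have h' := h.lift b fun i j => by rw [hr, hr, w i j]
  simpa only [meet_of_total b hb, Category.id_comp] using h'

/-- Restriction pullbacks are pullbacks of total maps. -/
theorem Tot.isPullback {P B E A : Tot C} {fst : P ⟶ B} {snd : P ⟶ E} {f : B ⟶ A} {g : E ⟶ A}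
    (h : IsRestrictionPullback ((Tot.incl C).map fst) ((Tot.incl C).map snd)
      ((Tot.incl C).map f) ((Tot.incl C).map g)) : IsPullback fst snd f g := by
  refine isPullback_of_exists (Tot.hom_ext h.w) (fun {Z} b e hw => ?_) (fun t t' h₁ h₂ => ?_)
  · obtain ⟨t, h₁, h₂⟩ := h.exists_lift b.2 e.2 (congrArg Subtype.val hw)
    exact ⟨⟨t, isTotal_of_comp_eq h₁ b.2⟩, Tot.hom_ext h₁, Tot.hom_ext h₂⟩
  · exact Tot.hom_ext (h.hom_ext (congrArg Subtype.val h₁) (congrArg Subtype.val h₂))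

/-- `n`-fold restriction pullbacks are `n`-fold pullbacks of total maps. -/
theorem Tot.isNFoldPullback {P B E : Tot C} {n : ℕ} (hn : 1 ≤ n) {q : E ⟶ B}
    {π : Fin n → (P ⟶ E)} (h : IsNFoldRestrictionPullback ((Tot.incl C).map q)
      (fun i => (Tot.incl C).map (π i))) : IsNFoldPullback q π := by
  refine ⟨fun i j => Tot.hom_ext (h.w i j), fun Z b hb => ?_⟩
  obtain ⟨t, ht, ht'⟩ := h.existsUnique_lift (fun i => (b i).2)
    fun i j => congrArg Subtype.val (hb i j)
  exact ⟨⟨t, isTotal_of_comp_eq (ht ⟨0, hn⟩) (b ⟨0, hn⟩).2⟩, fun i => Tot.hom_ext (ht i),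
    fun t' h' => Tot.hom_ext (ht' t'.1 fun i => congrArg Subtype.val (h' i))⟩

theorem Tot.iter_isPullback {T : C ⥤ C} (hT : IsRestrictionFunctor T) (k : ℕ)
    {P B E A : Tot C} {fst : P ⟶ B} {snd : P ⟶ E} {f : B ⟶ A} {g : E ⟶ A}
    (h : IsRestrictionPullback ((iter T k).map fst.1) ((iter T k).map snd.1)
      ((iter T k).map f.1) ((iter T k).map g.1)) :
    IsPullback ((iter (Tot.map T hT) k).map fst) ((iter (Tot.map T hT) k).map snd)
      ((iter (Tot.map T hT) k).map f) ((iter (Tot.map T hT) k).map g) := by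
  have key : IsRestrictionPullback ((Tot.incl C ⋙ iter T k).map fst)
      ((Tot.incl C ⋙ iter T k).map snd) ((Tot.incl C ⋙ iter T k).map f)
      ((Tot.incl C ⋙ iter T k).map g) := h
  rw [← Tot.iter_comp_incl hT] at key
  exact Tot.isPullback key

theorem Tot.iter_isNFoldPullback {T : C ⥤ C} (hT : IsRestrictionFunctor T) (k : ℕ)
    {P B E : Tot C} {n : ℕ} (hn : 1 ≤ n) {q : E ⟶ B} {π : Fin n → (P ⟶ E)}
    (h : IsNFoldRestrictionPullback ((iter T k).map q.1) (fun i => (iter T k).map (π i).1)) :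
    IsNFoldPullback ((iter (Tot.map T hT) k).map q)
      (fun i => (iter (Tot.map T hT) k).map (π i)) := by
  have key : IsNFoldRestrictionPullback ((Tot.incl C ⋙ iter T k).map q)
      (fun i => (Tot.incl C ⋙ iter T k).map (π i)) := h
  rw [← Tot.iter_comp_incl hT] at key
  exact Tot.isNFoldPullback hn key

/-! ### Restriction monics -/

/-- `r` is a restriction retraction of `m`. -/
def IsResRetraction {A B : C} (m : A ⟶ B) (r : B ⟶ A) : Prop := m ≫ r = 𝟙 A ∧ r ≫ m = res r

/-- Each of `r`, `r'` is a restriction of the other, so their domains coincide and the two maps are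
equal. -/
theorem IsResRetraction.unique {A B : C} {m : A ⟶ B} {r r' : B ⟶ A} (h : IsResRetraction m r)
    (h' : IsResRetraction m r') : r = r' := by
  have e₁ : r = res r ≫ r' := by rw [← h.2, Category.assoc, h'.1, Category.comp_id]
  have e₂ : r' = res r' ≫ r := by rw [← h'.2, Category.assoc, h.1, Category.comp_id]
  have e₃ : res r' = res r := by
    have a₁ := congrArg res e₁
    have a₂ := congrArg res e₂
    rw [res_res_comp] at a₁ a₂
    rw [a₂, res_comm, ← a₁]
  rw [e₁, ← e₃, res_comp_self]

theorem IsResRetraction.map {F : C ⥤ C'} (hF : IsRestrictionFunctor F) {A B : C} {m : A ⟶ B}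
    {r : B ⟶ A} (h : IsResRetraction m r) : IsResRetraction (F.map m) (F.map r) :=
  ⟨by rw [← F.map_comp, h.1, F.map_id], by rw [← F.map_comp, h.2, hF]⟩

theorem IsResRetraction.comp {A B E : C} {m : A ⟶ B} {r : B ⟶ A} {n : B ⟶ E} {s : E ⟶ B}
    (h : IsResRetraction m r) (h' : IsResRetraction n s) : IsResRetraction (m ≫ n) (s ≫ r) := by
  refine ⟨?_, ?_⟩
  · rw [Category.assoc, ← Category.assoc n, h'.1, Category.id_comp, h.1]
  · rw [Category.assoc, ← Category.assoc r, h.2, ← Category.assoc, comp_res, Category.assoc, h'.2,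
      res_comp_res]

variable (C) in
/-- The restriction monics, as morphisms of `Tot C`. -/
def Tot.monics : MorphismProperty (Tot C) := fun _ _ m => ∃ r, IsResRetraction m.1 r

theorem Tot.monics_map (F : C ⥤ C') (hF : IsRestrictionFunctor F) {A B : Tot C} {m : A ⟶ B}
    (hm : Tot.monics C m) : Tot.monics C' ((Tot.map F hF).map m) := by
  obtain ⟨r, hr⟩ := hm
  exact ⟨F.map r, hr.map hF⟩

theorem Tot.monics_mono {A B : Tot C} {m : A ⟶ B} (hm : Tot.monics C m) : Mono m := by
  obtain ⟨r, hr⟩ := hm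
  refine ⟨fun g h w => Tot.hom_ext ?_⟩
  have := congrArg (fun k => k.1 ≫ r) w
  simpa only [Tot.comp_val, Category.assoc, hr.1, Category.comp_id] using this

theorem Tot.monics_iso {A B : Tot C} (f : A ⟶ B) [IsIso f] : Tot.monics C f := by
  have h₂ : (inv f).1 ≫ f.1 = 𝟙 _ := congrArg Subtype.val (IsIso.inv_hom_id f)
  exact ⟨(inv f).1, congrArg Subtype.val (IsIso.hom_inv_id f), h₂.trans (inv f).2.symm⟩

theorem Tot.monics_comp {A B E : Tot C} {m : A ⟶ B} {n : B ⟶ E} (hm : Tot.monics C m)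
    (hn : Tot.monics C n) : Tot.monics C (m ≫ n) := by
  obtain ⟨r, hr⟩ := hm
  obtain ⟨s, hs⟩ := hn
  exact ⟨s ≫ r, hr.comp hs⟩

/-- A commutative square of total maps, two parallel sides of which are restriction monics whose
retractions are compatible with the other two sides. -/
def IsRetractSquare {P N A B : Tot C} (fst : P ⟶ N) (snd : P ⟶ A) (f : N ⟶ B) (m : A ⟶ B) : Prop :=
  fst ≫ f = snd ≫ m ∧ ∃ r s, IsResRetraction fst.1 r ∧ IsResRetraction m.1 s ∧
    r ≫ snd.1 = f.1 ≫ s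

/-- The lift of a cone `(x, y)` is `x ≫ r`. Its second component is `y` by the compatibility of the
retractions; as `y` is total, so is `x ≫ r`, hence `x` factors through the domain of `r` and `x ≫ r
≫ fst = x`. -/
theorem IsRetractSquare.isPullback {P N A B : Tot C} {fst : P ⟶ N} {snd : P ⟶ A} {f : N ⟶ B}
    {m : A ⟶ B} (h : IsRetractSquare fst snd f m) : IsPullback fst snd f m := by
  obtain ⟨w, r, s, hr, hs, e⟩ := h
  refine isPullback_of_exists w (fun {Z} x y hw => ?_) (fun t t' h₁ _ => ?_)
  · have hw' : x.1 ≫ f.1 = y.1 ≫ m.1 := congrArg Subtype.val hw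
    have e' : (x.1 ≫ r) ≫ snd.1 = y.1 := by
      rw [Category.assoc, e, ← Category.assoc, hw', Category.assoc, hs.1, Category.comp_id]
    have ht : IsTotal (x.1 ≫ r) := isTotal_of_comp (e'.symm ▸ y.2)
    refine ⟨⟨x.1 ≫ r, ht⟩, Tot.hom_ext ?_, Tot.hom_ext e'⟩
    change (x.1 ≫ r) ≫ fst.1 = x.1
    rw [Category.assoc, hr.2, comp_res, ht, Category.id_comp]
  · have := Tot.monics_mono ⟨r, hr⟩
    exact (cancel_mono fst).1 h₁

/-- The data of a retract square are equations involving only composition and restriction. Such a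
square is thus an absolute pullback for restriction functors. -/
theorem IsRetractSquare.map {P N A B : Tot C} {fst : P ⟶ N} {snd : P ⟶ A} {f : N ⟶ B}
    {m : A ⟶ B} (h : IsRetractSquare fst snd f m) (F : C ⥤ C') (hF : IsRestrictionFunctor F) :
    IsRetractSquare ((Tot.map F hF).map fst) ((Tot.map F hF).map snd) ((Tot.map F hF).map f)
      ((Tot.map F hF).map m) := by
  obtain ⟨w, r, s, hr, hs, e⟩ := h
  refine ⟨by rw [← Functor.map_comp, w, Functor.map_comp], F.map r, F.map s, hr.map hF, hs.map hF,
    ?_⟩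
  change F.map r ≫ F.map snd.1 = F.map f.1 ≫ F.map s
  rw [← F.map_comp, e, F.map_comp]

theorem IsRetractSquare.iter {T : C ⥤ C} (hT : IsRestrictionFunctor T) {P N A B : Tot C}
    {fst : P ⟶ N} {snd : P ⟶ A} {f : N ⟶ B} {m : A ⟶ B} (h : IsRetractSquare fst snd f m) (k : ℕ) :
    IsRetractSquare ((iter (Tot.map T hT) k).map fst) ((iter (Tot.map T hT) k).map snd)
      ((iter (Tot.map T hT) k).map f) ((iter (Tot.map T hT) k).map m) := by
  induction k with
  | zero => exact h
  | succ k ih => exact ih.map T hT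

/-- The preimage of `m` under `f` is the domain of `f ≫ s`, where `s` retracts `m`; it becomes an
object by splitting `res (f ≫ s)`. -/
theorem Tot.exists_isRetractSquare (hC : IsSplit C) {N A B : Tot C} (f : N ⟶ B) {m : A ⟶ B}
    (hm : Tot.monics C m) :
    ∃ (P : Tot C) (fst : P ⟶ N) (snd : P ⟶ A), IsRetractSquare fst snd f m := by
  obtain ⟨s, hs⟩ := hm
  obtain ⟨S, n, q, h₁, h₂⟩ := hC (f.1 ≫ s)
  have hq : res q = res (f.1 ≫ s) := by
    rw [← res_res (f.1 ≫ s), ← h₂, res_comp_total q (isTotal_of_comp_eq_id h₁)]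
  have e : n ≫ f.1 = (n ≫ f.1 ≫ s) ≫ m.1 := by
    rw [Category.assoc, Category.assoc, hs.2, comp_res, ← h₂, Category.assoc, ← Category.assoc n q,
      h₁, Category.id_comp]
  have ht : IsTotal (n ≫ f.1 ≫ s) :=
    isTotal_of_comp (e ▸ isTotal_comp (isTotal_of_comp_eq_id h₁) f.2)
  refine ⟨⟨S⟩, ⟨n, isTotal_of_comp_eq_id h₁⟩, ⟨n ≫ f.1 ≫ s, ht⟩, Tot.hom_ext e, q, s,
    ⟨h₁, h₂.trans hq.symm⟩, hs, ?_⟩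
  change q ≫ n ≫ f.1 ≫ s = f.1 ≫ s
  rw [← Category.assoc, h₂, res_comp_self]

/-- Any pullback along a restriction monic is isomorphic to the one built from a splitting, and
isomorphisms have restriction retractions. Hence restriction functors preserve all these pullbacks.
-/
theorem Tot.isRetractSquare_of_isPullback (hC : IsSplit C) {P N A B : Tot C} {fst : P ⟶ N}
    {snd : P ⟶ A} {f : N ⟶ B} {m : A ⟶ B} (hm : Tot.monics C m) (h : IsPullback fst snd f m) :
    IsRetractSquare fst snd f m := by
  obtain ⟨P', fst', snd', h'⟩ := Tot.exists_isRetractSquare hC f hm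
  obtain ⟨e, e₁, e₂⟩ : ∃ e : P ≅ P', e.hom ≫ fst' = fst ∧ e.inv ≫ snd = snd' :=
    ⟨h.isoIsPullback _ _ h'.isPullback, h.isoIsPullback_hom_fst _ _ _,
      h.isoIsPullback_inv_snd _ _ _⟩
  obtain ⟨-, r, s, hr, hs, e'⟩ := h'
  obtain ⟨i, hi⟩ := Tot.monics_iso e.hom
  have hi' : i = e.inv.1 := by
    have : e.inv.1 ≫ e.hom.1 = 𝟙 _ := congrArg Subtype.val e.inv_hom_id
    rw [← Category.id_comp i, ← this, Category.assoc, hi.1, Category.comp_id]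
  refine ⟨h.w, r ≫ i, s, ?_, hs, ?_⟩
  · rw [← e₁]
    exact hi.comp hr
  · rw [← e', ← e₂, hi', Category.assoc]
    rfl

/-- Total natural transformations are natural with respect to restriction monics. -/
theorem IsTotalTrans.isRetractSquare {F G : C ⥤ C'} (hF : IsRestrictionFunctor F)
    (hG : IsRestrictionFunctor G) {φ : F ⟶ G} (hφ : IsTotalTrans φ) {A B : Tot C} {m : A ⟶ B}
    (hm : Tot.monics C m) :
    IsRetractSquare ((Tot.map F hF).map m) ((Tot.mapTrans hF hG φ hφ).app A)
      ((Tot.mapTrans hF hG φ hφ).app B) ((Tot.map G hG).map m) := by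
  obtain ⟨r, hr⟩ := hm
  -- The last entry is naturality of `φ` at the partial map `r`, which is not visible among total
  -- maps alone.
  exact ⟨(Tot.mapTrans hF hG φ hφ).naturality m, F.map r, G.map r, hr.map hF, hr.map hG,
    φ.naturality r⟩

theorem Tot.isMNatural {F G : C ⥤ C'} (hF : IsRestrictionFunctor F)
    (hG : IsRestrictionFunctor G) {φ : F ⟶ G} (hφ : IsTotalTrans φ) :
    IsMNatural (Tot.monics C) (Tot.mapTrans hF hG φ hφ) := fun _ _ _ hm =>
  (hφ.isRetractSquare hF hG hm).isPullback

theorem Tot.isMFunctor (hC : IsSplit C) (F : C ⥤ C') (hF : IsRestrictionFunctor F) :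
    IsMFunctor (Tot.monics C) (Tot.monics C') (Tot.map F hF) where
  map_mem _ hm := Tot.monics_map F hF hm
  map_pullback hm h := ((Tot.isRetractSquare_of_isPullback hC hm h).map F hF).isPullback

/-! ### The tangent structure on total maps -/

theorem BundleData.IsAdditive.of_map_incl {Q : BundleData (Tot C)}
    (h : (Q.map (Tot.incl C)).IsAdditive) : Q.IsAdditive where
  zero_q := Tot.hom_ext h.zero_q
  sum_q := Tot.hom_ext h.sum_q
  assoc u v w w' h₁ h₂ h₃ h₄ h₅ := Tot.hom_ext (h.assoc u.1 v.1 w.1 w'.1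
    (congrArg Subtype.val h₁) (congrArg Subtype.val h₂) (congrArg Subtype.val h₃)
    (congrArg Subtype.val h₄) (congrArg Subtype.val h₅))
  unit := by
    obtain ⟨k, h₁, h₂, h₃⟩ := h.unit
    exact ⟨⟨k, isTotal_of_comp_eq h₂ (isTotal_id _)⟩, Tot.hom_ext h₁, Tot.hom_ext h₂,
      Tot.hom_ext h₃⟩
  comm := by
    obtain ⟨k, h₁, h₂, h₃⟩ := h.comm
    exact ⟨⟨k, isTotal_of_comp_eq h₁ Q.snd.2⟩, Tot.hom_ext h₁, Tot.hom_ext h₂,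
      Tot.hom_ext h₃⟩

theorem IsAdditiveMorphism.of_map_incl {P Q : BundleData (Tot C)} {f : P.B ⟶ Q.B} {g : P.E ⟶ Q.E}
    (h : IsAdditiveMorphism (P.map (Tot.incl C)) (Q.map (Tot.incl C)) f.1 g.1) :
    IsAdditiveMorphism P Q f g := by
  obtain ⟨h1, h2, k, h3, h4, h5⟩ := h
  exact ⟨Tot.hom_ext h1, Tot.hom_ext h2,
    ⟨k, isTotal_of_comp_eq h3 (P.fst ≫ g).2⟩, Tot.hom_ext h3, Tot.hom_ext h4,
    Tot.hom_ext h5⟩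

variable {D : TangentData C}

/-- The definition asks this of `T` only. After either projection of `T₂`, both sides become the
restriction of `T₂ f` followed by that projection, and the projections are jointly monic. -/
theorem TangentData.IsTangentRestriction.T₂_res (hD : D.IsTangentRestriction) :
    IsRestrictionFunctor D.T₂ := by
  intro A B f
  have hπ : ∀ (π : D.T₂ ⟶ D.T), IsTotal (π.app B) →
      D.T₂.map (res f) ≫ π.app A = res (D.T₂.map f) ≫ π.app A := by
    intro π ht
    rw [π.naturality, hD.T_res, comp_res, ← π.naturality, res_comp_total _ ht]
  exact (hD.pullback₂ A 0).hom_ext (hπ D.π₁ (hD.pullback₂ B 0).fst_total)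
    (hπ D.π₂ (hD.pullback₂ B 0).snd_total)

/-- The tangent structure on total maps. -/
def TangentData.tot (D : TangentData C) (hD : D.IsTangentRestriction) : TangentData (Tot C) where
  T := Tot.map D.T hD.T_res
  p :=
    { app := fun A => ⟨D.p.app A.obj, hD.p_total A.obj⟩
      naturality := fun _ _ f => Tot.hom_ext (D.p.naturality f.1) }
  z :=
    { app := fun A => ⟨D.z.app A.obj, hD.z_total A.obj⟩
      naturality := fun _ _ f => Tot.hom_ext (D.z.naturality f.1) }
  T₂ := Tot.map D.T₂ hD.T₂_res
  π₁ := Tot.mapTrans hD.T₂_res hD.T_res D.π₁ fun A => (hD.pullback₂ A 0).fst_total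
  π₂ := Tot.mapTrans hD.T₂_res hD.T_res D.π₂ fun A => (hD.pullback₂ A 0).snd_total
  s := Tot.mapTrans hD.T₂_res hD.T_res D.s hD.s_total
  l :=
    { app := fun A => ⟨D.l.app A.obj, hD.l_total A.obj⟩
      naturality := fun _ _ f => Tot.hom_ext (D.l.naturality f.1) }
  c :=
    { app := fun A => ⟨D.c.app A.obj, hD.c_total A.obj⟩
      naturality := fun _ _ f => Tot.hom_ext (D.c.naturality f.1) }

theorem TangentData.IsTangentRestriction.tot_equations (hD : D.IsTangentRestriction) :
    (D.tot hD).Equations where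
  additive A := .of_map_incl (hD.equations.additive A.obj)
  lift_additive A := .of_map_incl (hD.equations.lift_additive A.obj)
  flip_additive A := .of_map_incl (hD.equations.flip_additive A.obj)
  lift_coassoc A := Tot.hom_ext (hD.equations.lift_coassoc A.obj)
  lift_flip A := Tot.hom_ext (hD.equations.lift_flip A.obj)
  lift_flip_flip A := Tot.hom_ext (hD.equations.lift_flip_flip A.obj)
  flip_flip A := Tot.hom_ext (hD.equations.flip_flip A.obj)
  yang_baxter A := Tot.hom_ext (hD.equations.yang_baxter A.obj)

theorem TangentData.IsTangentRestriction.tot_isTangent (hD : D.IsTangentRestriction) :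
    (D.tot hD).IsTangent where
  equations := hD.tot_equations
  pullback₂ A k := Tot.iter_isPullback hD.T_res k (hD.pullback₂ A.obj k)
  pullbackN A n hn := by
    obtain ⟨P, π, hπ⟩ := hD.pullbackN A.obj n hn
    exact ⟨⟨P⟩, fun i => ⟨π i, (hπ 0).total i⟩, fun k =>
      Tot.iter_isNFoldPullback hD.T_res k hn (hπ k)⟩
  linear A := by
    obtain ⟨v, hv, h⟩ := hD.linear A.obj
    -- The first component of `v` is a composite of total maps, and a map with a total composite is
    -- total.
    have ht : IsTotal v := isTotal_of_comp_eq hv.1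
      (isTotal_comp (hD.pullback₂ A.obj 0).fst_total (hD.z_total _))
    exact ⟨⟨v, ht⟩, ⟨Tot.hom_ext hv.1, Tot.hom_ext hv.2⟩,
      Tot.isPullback (h 0)⟩

/-- Étaleness holds because `p` is natural at the retraction of `m`, which makes its square at `m` a
retract square; those are stable under all iterates of `T`. -/
theorem TangentData.IsTangentRestriction.tot_isTangentMonicSystem
    (hD : D.IsTangentRestriction) (hC : IsSplit C) :
    IsTangentMonicSystem (D.tot hD) (Tot.monics C) where
  mono _ hm := Tot.monics_mono hm
  etale m hm k := by
    obtain ⟨r, hr⟩ := hm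
    have h : IsRetractSquare ((D.tot hD).T.map m) ((D.tot hD).p.app _) ((D.tot hD).p.app _) m :=
      ⟨(D.tot hD).p.naturality m, D.T.map r, r, hr.map hD.T_res, hr, D.p.naturality r⟩
    exact (h.iter hD.T_res k).isPullback
  iso f _ := Tot.monics_iso f
  comp _ _ hm hn := Tot.monics_comp hm hn
  map_mem _ hm := Tot.monics_map D.T hD.T_res hm
  pullback f m hm := by
    obtain ⟨P, fst, snd, h⟩ := Tot.exists_isRetractSquare hC f hm
    refine ⟨P, fst, snd, fun k => (h.iter hD.T_res k).isPullback, ?_⟩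
    obtain ⟨-, r, -, hr, -⟩ := h
    exact ⟨r, hr⟩

variable {D' : TangentData C'}

/-- The distributive law on total maps induced by a total distributive law. -/
def Tot.law (hD : D.IsTangentRestriction) (hD' : D'.IsTangentRestriction) {F : C ⥤ C'}
    (hF : IsRestrictionFunctor F) (α : D.T ⋙ F ⟶ F ⋙ D'.T) (hα : IsTotalTrans α) :
    (D.tot hD).T ⋙ Tot.map F hF ⟶ Tot.map F hF ⋙ (D'.tot hD').T where
  app A := ⟨α.app A.obj, hα A.obj⟩
  naturality _ _ f := Tot.hom_ext (α.naturality f.1)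

theorem IsRestrictionFunctor.comp {C'' : Type u''} [Category.{v''} C''] [RestrictionCategory C'']
    {F : C ⥤ C'} {G : C' ⥤ C''} (hF : IsRestrictionFunctor F) (hG : IsRestrictionFunctor G) :
    IsRestrictionFunctor (F ⋙ G) := fun _ _ f =>
  (congrArg G.map (hF f)).trans (hG _)

theorem Tot.law_isMNatural (hD : D.IsTangentRestriction) (hD' : D'.IsTangentRestriction)
    {F : C ⥤ C'} (hF : IsRestrictionFunctor F) (α : D.T ⋙ F ⟶ F ⋙ D'.T) (hα : IsTotalTrans α) :
    IsMNatural (Tot.monics C) (Tot.law hD hD' hF α hα) :=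
  Tot.isMNatural (hD.T_res.comp hF) (hF.comp hD'.T_res) hα

theorem IsLaxTangent.tot (hD : D.IsTangentRestriction) (hD' : D'.IsTangentRestriction)
    {F : C ⥤ C'} (hF : IsRestrictionFunctor F) {α : D.T ⋙ F ⟶ F ⋙ D'.T} (hα : IsTotalTrans α)
    (h : IsLaxTangent D D' F α) :
    IsLaxTangent (D.tot hD) (D'.tot hD') (Tot.map F hF) (Tot.law hD hD' hF α hα) where
  additive A := .of_map_incl (h.additive A.obj)
  lift A := Tot.hom_ext (h.lift A.obj)
  flip A := Tot.hom_ext (h.flip A.obj)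

end Tot

/-! ### The 2-functor `Tot` -/

namespace SplitTangentRestrictionCat

/-- The tangent `M`-category of total maps of a tangent split restriction category. -/
def tot (X : SplitTangentRestrictionCat.{v, u}) : MTangentCat.{v, u} where
  C := Tot X.C
  D := X.D.tot X.isTangent
  isTangent := X.isTangent.tot_isTangent
  M := Tot.monics X.C
  isMonicSystem := X.isTangent.tot_isTangentMonicSystem X.isSplit

/-- The action of `Tot` on 1-morphisms. -/
def totMap {X Y : SplitTangentRestrictionCat.{v, u}} (f : X ⟶ Y) : X.tot ⟶ Y.tot where
  F := Tot.map f.F f.isRestriction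
  α := Tot.law X.isTangent Y.isTangent f.isRestriction f.α f.α_total
  isM := Tot.isMFunctor X.isSplit f.F f.isRestriction
  α_M := Tot.law_isMNatural X.isTangent Y.isTangent f.isRestriction f.α f.α_total
  isLax := f.isLax.tot X.isTangent Y.isTangent f.isRestriction f.α_total

/-- The action of `Tot` on 2-morphisms. -/
def totMap₂ {X Y : SplitTangentRestrictionCat.{v, u}} {f g : X ⟶ Y} (θ : f ⟶ g) :
    totMap f ⟶ totMap g where
  φ := Tot.mapTrans f.isRestriction g.isRestriction (Hom₂.φ θ) (Hom₂.isTotal θ)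
  isM := Tot.isMNatural f.isRestriction g.isRestriction (Hom₂.isTotal θ)
  isTangent A := Tot.hom_ext (Hom₂.isTangent θ A.obj)

theorem totMap_id (X : SplitTangentRestrictionCat.{v, u}) : totMap (𝟙 X) = 𝟙 X.tot := rfl

theorem totMap_comp {X Y Z : SplitTangentRestrictionCat.{v, u}} (f : X ⟶ Y) (g : Y ⟶ Z) :
    totMap (f ≫ g) = totMap f ≫ totMap g := rfl

/-- The 2-functor `Tot`. -/
def totFunctor : StrictPseudofunctor SplitTangentRestrictionCat.{v, u} MTangentCat.{v, u} :=
  StrictPseudofunctor.mk''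
    { obj := fun X => tot X
      map := fun f => totMap f
      map₂ := fun θ => totMap₂ θ
      map₂_id := fun _ => MTangentCat.hom₂_ext fun _ => rfl
      map₂_comp := fun _ _ => MTangentCat.hom₂_ext fun _ => rfl
      map_id := totMap_id
      map_comp := totMap_comp
      map₂_whisker_left := fun f _ _ θ => MTangentCat.hom₂_ext fun A => by
        rw [MTangentCat.comp_app, MTangentCat.comp_app,
          MTangentCat.eqToHom_app, MTangentCat.eqToHom_app]
        exact ((Category.id_comp _).trans (Category.comp_id _)).symm
      map₂_whisker_right := fun θ g => MTangentCat.hom₂_ext fun A => by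
        rw [MTangentCat.comp_app, MTangentCat.comp_app,
          MTangentCat.eqToHom_app, MTangentCat.eqToHom_app]
        exact ((Category.id_comp _).trans (Category.comp_id _)).symm }

end SplitTangentRestrictionCat

/-! ### Total partial maps -/

section Unit

variable {C : Type u} [Category.{v} C] {M : MorphismProperty C} [hM : IsMonicSystem M]

/-- Totality says that the restriction is the identity span, so the left leg may be taken to be the
identity. -/
theorem Par.exists_tot {A B : Tot (Par M)} (x : A ⟶ B) :
    ∃ f : A.obj.obj ⟶ B.obj.obj, x.1 = ParHom.tot f :=
  ParHom.exists_mk_of_res x.2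

variable (M) in
/-- A category is included into the total maps of its category of partial maps. -/
noncomputable def Par.toTot : C ⥤ Tot (Par M) where
  obj A := ⟨⟨A⟩⟩
  map f := ⟨ParHom.tot f, rfl⟩
  map_id _ := rfl
  map_comp f g := Tot.hom_ext (ParHom.tot_comp_tot f g).symm

variable (M) in
/-- The map underlying a total partial map. -/
noncomputable def Par.ofTot : Tot (Par M) ⥤ C where
  obj A := A.obj.obj
  map x := (Par.exists_tot x).choose
  map_id A := ParHom.tot_injective (M := M) (Par.exists_tot (𝟙 A)).choose_spec.symm
  map_comp x y := ParHom.tot_injective (M := M) ((Par.exists_tot (x ≫ y)).choose_spec.symm.trans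
    (Par.comp_eq_tot (Par.exists_tot x).choose_spec (Par.exists_tot y).choose_spec))

theorem Par.tot_ofTot_map {A B : Tot (Par M)} (x : A ⟶ B) :
    x.1 = ParHom.tot ((Par.ofTot M).map x) :=
  (Par.exists_tot x).choose_spec

theorem Par.ofTot_map_eq {A B : Tot (Par M)} {x : A ⟶ B} {f : A.obj.obj ⟶ B.obj.obj}
    (h : x.1 = ParHom.tot f) : (Par.ofTot M).map x = f :=
  ParHom.tot_injective (M := M) ((Par.tot_ofTot_map x).symm.trans h)

/-- Equivalences preserve all pullbacks, so for `toTot` and `ofTot` only membership in the classes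
of monics has to be checked. -/
instance : (Par.toTot M).IsEquivalence where
  faithful := ⟨fun h => ParHom.tot_injective (M := M) (congrArg Subtype.val h)⟩
  full := ⟨fun x => ⟨(Par.ofTot M).map x, Tot.hom_ext (Par.tot_ofTot_map x).symm⟩⟩
  essSurj := ⟨fun A => ⟨A.obj.obj, ⟨Iso.refl _⟩⟩⟩

instance : (Par.ofTot M).IsEquivalence where
  faithful := ⟨fun {_ _ x y} h => Tot.hom_ext (by
    rw [Par.tot_ofTot_map x, Par.tot_ofTot_map y, h])⟩
  full := ⟨fun f => ⟨⟨ParHom.tot f, rfl⟩, Par.ofTot_map_eq rfl⟩⟩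
  essSurj := ⟨fun A => ⟨⟨⟨A⟩⟩, ⟨Iso.refl _⟩⟩⟩

theorem Par.toTot_mem {A B : C} {m : A ⟶ B} (hm : M m) :
    Tot.monics (Par M) ((Par.toTot M).map m) := by
  refine ⟨ParHom.mk m hm (𝟙 A), ?_, ?_⟩
  · change ParHom.comp (ParHom.tot m) (ParHom.mk m hm (𝟙 A)) = ParHom.tot (𝟙 A)
    rw [ParHom.tot_comp (isPullback_self hm)]
    exact ParHom.mk_congr rfl (by simp)
  · change ParHom.comp (ParHom.mk m hm (𝟙 A)) (ParHom.tot m) = ParHom.res (ParHom.mk m hm (𝟙 A))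
    rw [ParHom.comp_tot, ParHom.res_mk]
    exact ParHom.mk_congr rfl (by simp)

/-- The restriction monics of `Par M` are no more than `M`: a retraction `[n, g]` of `f` forces `g`
to be invertible with `g ≫ f = n`, so `f` is an isomorphism followed by a member of `M`. -/
theorem Par.mem_of_isResRetraction {A B : C} {f : A ⟶ B} {r : ParHom M B A}
    (h₁ : ParHom.comp (ParHom.tot f) r = ParHom.tot (𝟙 A))
    (h₂ : ParHom.comp r (ParHom.tot f) = ParHom.res r) : M f := by
  induction r using ParHom.ind with
  | h S n hn g =>
    rw [ParHom.comp_tot, ParHom.res_mk] at h₂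
    have hgf : g ≫ f = n := ParHom.mk_inj h₂
    obtain ⟨P, a, b, hp, ha⟩ := hM.pullback f n hn
    rw [ParHom.tot_comp hp] at h₁
    -- Here `e` is both the projection `a` and the composite `b ≫ g`, which makes `e.inv ≫ b` the
    -- candidate inverse of `g`.
    obtain ⟨e, e₁, e₂⟩ := Quotient.exact h₁
    change e.hom ≫ 𝟙 A = a at e₁
    change e.hom ≫ 𝟙 A = b ≫ g at e₂
    have h₃ : (e.inv ≫ b) ≫ g = 𝟙 A := by
      rw [Category.assoc, ← e₂, Category.comp_id, e.inv_hom_id]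
    have h₄ : (e.inv ≫ b) ≫ n = f := by
      rw [Category.assoc, ← hp.w, ← Category.assoc, (Iso.inv_comp_eq e).2 e₁.symm,
        Category.id_comp]
    have := hM.mono n hn
    have h₅ : g ≫ e.inv ≫ b = 𝟙 S := by
      rw [← cancel_mono n, Category.assoc, h₄, hgf, Category.id_comp]
    rw [← h₄]
    exact hM.comp _ _ (hM.iso _ ⟨g, h₃, h₅⟩) hn

theorem Par.ofTot_mem {A B : Tot (Par M)} {m : A ⟶ B} (hm : Tot.monics (Par M) m) :
    M ((Par.ofTot M).map m) := by
  obtain ⟨r, h₁, h₂⟩ := hm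
  rw [Par.tot_ofTot_map] at h₁ h₂
  exact Par.mem_of_isResRetraction h₁ h₂

theorem Par.toTot_isMFunctor : IsMFunctor M (Tot.monics (Par M)) (Par.toTot M) where
  map_mem _ hm := Par.toTot_mem hm
  map_pullback _ h := h.map _

theorem Par.ofTot_isMFunctor : IsMFunctor (Tot.monics (Par M)) M (Par.ofTot M) where
  map_mem _ hm := Par.ofTot_mem hm
  map_pullback _ h := h.map _

end Unit

/-- The comparison 1-morphisms of the unit and the counit have identity distributive laws. Their lax
axioms then have the shapes of this lemma and the two that follow, up to unfolding of definitions.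
-/
theorem comp_id_map_id {K : Type u} [Category.{v} K] {T : K ⥤ K} {A B : K} {f g : A ⟶ T.obj B}
    (h : f = g) : f ≫ 𝟙 (T.obj B) ≫ T.map (𝟙 B) = 𝟙 A ≫ g := by
  simp [h]

theorem comp_id_map_id' {K : Type u} [Category.{v} K] {T : K ⥤ K} {A B : K}
    {f g : T.obj A ⟶ T.obj B} (h : f = g) :
    f ≫ 𝟙 (T.obj B) ≫ T.map (𝟙 B) = 𝟙 (T.obj A) ≫ T.map (𝟙 A) ≫ g := by
  simp [h]

theorem id_comp_eq_comp_id {K : Type u} [Category.{v} K] {A B : K} {f g : A ⟶ B} (h : f = g) :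
    𝟙 A ≫ f = g ≫ 𝟙 B := by
  simp [h]

theorem IsMNatural.of_isIso_app {C : Type u} [Category.{v} C] {C' : Type u'} [Category.{v'} C']
    {M : MorphismProperty C} {F G : C ⥤ C'} (φ : F ⟶ G) (h : ∀ A, IsIso (φ.app A)) :
    IsMNatural M φ :=
  have := NatIso.isIso_of_isIso_app φ
  IsMNatural.of_isIso φ

/-! ### The unit: a tangent `M`-category and the total maps of its partial maps. -/

namespace MTangentCat

/-- The 1-morphism from a tangent `M`-category to the total maps of its partial maps. -/
noncomputable def toTotPar (X : MTangentCat.{max u v, u}) : X ⟶ X.par.tot where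
  F := Par.toTot X.M
  α :=
    -- Both composites agree on objects by definition, so the comparison can be the identity;
    -- naturality is the compatibility of `tot` with `Par.map`.
    { app := fun A => 𝟙 ((Par.toTot X.M).obj (X.D.T.obj A))
      naturality := fun A B f => (Category.comp_id _).trans
        (Eq.trans (Tot.hom_ext (by exact (ParHom.map_tot X.isMStructure.T f).symm))
          (Category.id_comp _).symm) }
  isM := Par.toTot_isMFunctor
  α_M := IsMNatural.of_isIso_app _ fun A =>
    IsIso.id ((Par.toTot X.M).obj (X.D.T.obj A))
  isLax :=
    { additive := fun A =>
        ⟨id_comp_eq_comp_id (Tot.hom_ext (X.D.par_p_app X.isMStructure ⟨A⟩)),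
          (id_comp_eq_comp_id (Tot.hom_ext (X.D.par_z_app X.isMStructure ⟨A⟩))).symm,
          𝟙 _, id_comp_eq_comp_id rfl, id_comp_eq_comp_id rfl, id_comp_eq_comp_id rfl⟩
      lift := fun A => comp_id_map_id (T := X.par.tot.D.T)
        (B := (Par.toTot X.M).obj (X.D.T.obj A)) (Tot.hom_ext (X.D.par_l_app X.isMStructure ⟨A⟩).symm)
      flip := fun A => comp_id_map_id' (T := X.par.tot.D.T)
        (A := (Par.toTot X.M).obj (X.D.T.obj A)) (B := (Par.toTot X.M).obj (X.D.T.obj A))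
        (Tot.hom_ext (X.D.par_c_app X.isMStructure ⟨A⟩).symm) }

/-- The inverse of `toTotPar`. -/
noncomputable def ofTotPar (X : MTangentCat.{max u v, u}) : X.par.tot ⟶ X where
  F := Par.ofTot X.M
  α :=
    { app := fun A => 𝟙 (X.D.T.obj A.obj.obj)
      naturality := fun _ _ f => (Category.comp_id _).trans
        (Eq.trans (Par.ofTot_map_eq
          (Par.map_eq_tot X.isMStructure.T (Par.tot_ofTot_map f)))
          (Category.id_comp _).symm) }
  isM := Par.ofTot_isMFunctor
  α_M := IsMNatural.of_isIso_app _ fun A => IsIso.id (X.D.T.obj A.obj.obj)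
  isLax :=
    { additive := fun A =>
        have hp : (Par.ofTot X.M).map (X.par.tot.D.p.app A) = X.D.p.app A.obj.obj :=
          Par.ofTot_map_eq (X.D.par_p_app X.isMStructure A.obj)
        have hz : (Par.ofTot X.M).map (X.par.tot.D.z.app A) = X.D.z.app A.obj.obj :=
          Par.ofTot_map_eq (X.D.par_z_app X.isMStructure A.obj)
        have hπ₁ : (Par.ofTot X.M).map (X.par.tot.D.π₁.app A) = X.D.π₁.app A.obj.obj :=
          Par.ofTot_map_eq rfl
        have hπ₂ : (Par.ofTot X.M).map (X.par.tot.D.π₂.app A) = X.D.π₂.app A.obj.obj :=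
          Par.ofTot_map_eq rfl
        have hs : (Par.ofTot X.M).map (X.par.tot.D.s.app A) = X.D.s.app A.obj.obj :=
          Par.ofTot_map_eq rfl
        ⟨id_comp_eq_comp_id hp.symm, (id_comp_eq_comp_id hz.symm).symm, 𝟙 _,
          id_comp_eq_comp_id hπ₁.symm, id_comp_eq_comp_id hπ₂.symm, id_comp_eq_comp_id hs.symm⟩
      lift := fun A =>
        have hl : (Par.ofTot X.M).map (X.par.tot.D.l.app A) = X.D.l.app A.obj.obj :=
          Par.ofTot_map_eq (X.D.par_l_app X.isMStructure A.obj)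
        comp_id_map_id (T := X.D.T) (B := X.D.T.obj A.obj.obj) hl
      flip := fun A =>
        have hc : (Par.ofTot X.M).map (X.par.tot.D.c.app A) = X.D.c.app A.obj.obj :=
          Par.ofTot_map_eq (X.D.par_c_app X.isMStructure A.obj)
        comp_id_map_id' (T := X.D.T) (A := X.D.T.obj A.obj.obj) (B := X.D.T.obj A.obj.obj) hc }

theorem toTotPar_comp_ofTotPar (X : MTangentCat.{max u v, u}) :
    X.toTotPar ≫ X.ofTotPar = 𝟙 X := by
  refine hom_hext (fun _ => rfl) (fun a => heq_of_eq ?_) (fun A => heq_of_eq ?_)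
  · change (Par.ofTot X.M).map ((Par.toTot X.M).map a) = a
    exact Par.ofTot_map_eq rfl
  · change (Par.ofTot X.M).map (𝟙 ((Par.toTot X.M).obj (X.D.T.obj A))) ≫ 𝟙 (X.D.T.obj A) =
      𝟙 (X.D.T.obj A)
    exact (Category.comp_id _).trans ((Par.ofTot X.M).map_id _)

theorem ofTotPar_comp_toTotPar (X : MTangentCat.{max u v, u}) :
    X.ofTotPar ≫ X.toTotPar = 𝟙 X.par.tot := by
  refine hom_hext (fun _ => rfl) (fun a => heq_of_eq ?_) (fun A => heq_of_eq ?_)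
  · change (Par.toTot X.M).map ((Par.ofTot X.M).map a) = a
    exact Tot.hom_ext (Par.tot_ofTot_map a).symm
  · change (Par.toTot X.M).map (𝟙 (X.D.T.obj A.obj.obj)) ≫
      𝟙 ((Par.toTot X.M).obj (X.D.T.obj A.obj.obj)) = 𝟙 _
    exact (Category.comp_id _).trans ((Par.toTot X.M).map_id _)

theorem toTotPar_naturality {X Y : MTangentCat.{max u v, u}} (f : X ⟶ Y) :
    f ≫ Y.toTotPar = X.toTotPar ≫ SplitTangentRestrictionCat.totMap (parMap f) := by
  refine hom_hext (fun _ => rfl) (fun a => heq_of_eq ?_) (fun A => heq_of_eq ?_)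
  · exact Tot.hom_ext (by exact (ParHom.map_tot f.isM a).symm)
  · refine Tot.hom_ext ?_
    change ParHom.comp (ParHom.tot (f.α.app A)) (ParHom.tot (𝟙 (Y.D.T.obj (f.F.obj A)))) =
      ParHom.comp (ParHom.map f.isM (ParHom.tot (𝟙 (X.D.T.obj A)))) ((parMap f).α.app ⟨A⟩)
    refine (ParHom.comp_id _).trans (Eq.symm ((congrArg (fun t => ParHom.comp t _)
      ((Par.map f.F f.isM).map_id ⟨X.D.T.obj A⟩)).trans ?_))
    exact (ParHom.id_comp _).trans (parMap_α_app f ⟨A⟩)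

theorem toTotPar_naturality₂ {X Y : MTangentCat.{max u v, u}} {f g : X ⟶ Y} (θ : f ⟶ g) :
    whiskerRight θ Y.toTotPar ≫ eqToHom (toTotPar_naturality g) =
      eqToHom (toTotPar_naturality f) ≫
        whiskerLeft X.toTotPar (SplitTangentRestrictionCat.totMap₂ (parMap₂ θ)) :=
  hom₂_ext fun A => by
    rw [comp_app, comp_app, eqToHom_app, eqToHom_app]
    exact (Category.comp_id _).trans (Category.id_comp _).symm

/-- The unit of the 2-equivalence between `Par` and `Tot`. -/
noncomputable def unitIso :
    TwoNatIso (StrictPseudofunctor.id MTangentCat.{max u v, u})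
      (parFunctor.{v, u}.comp SplitTangentRestrictionCat.totFunctor) where
  hom X := toTotPar X
  inv X := ofTotPar X
  hom_inv_id X := toTotPar_comp_ofTotPar X
  inv_hom_id X := ofTotPar_comp_toTotPar X
  naturality f := toTotPar_naturality f
  naturality₂ θ := toTotPar_naturality₂ θ

end MTangentCat

/-! ### Partial maps of the category of total maps -/

section Counit

open RestrictionCategory

variable {C : Type u} [Category.{v} C] [RestrictionCategory C]

theorem Tot.exists_isResRetraction {A B : Tot C} {m : A ⟶ B} (hm : Tot.monics C m) :
    ∃ r, IsResRetraction m.1 r := hm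

theorem IsResRetraction.of_isIso {A B : Tot C} (e : A ≅ B) : IsResRetraction e.hom.1 e.inv.1 :=
  ⟨congrArg Subtype.val e.hom_inv_id,
    (show e.inv.1 ≫ e.hom.1 = 𝟙 _ from congrArg Subtype.val e.inv_hom_id).trans e.inv.2.symm⟩

theorem IsResRetraction.id (A : C) : IsResRetraction (𝟙 A) (𝟙 A) :=
  ⟨Category.id_comp _, (Category.id_comp _).trans (isTotal_id A).symm⟩

/-- The map of `C` represented by a span of total maps. -/
noncomputable def PSpan.toHom {A B : Tot C} (x : PSpan (Tot.monics C) A B) : A.obj ⟶ B.obj :=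
  x.mem.choose ≫ x.f.1

/-- The chosen retraction in `toHom` may be replaced by any other, by uniqueness. -/
theorem PSpan.toHom_eq {A B : Tot C} (x : PSpan (Tot.monics C) A B) {r : A.obj ⟶ x.dom.obj}
    (hr : IsResRetraction x.m.1 r) : x.toHom = r ≫ x.f.1 := by
  rw [PSpan.toHom, x.mem.choose_spec.unique hr]

theorem PSpan.toHom_congr {A B : Tot C} {x y : PSpan (Tot.monics C) A B} (h : x.Rel y) :
    x.toHom = y.toHom := by
  obtain ⟨e, h₁, h₂⟩ := h
  obtain ⟨r, hr⟩ := y.mem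
  have h := (IsResRetraction.of_isIso e).comp hr
  have h₁' : e.hom.1 ≫ y.m.1 = x.m.1 := congrArg Subtype.val h₁
  have h₂' : e.hom.1 ≫ y.f.1 = x.f.1 := congrArg Subtype.val h₂
  have h₃ : e.inv.1 ≫ e.hom.1 = 𝟙 _ := congrArg Subtype.val e.inv_hom_id
  rw [h₁'] at h
  rw [x.toHom_eq h, y.toHom_eq hr, ← h₂', Category.assoc, ← Category.assoc e.inv.1, h₃,
    Category.id_comp]

/-- The map of `C` represented by a partial map of `Tot C`. -/
noncomputable def ParHom.toHom {A B : Tot C} (x : ParHom (Tot.monics C) A B) : A.obj ⟶ B.obj :=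
  Quotient.lift PSpan.toHom (fun _ _ h => PSpan.toHom_congr h) x

theorem ParHom.toHom_mk {A B S : Tot C} {m : S ⟶ A} {hm : Tot.monics C m} {f : S ⟶ B}
    {r : A.obj ⟶ S.obj} (hr : IsResRetraction m.1 r) :
    ParHom.toHom (ParHom.mk m hm f) = r ≫ f.1 :=
  PSpan.toHom_eq ⟨S, m, f, hm⟩ hr

/-- If `r ≫ f = s ≫ g` with `f` and `g` total, then `r` and `s` have the same restriction. So `m`
and `n` are the same subobject, with `m ≫ s` and `n ≫ r` as mutually inverse comparisons. -/
theorem ParHom.toHom_injective {A B : Tot C} {x y : ParHom (Tot.monics C) A B}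
    (h : x.toHom = y.toHom) : x = y := by
  induction x using ParHom.ind with
  | h S m hm f =>
  induction y using ParHom.ind with
  | h R n hn g =>
    obtain ⟨r, hr⟩ := Tot.exists_isResRetraction hm
    obtain ⟨s, hs⟩ := Tot.exists_isResRetraction hn
    rw [ParHom.toHom_mk hr, ParHom.toHom_mk hs] at h
    have hrs : RestrictionCategory.res r = RestrictionCategory.res s := by
      rw [← res_comp_total r f.2, h, res_comp_total s g.2]
    have e₁ : (m.1 ≫ s) ≫ n.1 = m.1 := by
      rw [Category.assoc, hs.2, ← hrs, ← hr.2, ← Category.assoc, hr.1, Category.id_comp]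
    have e₂ : (n.1 ≫ r) ≫ m.1 = n.1 := by
      rw [Category.assoc, hr.2, hrs, ← hs.2, ← Category.assoc, hs.1, Category.id_comp]
    have e₃ : (m.1 ≫ s) ≫ g.1 = f.1 := by
      rw [Category.assoc, ← h, ← Category.assoc, hr.1, Category.id_comp]
    have hm' := Tot.monics_mono ⟨r, hr⟩
    have hn' := Tot.monics_mono ⟨s, hs⟩
    let a : S ⟶ R := ⟨m.1 ≫ s, isTotal_of_comp_eq e₁ m.2⟩
    let b : R ⟶ S := ⟨n.1 ≫ r, isTotal_of_comp_eq e₂ n.2⟩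
    have ha : a ≫ n = m := Tot.hom_ext e₁
    have hb : b ≫ m = n := Tot.hom_ext e₂
    refine ParHom.mk_eq ⟨a, b, ?_, ?_⟩ ha (Tot.hom_ext e₃)
    · rw [← cancel_mono m, Category.assoc, hb, ha, Category.id_comp]
    · rw [← cancel_mono n, Category.assoc, ha, hb, Category.id_comp]

/-- Splitting `res f` as `q ≫ n` makes `f` total on its domain, and `f = q ≫ (n ≫ f)`. -/
theorem ParHom.toHom_surjective (hC : IsSplit C) {A B : Tot C} (f : A.obj ⟶ B.obj) :
    ∃ x : ParHom (Tot.monics C) A B, x.toHom = f := by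
  obtain ⟨S, n, q, h₁, h₂⟩ := hC f
  have hn : IsTotal n := isTotal_of_comp_eq_id h₁
  have hq : RestrictionCategory.res q = RestrictionCategory.res f := by
    rw [← TangentCats.res_res f, ← h₂, res_comp_total q hn]
  -- Since `n ≫ res f = n`, axiom `comp_res` gives `res (n ≫ f) ≫ n = n`, and the section `n` is
  -- cancelled by composing with `q`.
  have ht : IsTotal (n ≫ f) := by
    have e : RestrictionCategory.res (n ≫ f) ≫ n = n := by
      rw [← comp_res, ← h₂, ← Category.assoc, h₁, Category.id_comp]
    have e' := congrArg (· ≫ q) e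
    rwa [Category.assoc, h₁, Category.comp_id] at e'
  have hr : IsResRetraction n q := ⟨h₁, h₂.trans hq.symm⟩
  refine ⟨ParHom.mk (S := ⟨S⟩) ⟨n, hn⟩ ⟨q, hr⟩ ⟨n ≫ f, ht⟩, (ParHom.toHom_mk hr).trans ?_⟩
  change q ≫ n ≫ f = f
  rw [← Category.assoc, h₂, res_comp_self]

theorem ParHom.toHom_res {A B : Tot C} (x : ParHom (Tot.monics C) A B) :
    (ParHom.res x).toHom = RestrictionCategory.res x.toHom := by
  induction x using ParHom.ind with
  | h S m hm f =>
    obtain ⟨r, hr⟩ := Tot.exists_isResRetraction hm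
    rw [ParHom.res_mk, ParHom.toHom_mk hr, ParHom.toHom_mk hr, hr.2, res_comp_total r f.2]

theorem ParHom.toHom_map {C' : Type u'} [Category.{v'} C'] [RestrictionCategory C'] {F : C ⥤ C'}
    (hF : IsRestrictionFunctor F) (hF' : IsMFunctor (Tot.monics C) (Tot.monics C') (Tot.map F hF))
    {A B : Tot C} (x : ParHom (Tot.monics C) A B) :
    (ParHom.map hF' x).toHom = F.map x.toHom := by
  induction x using ParHom.ind with
  | h S m hm f =>
    obtain ⟨r, hr⟩ := Tot.exists_isResRetraction hm
    rw [ParHom.map_mk, ParHom.toHom_mk (hr.map hF), ParHom.toHom_mk hr, F.map_comp]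
    rfl

variable [IsMonicSystem (Tot.monics C)]

theorem ParHom.toHom_tot {A B : Tot C} (f : A ⟶ B) :
    ParHom.toHom (ParHom.tot f : ParHom (Tot.monics C) A B) = f.1 :=
  (ParHom.toHom_mk (IsResRetraction.id A.obj)).trans (Category.id_comp f.1)

/-- The pullback used to compose spans is a retract square, and its equation `r ≫ b = f ≫ s` is
exactly what identifies the two composites. -/
theorem ParHom.toHom_comp (hC : IsSplit C) {A B E : Tot C} (x : ParHom (Tot.monics C) A B)
    (y : ParHom (Tot.monics C) B E) : (ParHom.comp x y).toHom = x.toHom ≫ y.toHom := by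
  induction x using ParHom.ind with
  | h S m hm f =>
  induction y using ParHom.ind with
  | h R n hn g =>
    obtain ⟨P, a, b, hp, -⟩ := IsMonicSystem.pullback f n hn
    obtain ⟨-, r, s, hr, hs, e⟩ := Tot.isRetractSquare_of_isPullback hC hn hp
    obtain ⟨t, ht⟩ := Tot.exists_isResRetraction hm
    rw [ParHom.comp_mk hp, ParHom.toHom_mk (hr.comp ht), ParHom.toHom_mk ht, ParHom.toHom_mk hs,
      Tot.comp_val, Category.assoc, Category.assoc, ← Category.assoc r, e, Category.assoc]

/-- The functor from partial maps of `Tot C` to `C`. -/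
noncomputable def Par.eval (hC : IsSplit C) : Par (Tot.monics C) ⥤ C where
  obj A := A.obj.obj
  map x := ParHom.toHom x
  map_id A := ParHom.toHom_tot (𝟙 A.obj)
  map_comp x y := ParHom.toHom_comp hC x y

/-- The inverse of `Par.eval`. -/
noncomputable def Par.coeval (hC : IsSplit C) : C ⥤ Par (Tot.monics C) where
  obj A := ⟨⟨A⟩⟩
  map {A B} f := (ParHom.toHom_surjective (A := ⟨A⟩) (B := ⟨B⟩) hC f).choose
  map_id A := ParHom.toHom_injective
    ((ParHom.toHom_surjective (A := ⟨A⟩) (B := ⟨A⟩) hC (𝟙 A)).choose_spec.trans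
      (ParHom.toHom_tot (𝟙 (⟨A⟩ : Tot C))).symm)
  map_comp {A B E} f g := ParHom.toHom_injective
    ((ParHom.toHom_surjective (A := ⟨A⟩) (B := ⟨E⟩) hC (f ≫ g)).choose_spec.trans
      ((ParHom.toHom_comp hC _ _).trans (congrArg₂ (· ≫ ·)
        (ParHom.toHom_surjective (A := ⟨A⟩) (B := ⟨B⟩) hC f).choose_spec
        (ParHom.toHom_surjective (A := ⟨B⟩) (B := ⟨E⟩) hC g).choose_spec)).symm)

theorem Par.toHom_coeval_map (hC : IsSplit C) {A B : C} (f : A ⟶ B) :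
    ParHom.toHom ((Par.coeval hC).map f) = f :=
  (ParHom.toHom_surjective (A := ⟨A⟩) (B := ⟨B⟩) hC f).choose_spec

/-- `Par.coeval` is defined by choice on maps; injectivity of `toHom` allows any span representing
`f` to be used in its place. -/
theorem Par.coeval_map_eq (hC : IsSplit C) {A B : C} {f : A ⟶ B}
    {x : (Par.coeval hC).obj A ⟶ (Par.coeval hC).obj B} (h : ParHom.toHom x = f) :
    (Par.coeval hC).map f = x :=
  ParHom.toHom_injective ((Par.toHom_coeval_map hC f).trans h.symm)

theorem Par.coeval_isRestrictionFunctor (hC : IsSplit C) :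
    IsRestrictionFunctor (Par.coeval hC) := fun _ _ f =>
  Par.coeval_map_eq hC ((ParHom.toHom_res ((Par.coeval hC).map f)).trans
    (congrArg res (Par.toHom_coeval_map hC f)))

theorem ParHom.toHom_of_eq_tot {A B : Tot C} {x : ParHom (Tot.monics C) A B} {f : A ⟶ B}
    (h : x = ParHom.tot f) : x.toHom = f.1 := by
  rw [h, ParHom.toHom_tot]

end Counit

/-! ### The counit: partial maps of the total maps, and the original restriction category. -/

namespace SplitTangentRestrictionCat

instance (X : SplitTangentRestrictionCat.{v, u}) : IsMonicSystem (Tot.monics X.C) :=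
  X.tot.isMonicSystem.isMonicSystem

/-- The 1-morphism from the partial maps of the total maps of a tangent split restriction category
to the category itself. -/
noncomputable def ofParTot (X : SplitTangentRestrictionCat.{max u v, u}) :
    (X.tot.par : SplitTangentRestrictionCat.{max u v, u}) ⟶ X where
  F := Par.eval X.isSplit
  α :=
    { app := fun A => 𝟙 (X.D.T.obj A.obj.obj)
      naturality := fun _ _ f => (Category.comp_id _).trans
        (Eq.trans (ParHom.toHom_map X.isTangent.T_res X.tot.isMStructure.T f)
          (Category.id_comp _).symm) }
  isRestriction _ _ x := ParHom.toHom_res x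
  α_total _ := isTotal_id _
  isLax :=
    { additive := fun A =>
        have hp : ParHom.toHom (X.tot.par.D.p.app A) = X.D.p.app A.obj.obj :=
          ParHom.toHom_of_eq_tot (X.tot.D.par_p_app X.tot.isMStructure A)
        have hz : ParHom.toHom (X.tot.par.D.z.app A) = X.D.z.app A.obj.obj :=
          ParHom.toHom_of_eq_tot (X.tot.D.par_z_app X.tot.isMStructure A)
        have hπ₁ : ParHom.toHom (X.tot.par.D.π₁.app A) = X.D.π₁.app A.obj.obj :=
          ParHom.toHom_tot (X.tot.D.π₁.app A.obj)
        have hπ₂ : ParHom.toHom (X.tot.par.D.π₂.app A) = X.D.π₂.app A.obj.obj :=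
          ParHom.toHom_tot (X.tot.D.π₂.app A.obj)
        have hs : ParHom.toHom (X.tot.par.D.s.app A) = X.D.s.app A.obj.obj :=
          ParHom.toHom_tot (X.tot.D.s.app A.obj)
        ⟨id_comp_eq_comp_id hp.symm, (id_comp_eq_comp_id hz.symm).symm, 𝟙 _,
          id_comp_eq_comp_id hπ₁.symm, id_comp_eq_comp_id hπ₂.symm, id_comp_eq_comp_id hs.symm⟩
      lift := fun A =>
        have hl : ParHom.toHom (X.tot.par.D.l.app A) = X.D.l.app A.obj.obj :=
          ParHom.toHom_of_eq_tot (X.tot.D.par_l_app X.tot.isMStructure A)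
        comp_id_map_id (T := X.D.T) (B := X.D.T.obj A.obj.obj) hl
      flip := fun A =>
        have hc : ParHom.toHom (X.tot.par.D.c.app A) = X.D.c.app A.obj.obj :=
          ParHom.toHom_of_eq_tot (X.tot.D.par_c_app X.tot.isMStructure A)
        comp_id_map_id' (T := X.D.T) (A := X.D.T.obj A.obj.obj) (B := X.D.T.obj A.obj.obj) hc }

/-- The inverse of `ofParTot`. -/
noncomputable def toParTot (X : SplitTangentRestrictionCat.{max u v, u}) :
    X ⟶ (X.tot.par : SplitTangentRestrictionCat.{max u v, u}) where
  F := Par.coeval X.isSplit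
  α :=
    { app := fun A => 𝟙 ((Par.coeval X.isSplit).obj (X.D.T.obj A))
      naturality := fun _ _ f => (Category.comp_id _).trans
        (Eq.trans (Par.coeval_map_eq X.isSplit
          ((ParHom.toHom_map X.isTangent.T_res X.tot.isMStructure.T _).trans
            (congrArg X.D.T.map (Par.toHom_coeval_map X.isSplit f))))
          (Category.id_comp (X.tot.par.D.T.map ((Par.coeval X.isSplit).map f))).symm) }
  isRestriction := Par.coeval_isRestrictionFunctor X.isSplit
  α_total _ := isTotal_id _
  isLax :=
    { additive := fun A =>
        have hp : (Par.coeval X.isSplit).map (X.D.p.app A) = X.tot.par.D.p.app ⟨⟨A⟩⟩ :=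
          Par.coeval_map_eq X.isSplit
            (ParHom.toHom_of_eq_tot (X.tot.D.par_p_app X.tot.isMStructure ⟨⟨A⟩⟩))
        have hz : (Par.coeval X.isSplit).map (X.D.z.app A) = X.tot.par.D.z.app ⟨⟨A⟩⟩ :=
          Par.coeval_map_eq X.isSplit
            (ParHom.toHom_of_eq_tot (X.tot.D.par_z_app X.tot.isMStructure ⟨⟨A⟩⟩))
        have hπ₁ : (Par.coeval X.isSplit).map (X.D.π₁.app A) = X.tot.par.D.π₁.app ⟨⟨A⟩⟩ :=
          Par.coeval_map_eq X.isSplit (ParHom.toHom_tot (X.tot.D.π₁.app ⟨A⟩))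
        have hπ₂ : (Par.coeval X.isSplit).map (X.D.π₂.app A) = X.tot.par.D.π₂.app ⟨⟨A⟩⟩ :=
          Par.coeval_map_eq X.isSplit (ParHom.toHom_tot (X.tot.D.π₂.app ⟨A⟩))
        have hs : (Par.coeval X.isSplit).map (X.D.s.app A) = X.tot.par.D.s.app ⟨⟨A⟩⟩ :=
          Par.coeval_map_eq X.isSplit (ParHom.toHom_tot (X.tot.D.s.app ⟨A⟩))
        ⟨id_comp_eq_comp_id hp.symm, (id_comp_eq_comp_id hz.symm).symm, 𝟙 _,
          id_comp_eq_comp_id hπ₁.symm, id_comp_eq_comp_id hπ₂.symm, id_comp_eq_comp_id hs.symm⟩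
      lift := fun A =>
        have hl : (Par.coeval X.isSplit).map (X.D.l.app A) = X.tot.par.D.l.app ⟨⟨A⟩⟩ :=
          Par.coeval_map_eq X.isSplit
            (ParHom.toHom_of_eq_tot (X.tot.D.par_l_app X.tot.isMStructure ⟨⟨A⟩⟩))
        comp_id_map_id (T := X.tot.par.D.T) (B := (Par.coeval X.isSplit).obj (X.D.T.obj A)) hl
      flip := fun A =>
        have hc : (Par.coeval X.isSplit).map (X.D.c.app A) = X.tot.par.D.c.app ⟨⟨A⟩⟩ :=
          Par.coeval_map_eq X.isSplit
            (ParHom.toHom_of_eq_tot (X.tot.D.par_c_app X.tot.isMStructure ⟨⟨A⟩⟩))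
        comp_id_map_id' (T := X.tot.par.D.T) (A := (Par.coeval X.isSplit).obj (X.D.T.obj A))
          (B := (Par.coeval X.isSplit).obj (X.D.T.obj A)) hc }

theorem ofParTot_comp_toParTot (X : SplitTangentRestrictionCat.{max u v, u}) :
    ofParTot.{v, u} X ≫ toParTot.{v, u} X = 𝟙 _ := by
  refine hom_hext (fun _ => rfl) (fun a => heq_of_eq ?_) (fun A => heq_of_eq ?_)
  · change (Par.coeval X.isSplit).map (ParHom.toHom a) = a
    exact Par.coeval_map_eq X.isSplit rfl
  · change (Par.coeval X.isSplit).map (𝟙 (X.D.T.obj A.obj.obj)) ≫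
      𝟙 ((Par.coeval X.isSplit).obj (X.D.T.obj A.obj.obj)) = 𝟙 _
    exact (Category.comp_id _).trans ((Par.coeval X.isSplit).map_id _)

theorem toParTot_comp_ofParTot (X : SplitTangentRestrictionCat.{max u v, u}) :
    toParTot.{v, u} X ≫ ofParTot.{v, u} X = 𝟙 X := by
  refine hom_hext (fun _ => rfl) (fun a => heq_of_eq ?_) (fun A => heq_of_eq ?_)
  · exact Par.toHom_coeval_map X.isSplit a
  · change (Par.eval X.isSplit).map (𝟙 ((Par.coeval X.isSplit).obj (X.D.T.obj A))) ≫
      𝟙 (X.D.T.obj A) = 𝟙 (X.D.T.obj A)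
    exact (Category.comp_id _).trans ((Par.eval X.isSplit).map_id _)

theorem ofParTot_naturality {X Y : SplitTangentRestrictionCat.{max u v, u}} (f : X ⟶ Y) :
    MTangentCat.parMap (totMap f) ≫ ofParTot.{v, u} Y = ofParTot.{v, u} X ≫ f := by
  refine hom_hext (fun _ => rfl) (fun a => heq_of_eq ?_) (fun A => heq_of_eq ?_)
  · exact ParHom.toHom_map f.isRestriction (totMap f).isM a
  · have h : ParHom.toHom ((MTangentCat.parMap (totMap f)).α.app A) = f.α.app A.obj.obj :=
      ParHom.toHom_of_eq_tot (MTangentCat.parMap_α_app (totMap f) A)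
    change ParHom.toHom ((MTangentCat.parMap (totMap f)).α.app A) ≫
      𝟙 (Y.D.T.obj (f.F.obj A.obj.obj)) = f.F.map (𝟙 (X.D.T.obj A.obj.obj)) ≫ f.α.app A.obj.obj
    rw [f.F.map_id, h]
    exact (Category.comp_id _).trans (Category.id_comp _).symm

theorem ofParTot_naturality₂ {X Y : SplitTangentRestrictionCat.{max u v, u}} {f g : X ⟶ Y}
    (θ : f ⟶ g) :
    whiskerRight (MTangentCat.parMap₂ (totMap₂ θ)) (ofParTot.{v, u} Y) ≫
      eqToHom (ofParTot_naturality g) =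
    eqToHom (ofParTot_naturality f) ≫ whiskerLeft (ofParTot.{v, u} X) θ :=
  hom₂_ext fun A => by
    rw [comp_app, comp_app, eqToHom_app, eqToHom_app]
    refine (Category.comp_id _).trans (Eq.trans ?_ (Category.id_comp _).symm)
    exact ParHom.toHom_tot ((MTangentCat.Hom₂.φ (totMap₂ θ)).app A.obj)

/-- The counit of the 2-equivalence between `Par` and `Tot`. -/
noncomputable def counitIso :
    TwoNatIso (totFunctor.{max u v, u}.comp MTangentCat.parFunctor.{v, u})
      (StrictPseudofunctor.id SplitTangentRestrictionCat.{max u v, u}) where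
  hom X := ofParTot.{v, u} X
  inv X := toParTot.{v, u} X
  hom_inv_id X := ofParTot_comp_toParTot X
  inv_hom_id X := toParTot_comp_ofParTot X
  naturality f := ofParTot_naturality f
  naturality₂ θ := ofParTot_naturality₂ θ

end SplitTangentRestrictionCat

end TangentCats

/-- A partial map carries a domain object, so the hom-sets of `Par M` live in `max u v`. Taking
hom-universe `max u v` on both sides makes `Par` and `Tot` functors between the same two
2-categories. -/
theorem mainTheorem4 :
    ∃ E : TangentCats.TwoEquivalence
        TangentCats.MTangentCat.{max u v, u} TangentCats.SplitTangentRestrictionCat.{max u v, u},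
      ∀ X : TangentCats.MTangentCat.{max u v, u},
        ∃ (h : X.D.IsMStructure X.M) (h' : (X.D.par X.M h).IsTangentRestriction),
          E.functor.obj X =
            { C := TangentCats.Par X.M
              isSplit := TangentCats.Par.isSplit X.M
              D := X.D.par X.M h
              isTangent := h' } :=
  ⟨{ functor := TangentCats.MTangentCat.parFunctor.{v, u}
     inverse := TangentCats.SplitTangentRestrictionCat.totFunctor.{max u v, u}
     unit := TangentCats.MTangentCat.unitIso.{v, u}
     counit := TangentCats.SplitTangentRestrictionCat.counitIso.{v, u} },
    -- `par` was defined with exactly these fields, so the description of the image of `X` is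
    -- definitional.
    fun X => ⟨X.isMStructure, X.isTangent.par X.D X.isMStructure, rfl⟩⟩
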